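/- **Setting.** Let $k$ be a commutative ring, $A$ a $k$-algebra and $\mathfrak C$ an $A$-coring (a comonoid in $A$-bimodules on which $k$ acts centrally), with comultiplication $\Delta(c)=c_{(1)}\otimes_A c_{(2)}$ and counit $\varepsilon$. Let ${}^*\mathfrak C={}_A\mathrm{Hom}(\mathfrak C,A)$ and $\mathfrak C^*=\mathrm{Hom}_A(\mathfrak C,A)$ be the dual rings, with $(f*g)(c)=g(c_{(1)}f(c_{(2)}))$ in ${}^*\mathfrak C$, $(f*g)(c)=f(g(c_{(1)})c_{(2)})$ in $\mathfrak C^*$, and unit $\varepsilon$. Then $\mathfrak C$ is a $\mathfrak C^*$-${}^*\mathfrak C$-bimodule by $f\cdot c=f(c_{(1)})c_{(2)}$ and $c\cdot f=c_{(1)}f(c_{(2)})$. The finite topology on $\mathfrak C^*$ and ${}^*\mathfrak C$ is the topology of pointwise convergence, $A$ being discrete. A module $X$ is *weakly locally projective* if for every finitely generated submodule $E\subseteq X$, every surjective linear map $g:M\to N$ and every linear map $f:X\to N$ there is a linear map $h:X\to M$ with $g\circ h|_E=f|_E$. Let $S=\mathrm{Rat}({}^*\mathfrak C)$ be the set of $s\in{}^*\mathfrak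 C$ for which there is $\sum_i s_i\otimes_A c_i\in{}^*\mathfrak C\otimes_A\mathfrak C$ with $s*g=\sum_i s_i g(c_i)$ for all $g\in{}^*\mathfrak C$, and let $R=\mathrm{Rat}(\mathfrak C^*)$ be the set of $r\in\mathfrak C^*$ for which there is $\sum_i c_i\otimes_A r_i\in\mathfrak C\otimes_A\mathfrak C^*$ with $g*r=\sum_i g(c_i)r_i$ for all $g\in\mathfrak C^*$; these are rings, not necessarily with unit. For such a ring $T$ let $\mathcal M_T$ (resp. ${}_T\mathcal M$) be the category of firm right (resp. left) $T$-modules, i.e. of the $N$ for which the multiplication map $N\otimes_T T\to N$ (resp. $T\otimes_T N\to N$) is bijective; a right $T$-module $F$ is *flat* if $F\otimes_T-$ preserves injections between arbitrary (not necessarily firm) left $T$-modules. Let ${}^{\mathfrak C}\mathcal M$ and $\mathcal M^{\mathfrak C}$ be the categories of left and right $\mathfrak C$-comodules. $\mathfrak C$ is *left $k$-locally quasi-Frobenius* if there are a set $I$ and a $k$-${}^*\mathfrak C$-bilinear map $j=(j_\ell)_{\ell\in I}:\mathfrak C\to({}^*\mathfrak C)^I$ such that for every finite set $F\subseteq\mathfrak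 C$ there is a finitely supported family $(z_\ell)_{\ell\in I}$ in $\mathfrak C^k=\{z\in\mathfrak C: xz=zx \text{ for all } x\in k\}$ with $c=\sum_\ell z_\ell\cdot j_\ell(c)$ for all $c\in F$. Finally let $\tilde Q={}_{\mathfrak C^*}\mathrm{Hom}(\mathfrak C,\mathrm{Rat}(\mathfrak C^*))$, a left ${}^*\mathfrak C$-module by $(f\tilde q)(c)=\tilde q(c\cdot f)$, and let $\bar\triangle:\mathfrak C\otimes_{{}^*\mathfrak C}\tilde Q\to R$, $c\otimes\tilde q\mapsto\tilde q(c)$. **Theorem.** Let $\mathfrak C$ be weakly locally projective as a left $A$-module. Denote by (P) the condition that $\mathfrak C$ is weakly locally projective as a right $A$-module and $R=\mathrm{Rat}(\mathfrak C^*)$ is dense in the finite topology on $\mathfrak C^*$. The following are equivalent. 1. (i) $\mathfrak C$ is left $k$-locally quasi-Frobenius; 2. (ii) (P) holds and $\bar\triangle$ is surjective; 3. (iii) (P) holds and $-\otimes_R\mathfrak C$ is a (well-defined and) fully faithful functor $\mathcal M_R\to\mathcal M_{\mathrm{Rat}({}^*\mathfrak C)}$. In (ii), $\bar\triangle$ is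 then bijective. If moreover $S=\mathrm{Rat}({}^*\mathfrak C)$ is dense in the finite topology on ${}^*\mathfrak C$, then these statements are also equivalent to each of the following. 4. (iv) (P) holds and the functor $-\otimes_R\mathfrak C:\mathcal M_R\to\mathcal M^{\mathfrak C}$ is fully faithful; 5. (v) (P) holds and $\mathfrak C$ is a generator in ${}^{\mathfrak C}\mathcal M$; 6. (vi) (P) holds and $\mathfrak C$ is flat as a right $S$-module; 7. (vii) (P) holds and the functor ${}^{\mathfrak C}\mathrm{Hom}(\mathfrak C,-):{}^{\mathfrak C}\mathcal M\to{}_{{}^*\mathfrak C}\mathcal M$ is fully faithful, where ${}_{{}^*\mathfrak C}\mathcal M$ is the category of unital left ${}^*\mathfrak C$-modules and $(fh)(c)=h(c\cdot f)$; 8. (viii) (P) holds and $S\otimes_S{}^{\mathfrak C}\mathrm{Hom}(\mathfrak C,-)$ is a (well-defined and) fully faithful functor ${}^{\mathfrak C}\mathcal M\to{}_S\mathcal M$. -/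

import Mathlib

open MulOpposite CategoryTheory

universe u w

namespace QFCoring

/-! ### Tensor products over a noncommutative ring

A right `B`-module is a module over `Bᵐᵒᵖ`, with `m * b` written `op b • m`. -/

section BalancedTensor

open TensorProduct

variable (B M N : Type*) [Ring B] [AddCommGroup M] [Module Bᵐᵒᵖ M] [AddCommGroup N] [Module B N]

/-- The subgroup of `M ⊗[ℤ] N` generated by all `m b ⊗ n - m ⊗ b n`. -/
def balancedRel : AddSubgroup (M ⊗[ℤ] N) :=
  AddSubgroup.closure
    {x | ∃ (m : M) (b : B) (n : N), x = (op b • m) ⊗ₜ[ℤ] n - m ⊗ₜ[ℤ] (b • n)}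

/-- The tensor product `M ⊗_B N` of a right `B`-module and a left `B`-module. -/
def BalTensor : Type _ := (M ⊗[ℤ] N) ⧸ balancedRel B M N

instance : AddCommGroup (BalTensor B M N) :=
  inferInstanceAs (AddCommGroup ((M ⊗[ℤ] N) ⧸ balancedRel B M N))

variable {M N}

/-- The pure tensor `m ⊗_B n`, biadditively. -/
def tmul : M →+ N →+ BalTensor B M N :=
  AddMonoidHom.mk' (fun m => AddMonoidHom.mk'
      (fun n => (QuotientAddGroup.mk (m ⊗ₜ[ℤ] n) : (M ⊗[ℤ] N) ⧸ balancedRel B M N))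
      (fun n n' => congrArg QuotientAddGroup.mk (TensorProduct.tmul_add m n n')))
    (fun m m' => AddMonoidHom.ext fun n =>
      congrArg QuotientAddGroup.mk (TensorProduct.add_tmul m m' n))

variable {B}

theorem tmul_balanced (m : M) (b : B) (n : N) : tmul B (op b • m) n = tmul B m (b • n) := by
  refine (QuotientAddGroup.eq).2 ?_
  have h : (op b • m) ⊗ₜ[ℤ] n - m ⊗ₜ[ℤ] (b • n) ∈ balancedRel B M N :=
    AddSubgroup.subset_closure ⟨m, b, n, rfl⟩
  have h2 := neg_mem h
  rwa [neg_sub, sub_eq_neg_add] at h2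

variable {P : Type*} [AddCommGroup P]

/-- The universal property: balanced biadditive maps induce maps on the tensor product. -/
def BalTensor.lift (f : M →+ N →+ P) (hf : ∀ m (b : B) n, f (op b • m) n = f m (b • n)) :
    BalTensor B M N →+ P :=
  QuotientAddGroup.lift (balancedRel B M N)
    (TensorProduct.liftAddHom (R := ℤ) f (fun r m n => by simp))
    (by
      rw [balancedRel, AddSubgroup.closure_le]
      rintro _ ⟨m, b, n, rfl⟩
      simp [hf])

@[simp]
theorem BalTensor.lift_tmul (f : M →+ N →+ P)
    (hf : ∀ m (b : B) n, f (op b • m) n = f m (b • n)) (m : M) (n : N) :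
    BalTensor.lift f hf (tmul B m n) = f m n := rfl

theorem BalTensor.induction {p : BalTensor B M N → Prop} (zero : p 0)
    (pure : ∀ m n, p (tmul B m n)) (add : ∀ x y, p x → p y → p (x + y)) (x) : p x := by
  obtain ⟨y, rfl⟩ := QuotientAddGroup.mk_surjective x
  induction y using TensorProduct.induction_on with
  | zero => exact zero
  | tmul m n => exact pure m n
  | add a b ha hb => exact add _ _ ha hb

theorem BalTensor.hom_ext {f g : BalTensor B M N →+ P}
    (h : ∀ m n, f (tmul B m n) = g (tmul B m n)) : f = g := by
  ext x
  induction x using BalTensor.induction with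
  | zero => simp
  | pure m n => exact h m n
  | add a b ha hb => simp [ha, hb]

variable {M₁ M₂ N₁ N₂ : Type*} [AddCommGroup M₁] [Module Bᵐᵒᵖ M₁] [AddCommGroup N₁] [Module B N₁]
  [AddCommGroup M₂] [Module Bᵐᵒᵖ M₂] [AddCommGroup N₂] [Module B N₂]

/-- `f ⊗_B g`. -/
def BalTensor.map (f : M →ₗ[Bᵐᵒᵖ] M₁) (g : N →ₗ[B] N₁) : BalTensor B M N →+ BalTensor B M₁ N₁ :=
  BalTensor.lift
    (AddMonoidHom.mk' (fun m => (tmul B (f m)).comp g.toAddMonoidHom)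
      (fun m m' => by ext n; simp))
    (fun m b n => by simp [tmul_balanced])

@[simp]
theorem BalTensor.map_tmul (f : M →ₗ[Bᵐᵒᵖ] M₁) (g : N →ₗ[B] N₁) (m : M) (n : N) :
    BalTensor.map f g (tmul B m n) = tmul B (f m) (g n) := rfl

theorem BalTensor.map_id (x : BalTensor B M N) :
    BalTensor.map LinearMap.id LinearMap.id x = x := by
  have : BalTensor.map (B := B) (M := M) (N := N) LinearMap.id LinearMap.id = AddMonoidHom.id _ :=
    BalTensor.hom_ext fun m n => rfl
  exact DFunLike.congr_fun this x

theorem BalTensor.map_map (f : M →ₗ[Bᵐᵒᵖ] M₁) (g : N →ₗ[B] N₁) (f₂ : M₁ →ₗ[Bᵐᵒᵖ] M₂)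
    (g₂ : N₁ →ₗ[B] N₂) (x : BalTensor B M N) :
    BalTensor.map f₂ g₂ (BalTensor.map f g x) = BalTensor.map (f₂.comp f) (g₂.comp g) x := by
  have : (BalTensor.map f₂ g₂).comp (BalTensor.map f g) =
      BalTensor.map (f₂.comp f) (g₂.comp g) := BalTensor.hom_ext fun m n => rfl
  exact DFunLike.congr_fun this x

/-- If `M` is an `L`-`B`-bimodule then `M ⊗_B N` is a left `L`-module, `l (m ⊗ n) = l m ⊗ n`. -/
instance BalTensor.leftModule {L : Type*} [Ring L] [Module L M] [SMulCommClass L Bᵐᵒᵖ M] :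
    Module L (BalTensor B M N) where
  smul l := BalTensor.map (DistribSMul.toLinearMap Bᵐᵒᵖ M l) LinearMap.id
  one_smul x := by
    change BalTensor.map _ _ x = x
    induction x using BalTensor.induction with
    | zero => simp
    | pure m n => simp
    | add a b ha hb => simp [ha, hb]
  mul_smul l l' x := by
    change BalTensor.map _ _ x = BalTensor.map _ _ (BalTensor.map _ _ x)
    induction x using BalTensor.induction with
    | zero => simp
    | pure m n => simp [mul_smul]
    | add a b ha hb => simp [ha, hb]
  smul_zero l := map_zero (BalTensor.map _ _)
  smul_add l := map_add (BalTensor.map _ _)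
  add_smul l l' x := by
    change BalTensor.map _ _ x = BalTensor.map _ _ x + BalTensor.map _ _ x
    induction x using BalTensor.induction with
    | zero => simp
    | pure m n => simp [add_smul]
    | add a b ha hb => simp only [map_add, ha, hb]; abel
  zero_smul x := by
    change BalTensor.map _ _ x = 0
    induction x using BalTensor.induction with
    | zero => simp
    | pure m n => simp
    | add a b ha hb => simp [ha, hb]

theorem BalTensor.smul_tmul {L : Type*} [Ring L] [Module L M] [SMulCommClass L Bᵐᵒᵖ M]
    (l : L) (m : M) (n : N) : l • tmul B m n = tmul B (l • m) n := rfl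

/-- If `N` is a `B`-`L`-bimodule then `M ⊗_B N` is a right `L`-module, `(m ⊗ n) l = m ⊗ n l`. -/
instance BalTensor.rightModule {L : Type*} [Ring L] [Module Lᵐᵒᵖ N] [SMulCommClass B Lᵐᵒᵖ N] :
    Module Lᵐᵒᵖ (BalTensor B M N) :=
  haveI : SMulCommClass Lᵐᵒᵖ B N := SMulCommClass.symm _ _ _
  { smul := fun l => BalTensor.map LinearMap.id (DistribSMul.toLinearMap B N l)
    one_smul := fun x => by
      change BalTensor.map _ _ x = x
      induction x using BalTensor.induction with
      | zero => simp
      | pure m n => simp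
      | add a b ha hb => simp [ha, hb]
    mul_smul := fun l l' x => by
      change BalTensor.map _ _ x = BalTensor.map _ _ (BalTensor.map _ _ x)
      induction x using BalTensor.induction with
      | zero => simp
      | pure m n => simp [mul_smul]
      | add a b ha hb => simp [ha, hb]
    smul_zero := fun l => map_zero (BalTensor.map _ _)
    smul_add := fun l => map_add (BalTensor.map _ _)
    add_smul := fun l l' x => by
      change BalTensor.map _ _ x = BalTensor.map _ _ x + BalTensor.map _ _ x
      induction x using BalTensor.induction with
      | zero => simp
      | pure m n => simp [add_smul]
      | add a b ha hb => simp only [map_add, ha, hb]; abel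
    zero_smul := fun x => by
      change BalTensor.map _ _ x = 0
      induction x using BalTensor.induction with
      | zero => simp
      | pure m n => simp
      | add a b ha hb => simp [ha, hb] }

theorem BalTensor.op_smul_tmul {L : Type*} [Ring L] [Module Lᵐᵒᵖ N] [SMulCommClass B Lᵐᵒᵖ N]
    (l : Lᵐᵒᵖ) (m : M) (n : N) : l • tmul B m n = tmul B m (l • n) := rfl

section Assoc

variable {B' Q : Type*} [Ring B'] [Module B'ᵐᵒᵖ N] [SMulCommClass B B'ᵐᵒᵖ N]
  [AddCommGroup Q] [Module B' Q]

/-- The map `m ⊗ n ↦ (q ↦ m ⊗ (n ⊗ q))`. -/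
def BalTensor.assocAux : BalTensor B M N →+ Q →+ BalTensor B M (BalTensor B' N Q) :=
  BalTensor.lift
    (AddMonoidHom.mk' (fun m => AddMonoidHom.mk' (fun n => (tmul B m).comp (tmul B' n))
        (fun n n' => by ext q; simp))
      (fun m m' => by ext n q; simp))
    (fun m b n => by
      ext q
      simp only [AddMonoidHom.mk'_apply, AddMonoidHom.comp_apply]
      rw [tmul_balanced, BalTensor.smul_tmul])

/-- The associativity isomorphism `(M ⊗_B N) ⊗_B' Q → M ⊗_B (N ⊗_B' Q)`. -/
def BalTensor.assoc : BalTensor B' (BalTensor B M N) Q →+ BalTensor B M (BalTensor B' N Q) :=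
  BalTensor.lift BalTensor.assocAux
    (fun x b q => by
      induction x using BalTensor.induction with
      | zero => rw [smul_zero, map_zero]; rfl
      | pure m n =>
        change tmul B m (tmul B' (op b • n) q) = tmul B m (tmul B' n (b • q))
        rw [tmul_balanced]
      | add x y hx hy =>
        rw [smul_add, map_add, map_add, AddMonoidHom.add_apply, AddMonoidHom.add_apply, hx, hy])

@[simp]
theorem BalTensor.assoc_tmul (m : M) (n : N) (q : Q) :
    BalTensor.assoc (tmul B' (tmul B m n) q) = tmul B m (tmul B' n q) := rfl

/-- The map `n ⊗ q ↦ (m ⊗ n) ⊗ q`. -/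
def BalTensor.assocInvAux (m : M) : BalTensor B' N Q →+ BalTensor B' (BalTensor B M N) Q :=
  BalTensor.lift
    (AddMonoidHom.mk' (fun n => tmul B' (tmul B m n)) (fun n n' => by ext q; simp))
    (fun n b q => by
      simp only [AddMonoidHom.mk'_apply]
      rw [← BalTensor.op_smul_tmul, tmul_balanced])

/-- The inverse `M ⊗_B (N ⊗_B' Q) → (M ⊗_B N) ⊗_B' Q` of the associativity isomorphism. -/
def BalTensor.assocInv : BalTensor B M (BalTensor B' N Q) →+ BalTensor B' (BalTensor B M N) Q :=
  BalTensor.lift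
    (AddMonoidHom.mk' BalTensor.assocInvAux (fun m m' => BalTensor.hom_ext fun n q => by
      change tmul B' (tmul B (m + m') n) q = tmul B' (tmul B m n) q + tmul B' (tmul B m' n) q
      simp only [map_add, AddMonoidHom.add_apply]))
    (fun m b x => by
      induction x using BalTensor.induction with
      | zero => rw [smul_zero, map_zero, map_zero]
      | pure n q =>
        change tmul B' (tmul B (op b • m) n) q = tmul B' (tmul B m (b • n)) q
        rw [tmul_balanced]
      | add x y hx hy => rw [smul_add, map_add, map_add, hx, hy])

@[simp]
theorem BalTensor.assocInv_tmul (m : M) (n : N) (q : Q) :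
    BalTensor.assocInv (tmul B m (tmul B' n q)) = tmul B' (tmul B m n) q := rfl

theorem BalTensor.assocInv_assoc (x : BalTensor B' (BalTensor B M N) Q) :
    BalTensor.assocInv (BalTensor.assoc x) = x := by
  induction x using BalTensor.induction with
  | zero => simp
  | pure y q =>
    induction y using BalTensor.induction with
    | zero => simp
    | pure m n => simp
    | add a b ha hb => simp [ha, hb]
  | add a b ha hb => simp [ha, hb]

theorem BalTensor.assoc_assocInv (x : BalTensor B M (BalTensor B' N Q)) :
    BalTensor.assoc (BalTensor.assocInv x) = x := by
  induction x using BalTensor.induction with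
  | zero => simp
  | pure m y =>
    induction y using BalTensor.induction with
    | zero => simp
    | pure n q => simp
    | add a b ha hb => simp [ha, hb]
  | add a b ha hb => simp [ha, hb]

end Assoc

end BalancedTensor

set_option linter.unusedSectionVars false
set_option linter.unusedVariables false

/-! ### Corings and their dual rings -/

/-- An `A`-coring: a comonoid in the monoidal category of `A`-bimodules. -/
class Coring (A C : Type u) [Ring A] [AddCommGroup C] [Module A C] [Module Aᵐᵒᵖ C]
    [SMulCommClass A Aᵐᵒᵖ C] where
  /-- comultiplication `Δ : C → C ⊗_A C` -/
  comul : C →+ BalTensor A C C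
  /-- counit `ε : C → A` -/
  counit : C →+ A
  comul_smul : ∀ (a : A) (c : C), comul (a • c) = a • comul c
  comul_op_smul : ∀ (a : A) (c : C), comul (op a • c) = op a • comul c
  counit_smul : ∀ (a : A) (c : C), counit (a • c) = a * counit c
  counit_op_smul : ∀ (a : A) (c : C), counit (op a • c) = counit c * a
  coassoc : ∀ c : C,
    BalTensor.assoc (BalTensor.map (M₁ := BalTensor A C C) ⟨comul.toAddHom, fun b c => comul_op_smul b.unop c⟩
      LinearMap.id (comul c)) =
    BalTensor.map (N₁ := BalTensor A C C) LinearMap.id ⟨comul.toAddHom, comul_smul⟩ (comul c)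
  /-- `Σ ε(c₁) c₂ = c` -/
  counit_comul : ∀ c : C,
    BalTensor.lift (AddMonoidHom.mk' (fun x => DistribSMul.toAddMonoidHom C (counit x))
        (fun x y => by ext z; simp [add_smul]))
      (fun x a y => by simp [counit_op_smul, mul_smul]) (comul c) = c
  /-- `Σ c₁ ε(c₂) = c` -/
  comul_counit : ∀ c : C,
    BalTensor.lift (AddMonoidHom.mk' (fun x => AddMonoidHom.mk' (fun y => op (counit y) • x)
          (fun y z => by simp [add_smul]))
        (fun x y => by ext z; simp))
      (fun x a y => by simp [counit_smul, mul_smul]) (comul c) = c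

section Dual

variable (A C : Type u) [Ring A] [AddCommGroup C] [Module A C] [Module Aᵐᵒᵖ C]
  [SMulCommClass A Aᵐᵒᵖ C] 

/-- The left dual `*C` of left `A`-linear maps `C → A`. -/
def LeftDual : Type u := C →ₗ[A] A

/-- The right dual `C*` of right `A`-linear maps `C → A`. -/
def RightDual : Type u := C →ₗ[Aᵐᵒᵖ] A

variable {A C}

instance : AddCommGroup (LeftDual A C) := inferInstanceAs (AddCommGroup (C →ₗ[A] A))

instance : AddCommGroup (RightDual A C) := inferInstanceAs (AddCommGroup (C →ₗ[Aᵐᵒᵖ] A))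

instance : FunLike (LeftDual A C) C A := inferInstanceAs (FunLike (C →ₗ[A] A) C A)

instance : FunLike (RightDual A C) C A := inferInstanceAs (FunLike (C →ₗ[Aᵐᵒᵖ] A) C A)

instance : AddMonoidHomClass (LeftDual A C) C A :=
  inferInstanceAs (AddMonoidHomClass (C →ₗ[A] A) C A)

instance : AddMonoidHomClass (RightDual A C) C A :=
  inferInstanceAs (AddMonoidHomClass (C →ₗ[Aᵐᵒᵖ] A) C A)

@[ext]
theorem LeftDual.ext {f g : LeftDual A C} (h : ∀ c, f c = g c) : f = g := DFunLike.ext _ _ h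

@[ext]
theorem RightDual.ext {f g : RightDual A C} (h : ∀ c, f c = g c) : f = g := DFunLike.ext _ _ h

@[simp]
theorem LeftDual.add_apply (f g : LeftDual A C) (c : C) : (f + g) c = f c + g c := rfl

@[simp]
theorem RightDual.add_apply (f g : RightDual A C) (c : C) : (f + g) c = f c + g c := rfl

@[simp]
theorem LeftDual.zero_apply (c : C) : (0 : LeftDual A C) c = 0 := rfl

@[simp]
theorem RightDual.zero_apply (c : C) : (0 : RightDual A C) c = 0 := rfl

@[simp]
theorem LeftDual.apply_smul (f : LeftDual A C) (a : A) (c : C) : f (a • c) = a * f c :=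
  LinearMap.map_smul (R := A) f a c

@[simp]
theorem RightDual.apply_smul (f : RightDual A C) (a : A) (c : C) : f (op a • c) = f c * a :=
  LinearMap.map_smul (R := Aᵐᵒᵖ) f (op a) c

/-- `*C` is a left `A`-module through `(a f)(c) = f(c a)`. -/
instance : Module A (LeftDual A C) where
  smul a f := ({ toFun := fun c => f (op a • c)
                 map_add' := fun c d => by rw [smul_add, map_add]
                 map_smul' := fun b c => by
                  rw [← smul_comm b (op a) c, LeftDual.apply_smul]; rfl } : C →ₗ[A] A)
  one_smul f := by ext c; change f (op 1 • c) = f c; simp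
  mul_smul a b f := by ext c; change f (op (a * b) • c) = f (op b • op a • c); simp [mul_smul]
  smul_zero a := rfl
  smul_add a f g := rfl
  add_smul a b f := by
    ext c; change f (op (a + b) • c) = f (op a • c) + f (op b • c); simp [add_smul]
  zero_smul f := by ext c; change f (op 0 • c) = 0; simp

@[simp]
theorem LeftDual.smul_apply (a : A) (f : LeftDual A C) (c : C) : (a • f) c = f (op a • c) := rfl

/-- `*C` is a right `A`-module through `(f a)(c) = f(c) a`. -/
instance : Module Aᵐᵒᵖ (LeftDual A C) := inferInstanceAs (Module Aᵐᵒᵖ (C →ₗ[A] A))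

@[simp]
theorem LeftDual.op_smul_apply (a : A) (f : LeftDual A C) (c : C) : (op a • f) c = f c * a := rfl

/-- `C*` is a left `A`-module through `(a f)(c) = a f(c)`. -/
instance : Module A (RightDual A C) := inferInstanceAs (Module A (C →ₗ[Aᵐᵒᵖ] A))

@[simp]
theorem RightDual.smul_apply (a : A) (f : RightDual A C) (c : C) : (a • f) c = a * f c := rfl


/-- The map `M ⊗_A C → M`, `m ⊗ c ↦ m f(c)`. -/
def evalRight {M : Type*} [AddCommGroup M] [Module Aᵐᵒᵖ M] (f : LeftDual A C) :
    BalTensor A M C →+ M :=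
  BalTensor.lift
    (AddMonoidHom.mk' (fun m => AddMonoidHom.mk' (fun c => op (f c) • m)
        (fun c d => by simp [add_smul]))
      (fun m m' => by ext c; simp))
    (fun m a c => by simp [mul_smul])

@[simp]
theorem evalRight_tmul {M : Type*} [AddCommGroup M] [Module Aᵐᵒᵖ M] (f : LeftDual A C)
    (m : M) (c : C) : evalRight f (tmul A m c) = op (f c) • m := rfl

/-- The map `C ⊗_A M → M`, `c ⊗ m ↦ f(c) m`. -/
def evalLeft {M : Type*} [AddCommGroup M] [Module A M] (f : RightDual A C) :
    BalTensor A C M →+ M :=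
  BalTensor.lift
    (AddMonoidHom.mk' (fun c => DistribSMul.toAddMonoidHom M (f c))
      (fun c d => by ext m; simp [add_smul]))
    (fun c a m => by simp [mul_smul])

@[simp]
theorem evalLeft_tmul {M : Type*} [AddCommGroup M] [Module A M] (f : RightDual A C)
    (c : C) (m : M) : evalLeft f (tmul A c m) = f c • m := rfl

variable [Coring A C]

open Coring

/-- `Δ` as a left `A`-linear map. -/
def comulL : C →ₗ[A] BalTensor A C C := ⟨comul.toAddHom, comul_smul⟩

/-- `Δ` as a right `A`-linear map. -/
def comulR : C →ₗ[Aᵐᵒᵖ] BalTensor A C C := ⟨comul.toAddHom, fun b c => comul_op_smul b.unop c⟩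

/-- `c ↦ c · f = Σ c₁ f(c₂)`, a left `A`-linear map. -/
def actRight (f : LeftDual A C) : C →ₗ[A] C where
  toFun c := evalRight f (comul (A := A) c)
  map_add' c d := by simp
  map_smul' a c := by
    rw [comul_smul]
    generalize comul (A := A) c = x
    induction x using BalTensor.induction with
    | zero => simp
    | pure x y => rw [BalTensor.smul_tmul]; simp [smul_comm]
    | add x y hx hy => rw [smul_add, map_add, hx, hy, map_add, smul_add]

/-- `c ↦ f · c = Σ f(c₁) c₂`, a right `A`-linear map. -/
def actLeft (f : RightDual A C) : C →ₗ[Aᵐᵒᵖ] C where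
  toFun c := evalLeft f (comul (A := A) c)
  map_add' c d := by simp
  map_smul' a c := by
    induction a using MulOpposite.rec' with
    | _ a =>
    rw [comul_op_smul]
    generalize comul (A := A) c = x
    induction x using BalTensor.induction with
    | zero => simp
    | pure x y => rw [BalTensor.op_smul_tmul]; simp [smul_comm]
    | add x y hx hy => rw [smul_add, map_add, hx, hy, map_add, smul_add]

/-- `Δ(c · f) = Σ c₁ ⊗ c₂ · f`. -/
theorem comul_actRight (f : LeftDual A C) (c : C) :
    comul (A := A) (actRight f c) = BalTensor.map LinearMap.id (actRight f) (comul (A := A) c) := by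
  let Φ : BalTensor A C (BalTensor A C C) →+ BalTensor A C C :=
    BalTensor.map LinearMap.id
      ⟨(evalRight f).toAddHom, fun a x => by
        change evalRight f (a • x) = a • evalRight f x
        induction x using BalTensor.induction with
        | zero => simp
        | pure x y => rw [BalTensor.smul_tmul]; simp [smul_comm]
        | add x y hx hy => rw [smul_add, map_add, hx, hy, map_add, smul_add]⟩
  have h := congrArg Φ (coassoc (A := A) c)
  have h1 : ∀ x : BalTensor A C C,
      Φ (BalTensor.map (N₁ := BalTensor A C C) LinearMap.id ⟨comul.toAddHom, comul_smul⟩ x) =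
        BalTensor.map LinearMap.id (actRight f) x := by
    intro x
    induction x using BalTensor.induction with
    | zero => simp
    | pure x y => rfl
    | add x y hx hy => simp only [map_add, hx, hy]
  have h2 : ∀ x : BalTensor A C C,
      Φ (BalTensor.assoc (BalTensor.map (M₁ := BalTensor A C C)
        ⟨comul.toAddHom, fun b c => comul_op_smul b.unop c⟩ LinearMap.id x)) =
        comul (A := A) (evalRight f x) := by
    intro x
    induction x using BalTensor.induction with
    | zero => simp
    | pure x y =>
      rw [evalRight_tmul, comul_op_smul]
      change Φ (BalTensor.assoc (tmul A (comul (A := A) x) y)) = _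
      generalize comul (A := A) x = z
      induction z using BalTensor.induction with
      | zero => simp
      | pure x z => rfl
      | add x z hx hz => simp only [map_add, AddMonoidHom.add_apply, smul_add, hx, hz]
    | add x y hx hy => simp only [map_add, hx, hy]
  rw [h1, h2] at h
  exact h

/-- `Δ(f · c) = Σ f · c₁ ⊗ c₂`. -/
theorem comul_actLeft (f : RightDual A C) (c : C) :
    comul (A := A) (actLeft f c) = BalTensor.map (actLeft f) LinearMap.id (comul (A := A) c) := by
  let Φ : BalTensor A (BalTensor A C C) C →+ BalTensor A C C :=
    BalTensor.map
      ⟨(evalLeft f).toAddHom, fun a x => by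
        change evalLeft f (a • x) = a • evalLeft f x
        induction x using BalTensor.induction with
        | zero => simp
        | pure x y =>
          rw [BalTensor.op_smul_tmul, evalLeft_tmul, evalLeft_tmul, smul_comm]
        | add x y hx hy => rw [smul_add, map_add, hx, hy, map_add, smul_add]⟩ LinearMap.id
  have h := congrArg (fun z => Φ (BalTensor.assocInv z)) (coassoc (A := A) c)
  simp only [BalTensor.assocInv_assoc] at h
  have h1 : ∀ x : BalTensor A C C,
      Φ (BalTensor.map (M₁ := BalTensor A C C)
        ⟨comul.toAddHom, fun b c => comul_op_smul b.unop c⟩ LinearMap.id x) =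
        BalTensor.map (actLeft f) LinearMap.id x := by
    intro x
    induction x using BalTensor.induction with
    | zero => simp
    | pure x y => rfl
    | add x y hx hy => simp only [map_add, hx, hy]
  have h2 : ∀ x : BalTensor A C C,
      Φ (BalTensor.assocInv (BalTensor.map (N₁ := BalTensor A C C) LinearMap.id
        ⟨comul.toAddHom, comul_smul⟩ x)) = comul (A := A) (evalLeft f x) := by
    intro x
    induction x using BalTensor.induction with
    | zero => simp
    | pure x y =>
      rw [evalLeft_tmul, comul_smul]
      change Φ (BalTensor.assocInv (tmul A x (comul (A := A) y))) = _
      generalize comul (A := A) y = z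
      induction z using BalTensor.induction with
      | zero => simp
      | pure y z => rfl
      | add y z hy hz => simp only [map_add, smul_add, hy, hz]
    | add x y hx hy => simp only [map_add, hx, hy]
  rw [h1, h2] at h
  exact h.symm

theorem actRight_add (f g : LeftDual A C) (c : C) :
    actRight (f + g) c = actRight f c + actRight g c := by
  change evalRight (f + g) (comul (A := A) c) = evalRight f (comul (A := A) c) + evalRight g (comul (A := A) c)
  generalize comul (A := A) c = x
  induction x using BalTensor.induction with
  | zero => simp
  | pure x y => simp [add_smul]
  | add x y hx hy => simp only [map_add, hx, hy]; abel

theorem actLeft_add (f g : RightDual A C) (c : C) :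
    actLeft (f + g) c = actLeft f c + actLeft g c := by
  change evalLeft (f + g) (comul (A := A) c) = evalLeft f (comul (A := A) c) + evalLeft g (comul (A := A) c)
  generalize comul (A := A) c = x
  induction x using BalTensor.induction with
  | zero => simp
  | pure x y => simp [add_smul]
  | add x y hx hy => simp only [map_add, hx, hy]; abel

/-- `(f * g)(c) = Σ g(c₁ f(c₂))`. -/
instance : Mul (LeftDual A C) := ⟨fun f g => LinearMap.comp (g : C →ₗ[A] A) (actRight f)⟩

/-- `(f * g)(c) = Σ f(g(c₁) c₂)`. -/
instance : Mul (RightDual A C) := ⟨fun f g => LinearMap.comp (f : C →ₗ[Aᵐᵒᵖ] A) (actLeft g)⟩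

theorem LeftDual.mul_apply (f g : LeftDual A C) (c : C) : (f * g) c = g (actRight f c) := rfl

theorem RightDual.mul_apply (f g : RightDual A C) (c : C) : (f * g) c = f (actLeft g c) := rfl

/-- The unit of `*C` is the counit. -/
instance : One (LeftDual A C) := ⟨(⟨counit.toAddHom, counit_smul⟩ : C →ₗ[A] A)⟩

/-- The unit of `C*` is the counit. -/
instance : One (RightDual A C) :=
  ⟨(⟨counit.toAddHom, fun a c => counit_op_smul a.unop c⟩ : C →ₗ[Aᵐᵒᵖ] A)⟩

theorem LeftDual.one_apply (c : C) : (1 : LeftDual A C) c = counit (A := A) c := rfl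

theorem RightDual.one_apply (c : C) : (1 : RightDual A C) c = counit (A := A) c := rfl

theorem actRight_one (c : C) : actRight (1 : LeftDual A C) c = c := comul_counit c

theorem actLeft_one (c : C) : actLeft (1 : RightDual A C) c = c := counit_comul c

theorem actRight_mul (f g : LeftDual A C) (c : C) :
    actRight (f * g) c = actRight g (actRight f c) := by
  change evalRight (f * g) (comul (A := A) c) = evalRight g (comul (A := A) (actRight f c))
  rw [comul_actRight]
  generalize comul (A := A) c = x
  induction x using BalTensor.induction with
  | zero => simp
  | pure x y => rfl
  | add x y hx hy => simp only [map_add, hx, hy]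

theorem actLeft_mul (f g : RightDual A C) (c : C) :
    actLeft (f * g) c = actLeft f (actLeft g c) := by
  change evalLeft (f * g) (comul (A := A) c) = evalLeft f (comul (A := A) (actLeft g c))
  rw [comul_actLeft]
  generalize comul (A := A) c = x
  induction x using BalTensor.induction with
  | zero => simp
  | pure x y => rfl
  | add x y hx hy => simp only [map_add, hx, hy]

instance : Ring (LeftDual A C) :=
  { (inferInstance : AddCommGroup (LeftDual A C)), (inferInstance : Mul (LeftDual A C)),
    (inferInstance : One (LeftDual A C)) with
    mul_assoc := fun f g h => by
      ext c; simp only [LeftDual.mul_apply, actRight_mul]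
    one_mul := fun f => by ext c; rw [LeftDual.mul_apply, actRight_one]
    mul_one := fun f => by
      ext c
      change counit (A := A) (evalRight f (comul (A := A) c)) = f c
      have h := congrArg f (counit_comul (A := A) c)
      rw [← h]
      generalize comul (A := A) c = x
      induction x using BalTensor.induction with
      | zero => simp
      | pure x y => simp [counit_op_smul]
      | add x y hx hy => simp only [map_add, hx, hy]
    zero_mul := fun f => by
      ext c
      change f (evalRight 0 (comul (A := A) c)) = 0
      generalize comul (A := A) c = x
      induction x using BalTensor.induction with
      | zero => simp
      | pure x y => simp
      | add x y hx hy => simp only [map_add, hx, hy, add_zero]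
    mul_zero := fun f => rfl
    left_distrib := fun f g h => rfl
    right_distrib := fun f g h => by
      ext c; simp only [LeftDual.mul_apply, LeftDual.add_apply, actRight_add, map_add] }

instance : Ring (RightDual A C) :=
  { (inferInstance : AddCommGroup (RightDual A C)), (inferInstance : Mul (RightDual A C)),
    (inferInstance : One (RightDual A C)) with
    mul_assoc := fun f g h => by
      ext c; simp only [RightDual.mul_apply, actLeft_mul]
    mul_one := fun f => by ext c; rw [RightDual.mul_apply, actLeft_one]
    one_mul := fun f => by
      ext c
      change counit (A := A) (evalLeft f (comul (A := A) c)) = f c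
      have h := congrArg f (comul_counit (A := A) c)
      rw [← h]
      generalize comul (A := A) c = x
      induction x using BalTensor.induction with
      | zero => simp
      | pure x y => simp [counit_smul]
      | add x y hx hy => simp only [map_add, hx, hy]
    mul_zero := fun f => by
      ext c
      change f (evalLeft 0 (comul (A := A) c)) = 0
      generalize comul (A := A) c = x
      induction x using BalTensor.induction with
      | zero => simp
      | pure x y => simp
      | add x y hx hy => simp only [map_add, hx, hy, add_zero]
    zero_mul := fun f => rfl
    right_distrib := fun f g h => rfl
    left_distrib := fun f g h => by
      ext c; simp only [RightDual.mul_apply, RightDual.add_apply, actLeft_add, map_add] }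

/-- `C` is a right `*C`-module through `c · f = Σ c₁ f(c₂)`. -/
instance : Module (LeftDual A C)ᵐᵒᵖ C where
  smul f c := actRight f.unop c
  one_smul c := actRight_one c
  mul_smul f g c := actRight_mul g.unop f.unop c
  smul_zero f := map_zero (actRight f.unop)
  smul_add f := map_add (actRight f.unop)
  add_smul f g c := actRight_add f.unop g.unop c
  zero_smul c := by
    have h := actRight_add (A := A) (0 : LeftDual A C) 0 c
    rw [add_zero] at h
    exact left_eq_add.1 h

/-- `C` is a left `C*`-module through `f · c = Σ f(c₁) c₂`. -/
instance : Module (RightDual A C) C where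
  smul f c := actLeft f c
  one_smul c := actLeft_one c
  mul_smul f g c := actLeft_mul f g c
  smul_zero f := map_zero (actLeft f)
  smul_add f := map_add (actLeft f)
  add_smul f g c := actLeft_add f g c
  zero_smul c := by
    have h := actLeft_add (A := A) (0 : RightDual A C) 0 c
    rw [add_zero] at h
    exact left_eq_add.1 h

theorem LeftDual.op_smul_def (f : LeftDual A C) (c : C) : op f • c = actRight f c := rfl

theorem RightDual.smul_def (f : RightDual A C) (c : C) : f • c = actLeft f c := rfl

/-- `C` is a `C*`-`*C`-bimodule. -/
instance : SMulCommClass (RightDual A C) (LeftDual A C)ᵐᵒᵖ C where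
  smul_comm f g c := by
    change evalLeft f (comul (A := A) (actRight g.unop c)) =
      actRight g.unop (evalLeft f (comul (A := A) c))
    rw [comul_actRight]
    generalize comul (A := A) c = x
    induction x using BalTensor.induction with
    | zero => simp
    | pure x y => simp
    | add x y hx hy => simp only [map_add, hx, hy]

/-! ### Rational parts and quasi-Frobenius corings -/

variable (A C)

/-- `Rat(*C)`: the elements `s` of the right `*C`-module `*C` for which there is an element
`Σ sᵢ ⊗ cᵢ` of `*C ⊗_A C` with `s * g = Σ sᵢ g(cᵢ)` for all `g`. If `C` is weakly locally
projective as a left `A`-module, `Σ sᵢ ⊗ cᵢ` is unique and this is the largest `A`-submodule of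
`*C` with a right `C`-comodule structure that induces the right `*C`-action. -/
def RatLeftDual : NonUnitalSubring (LeftDual A C) where
  carrier := {s | ∃ t : BalTensor A (LeftDual A C) C, ∀ g : LeftDual A C, s * g = evalRight g t}
  zero_mem' := ⟨0, fun g => by simp⟩
  add_mem' := by
    rintro s s' ⟨t, ht⟩ ⟨t', ht'⟩
    exact ⟨t + t', fun g => by rw [add_mul, ht, ht', map_add]⟩
  neg_mem' := by
    rintro s ⟨t, ht⟩
    exact ⟨-t, fun g => by rw [neg_mul, ht, map_neg]⟩
  mul_mem' := by
    rintro s s' - ⟨t, ht⟩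
    refine ⟨BalTensor.map ⟨(AddMonoidHom.mulLeft s).toAddHom, fun a h => rfl⟩ LinearMap.id t,
      fun g => ?_⟩
    rw [mul_assoc, ht]
    clear ht
    induction t using BalTensor.induction with
    | zero => simp
    | pure h c => rfl
    | add x y hx hy => simp only [map_add, mul_add, hx, hy]

/-- `Rat(C*)`: the elements `r` of the left `C*`-module `C*` for which there is an element
`Σ cᵢ ⊗ rᵢ` of `C ⊗_A C*` with `g * r = Σ g(cᵢ) rᵢ` for all `g`. If `C` is weakly locally
projective as a right `A`-module, `Σ cᵢ ⊗ rᵢ` is unique and this is the largest `A`-submodule of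
`C*` with a left `C`-comodule structure that induces the left `C*`-action. -/
def RatRightDual : NonUnitalSubring (RightDual A C) where
  carrier := {r | ∃ t : BalTensor A C (RightDual A C), ∀ g : RightDual A C, g * r = evalLeft g t}
  zero_mem' := ⟨0, fun g => by simp⟩
  add_mem' := by
    rintro s s' ⟨t, ht⟩ ⟨t', ht'⟩
    exact ⟨t + t', fun g => by rw [mul_add, ht, ht', map_add]⟩
  neg_mem' := by
    rintro s ⟨t, ht⟩
    exact ⟨-t, fun g => by rw [mul_neg, ht, map_neg]⟩
  mul_mem' := by
    rintro s s' ⟨t, ht⟩ -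
    refine ⟨BalTensor.map LinearMap.id ⟨(AddMonoidHom.mulRight s').toAddHom, fun a h => rfl⟩ t,
      fun g => ?_⟩
    rw [← mul_assoc, ht]
    clear ht
    induction t using BalTensor.induction with
    | zero => simp
    | pure c h => rfl
    | add x y hx hy => simp only [map_add, add_mul, hx, hy]

variable {A C}

/-- `Rat(C*)` is a left ideal of `C*`. -/
theorem RatRightDual.mul_mem (f : RightDual A C) {r : RightDual A C}
    (hr : r ∈ RatRightDual A C) : f * r ∈ RatRightDual A C := by
  obtain ⟨t, ht⟩ := hr
  refine ⟨BalTensor.map (actLeft f) LinearMap.id t, fun g => ?_⟩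
  rw [← mul_assoc, ht]
  clear ht
  induction t using BalTensor.induction with
  | zero => simp
  | pure c h => rfl
  | add x y hx hy => simp only [map_add, hx, hy]

/-- `Rat(C*)` as a left `C*`-module. -/
instance : Module (RightDual A C) (RatRightDual A C) where
  smul f r := ⟨f * r.1, RatRightDual.mul_mem f r.2⟩
  one_smul r := Subtype.ext (one_mul _)
  mul_smul f g r := Subtype.ext (mul_assoc _ _ _)
  smul_zero f := Subtype.ext (mul_zero _)
  smul_add f r r' := Subtype.ext (mul_add _ _ _)
  add_smul f g r := Subtype.ext (add_mul _ _ _)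
  zero_smul r := Subtype.ext (zero_mul _)

variable (A C)

/-- The finite topology on `*C`: the topology of pointwise convergence with `A` discrete. -/
@[reducible]
def finiteTopologyLeftDual : TopologicalSpace (LeftDual A C) :=
  TopologicalSpace.induced (fun f c => f c) (@Pi.topologicalSpace C (fun _ => A) fun _ => ⊥)

/-- The finite topology on `C*`: the topology of pointwise convergence with `A` discrete. -/
@[reducible]
def finiteTopologyRightDual : TopologicalSpace (RightDual A C) :=
  TopologicalSpace.induced (fun f c => f c) (@Pi.topologicalSpace C (fun _ => A) fun _ => ⊥)

/-- `Rat(*C)` is dense in the finite topology on `*C`. -/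
def RatLeftDualDense : Prop :=
  @Dense _ (finiteTopologyLeftDual A C) (RatLeftDual A C : Set (LeftDual A C))

/-- `Rat(C*)` is dense in the finite topology on `C*`. -/
def RatRightDualDense : Prop :=
  @Dense _ (finiteTopologyRightDual A C) (RatRightDual A C : Set (RightDual A C))

/-- For a ring morphism `ι : B → A`, the coring `C` is left `B`-locally quasi-Frobenius: there is
a `B`-`*C`-bilinear map `j : C → (*C)^I` such that for finitely many elements `c` of `C` there is
`z ∈ (C^B)^(I)` with `c = Σ_l z_l · j_l(c)` for each of them. -/
def IsLeftLocallyQuasiFrobenius {B : Type*} [Ring B] (ι : B →+* A) : Prop :=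
  ∃ (I : Type u) (j : C →+ (I → LeftDual A C)),
    (∀ (b : B) (c : C) (l : I), j (ι b • c) l = ι b • j c l) ∧
    (∀ (f : LeftDual A C) (c : C) (l : I), j (op f • c) l = j c l * f) ∧
    ∀ s : Finset C, ∃ z : I →₀ C,
      (∀ (b : B) (l : I), ι b • z l = op (ι b) • z l) ∧
      ∀ c ∈ s, c = z.sum fun l zl => op (j c l) • zl

/-- `Q̃`: the left `C*`-linear maps `C → Rat(C*)`. -/
def QTilde : Type u := C →ₗ[RightDual A C] RatRightDual A C

instance : AddCommGroup (QTilde A C) :=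
  inferInstanceAs (AddCommGroup (C →ₗ[RightDual A C] RatRightDual A C))

instance : FunLike (QTilde A C) C (RatRightDual A C) :=
  inferInstanceAs (FunLike (C →ₗ[RightDual A C] RatRightDual A C) C (RatRightDual A C))

instance : AddMonoidHomClass (QTilde A C) C (RatRightDual A C) :=
  inferInstanceAs (AddMonoidHomClass (C →ₗ[RightDual A C] RatRightDual A C) C (RatRightDual A C))

/-- `Q̃` is a left `*C`-module through `(f q)(c) = q(c · f)`. -/
instance : Module (LeftDual A C) (QTilde A C) where
  smul f q := ({ toFun := fun c => q (op f • c)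
                 map_add' := fun c d => by rw [smul_add, map_add]
                 map_smul' := fun g c => by
                  rw [← smul_comm g (op f) c]
                  exact LinearMap.map_smul (R := RightDual A C) q g _ } :
               C →ₗ[RightDual A C] RatRightDual A C)
  one_smul q := DFunLike.ext _ _ fun c => congrArg q (one_smul (LeftDual A C)ᵐᵒᵖ c)
  mul_smul f g q := DFunLike.ext _ _ fun c => congrArg q (mul_smul (op g) (op f) c)
  smul_zero f := rfl
  smul_add f q q' := rfl
  add_smul f g q := DFunLike.ext _ _ fun c =>
    (congrArg q (add_smul (op f) (op g) c)).trans (map_add q _ _)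
  zero_smul q := DFunLike.ext _ _ fun c =>
    (congrArg q (zero_smul (LeftDual A C)ᵐᵒᵖ c)).trans (map_zero q)

/-- The restricted Morita map `C ⊗_{*C} Q̃ → Rat(C*)`, `c ⊗ q ↦ q(c)`. -/
def moritaMap : BalTensor (LeftDual A C) C (QTilde A C) →+ RatRightDual A C :=
  BalTensor.lift
    (AddMonoidHom.mk' (fun c => AddMonoidHom.mk' (fun q => q c) (fun q q' => rfl))
      (fun c d => AddMonoidHom.ext fun q => map_add q c d))
    (fun c f q => rfl)

end Dual

/-- A weakly locally projective module `X`: for every finitely generated submodule `E` of `X`,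
every epimorphism `g : M → N` and every `f : X → N` there is `h : X → M` with `g ∘ h = f` on `E`. -/
def IsWeaklyLocallyProjective (R X : Type u) [Ring R] [AddCommGroup X] [Module R X] : Prop :=
  ∀ E : Submodule R X, E.FG →
    ∀ (M N : Type u) [AddCommGroup M] [AddCommGroup N] [Module R M] [Module R N]
      (g : M →ₗ[R] N) (f : X →ₗ[R] N), Function.Surjective g →
      ∃ h : X →ₗ[R] M, ∀ e ∈ E, g (h e) = f e

/-! ### Modules over rings without unit

For a ring `R`, not necessarily with unit, let `Dorroh R = ℤ ⊕ R` be its Dorroh extension. Unital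
`Dorroh R`-modules are the same as all (not necessarily unital) `R`-modules, with the same
morphisms and the same tensor products. -/

/-- The Dorroh extension of a ring without unit. -/
def Dorroh (R : Type*) [NonUnitalRing R] : Type _ := Unitization ℤ R

instance (R : Type*) [NonUnitalRing R] : Ring (Dorroh R) :=
  inferInstanceAs (Ring (Unitization ℤ R))

section DorrohBasic

variable {R : Type*} [NonUnitalRing R]

/-- The integer component. -/
def Dorroh.fst (x : Dorroh R) : ℤ := (Unitization.toProd (R := ℤ) (A := R) x).1

/-- The component in `R`. -/
def Dorroh.snd (x : Dorroh R) : R := (Unitization.toProd (R := ℤ) (A := R) x).2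

/-- The inclusion of `R` in its Dorroh extension. -/
def Dorroh.of (r : R) : Dorroh R := Unitization.inr r

@[simp] theorem Dorroh.fst_one : (1 : Dorroh R).fst = 1 := rfl
@[simp] theorem Dorroh.snd_one : (1 : Dorroh R).snd = 0 := rfl
@[simp] theorem Dorroh.fst_zero : (0 : Dorroh R).fst = 0 := rfl
@[simp] theorem Dorroh.snd_zero : (0 : Dorroh R).snd = 0 := rfl
@[simp] theorem Dorroh.fst_add (x y : Dorroh R) : (x + y).fst = x.fst + y.fst := rfl
@[simp] theorem Dorroh.snd_add (x y : Dorroh R) : (x + y).snd = x.snd + y.snd := rfl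
@[simp] theorem Dorroh.fst_mul (x y : Dorroh R) : (x * y).fst = x.fst * y.fst := rfl
@[simp] theorem Dorroh.snd_mul (x y : Dorroh R) :
    (x * y).snd = x.fst • y.snd + y.fst • x.snd + x.snd * y.snd := rfl

theorem Dorroh.of_add (r s : R) : of (r + s) = of r + of s := Unitization.inr_add ℤ r s

theorem Dorroh.ext' {x y : Dorroh R} (h : x.fst = y.fst) (h' : x.snd = y.snd) : x = y :=
  Unitization.ext h h'

theorem Dorroh.mul_of (x : Dorroh R) (r : R) : x * of r = of (x.fst • r + x.snd * r) :=
  Dorroh.ext' (by change x.fst * 0 = 0; simp)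
    (by change x.fst • r + (0 : ℤ) • x.snd + x.snd * r = x.fst • r + x.snd * r; simp)

theorem Dorroh.of_mul (x : Dorroh R) (r : R) : of r * x = of (x.fst • r + r * x.snd) :=
  Dorroh.ext' (by change 0 * x.fst = 0; simp)
    (by change (0 : ℤ) • x.snd + x.fst • r + r * x.snd = x.fst • r + r * x.snd; simp)

end DorrohBasic

section Firm

variable (R : Type u) [NonUnitalRing R]

/-- The regular left `R`-module. -/
instance Dorroh.leftModule : Module (Dorroh R) R where
  smul x r := x.fst • r + x.snd * r
  one_smul r := by
    change (1 : Dorroh R).fst • r + (1 : Dorroh R).snd * r = r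
    simp
  mul_smul x y r := by
    change (x * y).fst • r + (x * y).snd * r =
      x.fst • (y.fst • r + y.snd * r) + x.snd * (y.fst • r + y.snd * r)
    simp only [Dorroh.fst_mul, Dorroh.snd_mul, mul_smul, smul_add, mul_add, add_mul,
      smul_mul_assoc, mul_smul_comm, mul_assoc]
    abel
  smul_zero x := by
    change x.fst • (0 : R) + x.snd * 0 = 0
    simp
  smul_add x r s := by
    change x.fst • (r + s) + x.snd * (r + s) = (x.fst • r + x.snd * r) + (x.fst • s + x.snd * s)
    rw [smul_add, mul_add]; abel
  add_smul x y r := by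
    change (x + y).fst • r + (x + y).snd * r = (x.fst • r + x.snd * r) + (y.fst • r + y.snd * r)
    rw [Dorroh.fst_add, Dorroh.snd_add, add_smul, add_mul]; abel
  zero_smul r := by
    change (0 : Dorroh R).fst • r + (0 : Dorroh R).snd * r = 0
    simp

/-- The regular right `R`-module. -/
instance Dorroh.rightModule : Module (Dorroh R)ᵐᵒᵖ R where
  smul x r := x.unop.fst • r + r * x.unop.snd
  one_smul r := by
    change (1 : Dorroh R).fst • r + r * (1 : Dorroh R).snd = r
    simp
  mul_smul x y r := by
    change (y.unop * x.unop).fst • r + r * (y.unop * x.unop).snd =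
      x.unop.fst • (y.unop.fst • r + r * y.unop.snd) +
        (y.unop.fst • r + r * y.unop.snd) * x.unop.snd
    simp only [Dorroh.fst_mul, Dorroh.snd_mul, mul_smul, smul_add, mul_add, add_mul,
      smul_mul_assoc, mul_smul_comm, mul_assoc]
    rw [smul_comm y.unop.fst x.unop.fst r]
    abel
  smul_zero x := by
    change x.unop.fst • (0 : R) + 0 * x.unop.snd = 0
    simp
  smul_add x r s := by
    change x.unop.fst • (r + s) + (r + s) * x.unop.snd =
      (x.unop.fst • r + r * x.unop.snd) + (x.unop.fst • s + s * x.unop.snd)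
    rw [smul_add, add_mul]; abel
  add_smul x y r := by
    change (x.unop + y.unop).fst • r + r * (x.unop + y.unop).snd =
      (x.unop.fst • r + r * x.unop.snd) + (y.unop.fst • r + r * y.unop.snd)
    rw [Dorroh.fst_add, Dorroh.snd_add, add_smul, mul_add]; abel
  zero_smul r := by
    change (0 : Dorroh R).fst • r + r * (0 : Dorroh R).snd = 0
    simp

instance Dorroh.smulCommClass : SMulCommClass (Dorroh R) (Dorroh R)ᵐᵒᵖ R where
  smul_comm x y r := by
    change x.fst • (y.unop.fst • r + r * y.unop.snd) +
        x.snd * (y.unop.fst • r + r * y.unop.snd) =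
      y.unop.fst • (x.fst • r + x.snd * r) + (x.fst • r + x.snd * r) * y.unop.snd
    simp only [smul_add, mul_add, add_mul, smul_mul_assoc, mul_smul_comm, mul_assoc]
    rw [smul_comm y.unop.fst x.fst r]
    abel

/-- The multiplication map `N ⊗_R R → N` of a right `R`-module. -/
def mulRight (N : Type u) [AddCommGroup N] [Module (Dorroh R)ᵐᵒᵖ N] :
    BalTensor (Dorroh R) N R →+ N :=
  BalTensor.lift
    (AddMonoidHom.mk' (fun n => AddMonoidHom.mk' (fun r => op (Dorroh.of r) • n)
        (fun r s => by rw [Dorroh.of_add, MulOpposite.op_add, add_smul]))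
      (fun n n' => by ext r; simp))
    (fun n x r => by
      change op (Dorroh.of r) • op x • n = op (Dorroh.of (x.fst • r + x.snd * r)) • n
      rw [smul_smul, ← MulOpposite.op_mul, Dorroh.mul_of])

/-- The multiplication map `R ⊗_R N → N` of a left `R`-module. -/
def mulLeft (N : Type u) [AddCommGroup N] [Module (Dorroh R) N] :
    BalTensor (Dorroh R) R N →+ N :=
  BalTensor.lift
    (AddMonoidHom.mk' (fun r => DistribSMul.toAddMonoidHom N (Dorroh.of r))
      (fun r s => by ext n; simp [Dorroh.of_add, add_smul]))
    (fun r x n => by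
      change Dorroh.of (x.fst • r + r * x.snd) • n = Dorroh.of r • x • n
      rw [smul_smul, Dorroh.of_mul])

/-- A right `R`-module `N` is firm if the multiplication map `N ⊗_R R → N` is bijective. -/
def IsFirmRight : ObjectProperty (ModuleCat.{u} (Dorroh R)ᵐᵒᵖ) :=
  fun N => Function.Bijective (mulRight R N)

/-- A left `R`-module `N` is firm if the multiplication map `R ⊗_R N → N` is bijective. -/
def IsFirmLeft : ObjectProperty (ModuleCat.{u} (Dorroh R)) :=
  fun N => Function.Bijective (mulLeft R N)

/-- The category `M_R` of firm right `R`-modules. -/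
abbrev FirmRight : Type (u + 1) := (IsFirmRight R).FullSubcategory

/-- The category `_R M` of firm left `R`-modules. -/
abbrev FirmLeft : Type (u + 1) := (IsFirmLeft R).FullSubcategory

/-- A right `R`-module `F` is flat if `F ⊗_R -` is exact (equivalently, preserves injections) on
all left `R`-modules. -/
def IsFlatRight (F : Type u) [AddCommGroup F] [Module (Dorroh R)ᵐᵒᵖ F] : Prop :=
  ∀ (X Y : Type u) [AddCommGroup X] [AddCommGroup Y] [Module (Dorroh R) X] [Module (Dorroh R) Y]
    (f : X →ₗ[Dorroh R] Y), Function.Injective f →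
    Function.Injective (BalTensor.map (B := Dorroh R) (LinearMap.id : F →ₗ[(Dorroh R)ᵐᵒᵖ] F) f)

end Firm

/-- For a subring `S` without unit of `T`, the ring morphism `Dorroh S → T` extending the
inclusion. -/
def Dorroh.toRing {T : Type*} [Ring T] (S : NonUnitalSubring T) : Dorroh S →+* T where
  toFun x := x.fst • (1 : T) + x.snd
  map_one' := by simp
  map_mul' x y := by
    change (x.fst * y.fst) • (1 : T) +
        (x.fst • (y.snd : T) + y.fst • (x.snd : T) + (x.snd : T) * y.snd) = _
    simp only [add_mul, mul_add, smul_mul_assoc, mul_smul_comm, one_mul, mul_one, mul_smul, smul_add]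
    rw [smul_comm y.fst x.fst (1 : T)]
    abel
  map_zero' := by simp
  map_add' x y := by
    change (x.fst + y.fst) • (1 : T) + ((x.snd : T) + y.snd) = _
    rw [add_smul]; abel

section Functors

variable (P Q X : Type u) [Ring P] [Ring Q] [AddCommGroup X]

/-- The functor `- ⊗_P X` from right `P`-modules to right `Q`-modules, for a `P`-`Q`-bimodule. -/
def tensorRight [Module P X] [Module Qᵐᵒᵖ X] [SMulCommClass P Qᵐᵒᵖ X] :
    ModuleCat.{u} Pᵐᵒᵖ ⥤ ModuleCat.{u} Qᵐᵒᵖ where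
  obj N := ModuleCat.of Qᵐᵒᵖ (BalTensor P N X)
  map f := ModuleCat.ofHom
    { toFun := BalTensor.map f.hom LinearMap.id
      map_add' := map_add _
      map_smul' := fun q x => by
        rw [RingHom.id_apply]
        induction x using BalTensor.induction with
        | zero => rw [smul_zero, map_zero, smul_zero]
        | pure n x => rfl
        | add x y hx hy => rw [smul_add, map_add, map_add, smul_add, hx, hy] }
  map_id N := ModuleCat.hom_ext <| LinearMap.ext fun x => BalTensor.map_id x
  map_comp f g := ModuleCat.hom_ext <| LinearMap.ext fun x =>
    (BalTensor.map_map f.hom LinearMap.id g.hom LinearMap.id x).symm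

/-- The functor `X ⊗_P -` from left `P`-modules to left `Q`-modules, for a `Q`-`P`-bimodule. -/
def tensorLeft [Module Pᵐᵒᵖ X] [Module Q X] [SMulCommClass Q Pᵐᵒᵖ X] :
    ModuleCat.{u} P ⥤ ModuleCat.{u} Q where
  obj N := ModuleCat.of Q (BalTensor P X N)
  map f := ModuleCat.ofHom
    { toFun := BalTensor.map LinearMap.id f.hom
      map_add' := map_add _
      map_smul' := fun q x => by
        rw [RingHom.id_apply]
        induction x using BalTensor.induction with
        | zero => rw [smul_zero, map_zero, smul_zero]
        | pure n x => rfl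
        | add x y hx hy => rw [smul_add, map_add, map_add, smul_add, hx, hy] }
  map_id N := ModuleCat.hom_ext <| LinearMap.ext fun x => BalTensor.map_id x
  map_comp f g := ModuleCat.hom_ext <| LinearMap.ext fun x =>
    (BalTensor.map_map LinearMap.id f.hom LinearMap.id g.hom x).symm

end Functors

/-! ### Comodules -/

section Comodules

variable (A C : Type u) [Ring A] [AddCommGroup C] [Module A C] [Module Aᵐᵒᵖ C]
  [SMulCommClass A Aᵐᵒᵖ C] [Coring A C]

/-- Right `C`-comodules. -/
structure RightComodule where
  carrier : Type u
  [addCommGroup : AddCommGroup carrier]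
  [module : Module Aᵐᵒᵖ carrier]
  /-- the coaction `M → M ⊗_A C` -/
  coact : carrier →ₗ[Aᵐᵒᵖ] BalTensor A carrier C
  coassoc : ∀ m, BalTensor.assoc (BalTensor.map coact LinearMap.id (coact m)) =
    BalTensor.map LinearMap.id (comulL (A := A) (C := C)) (coact m)
  counit : ∀ m, evalRight (1 : LeftDual A C) (coact m) = m

/-- Left `C`-comodules. -/
structure LeftComodule where
  carrier : Type u
  [addCommGroup : AddCommGroup carrier]
  [module : Module A carrier]
  /-- the coaction `M → C ⊗_A M` -/
  coact : carrier →ₗ[A] BalTensor A C carrier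
  coassoc : ∀ m, BalTensor.assoc (BalTensor.map (comulR (A := A) (C := C)) LinearMap.id (coact m)) =
    BalTensor.map LinearMap.id coact (coact m)
  counit : ∀ m, evalLeft (1 : RightDual A C) (coact m) = m

attribute [instance] RightComodule.addCommGroup RightComodule.module
  LeftComodule.addCommGroup LeftComodule.module

variable {A C}

/-- The group of colinear maps of right comodules. -/
def RightComodule.homs (M N : RightComodule A C) :
    AddSubgroup (M.carrier →ₗ[Aᵐᵒᵖ] N.carrier) where
  carrier := {h | ∀ m, N.coact (h m) = BalTensor.map h LinearMap.id (M.coact m)}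
  zero_mem' m := by
    generalize M.coact m = x
    rw [LinearMap.zero_apply, map_zero]
    induction x using BalTensor.induction with
    | zero => simp
    | pure m c => simp
    | add x y hx hy => rw [map_add, ← hx, ← hy, add_zero]
  add_mem' {h h'} hh hh' m := by
    rw [LinearMap.add_apply, map_add, hh m, hh' m]
    generalize M.coact m = x
    induction x using BalTensor.induction with
    | zero => simp
    | pure m c => simp
    | add x y hx hy => simp only [map_add, ← hx, ← hy]; abel
  neg_mem' {h} hh m := by
    rw [LinearMap.neg_apply, map_neg, hh m]
    generalize M.coact m = x
    induction x using BalTensor.induction with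
    | zero => simp
    | pure m c => simp
    | add x y hx hy => simp only [map_add, ← hx, ← hy]; abel

/-- The group of colinear maps of left comodules. -/
def LeftComodule.homs (M N : LeftComodule A C) : AddSubgroup (M.carrier →ₗ[A] N.carrier) where
  carrier := {h | ∀ m, N.coact (h m) = BalTensor.map LinearMap.id h (M.coact m)}
  zero_mem' m := by
    generalize M.coact m = x
    rw [LinearMap.zero_apply, map_zero]
    induction x using BalTensor.induction with
    | zero => simp
    | pure m c => simp
    | add x y hx hy => rw [map_add, ← hx, ← hy, add_zero]
  add_mem' {h h'} hh hh' m := by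
    rw [LinearMap.add_apply, map_add, hh m, hh' m]
    generalize M.coact m = x
    induction x using BalTensor.induction with
    | zero => simp
    | pure m c => simp
    | add x y hx hy => simp only [map_add, ← hx, ← hy]; abel
  neg_mem' {h} hh m := by
    rw [LinearMap.neg_apply, map_neg, hh m]
    generalize M.coact m = x
    induction x using BalTensor.induction with
    | zero => simp
    | pure m c => simp
    | add x y hx hy => simp only [map_add, ← hx, ← hy]; abel

/-- The category `M^C` of right `C`-comodules and colinear maps. -/
instance : Category (RightComodule A C) where
  Hom M N := RightComodule.homs M N
  id M := ⟨LinearMap.id, fun m => (BalTensor.map_id _).symm⟩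
  comp f g := ⟨g.1.comp f.1, fun m => by
    rw [LinearMap.comp_apply, g.2, f.2, BalTensor.map_map]; rfl⟩

/-- The category `^C M` of left `C`-comodules and colinear maps. -/
instance : Category (LeftComodule A C) where
  Hom M N := LeftComodule.homs M N
  id M := ⟨LinearMap.id, fun m => (BalTensor.map_id _).symm⟩
  comp f g := ⟨g.1.comp f.1, fun m => by
    rw [LinearMap.comp_apply, g.2, f.2, BalTensor.map_map]; rfl⟩

variable (A C)

/-- `C` as a left `C`-comodule, with coaction `Δ`. -/
@[reducible]
def LeftComodule.regular : LeftComodule A C where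
  carrier := C
  coact := comulL
  coassoc := Coring.coassoc
  counit := actLeft_one

/-- `^C Hom(C, M)` is a left `*C`-module through `(f h)(c) = h(c · f)`. -/
instance (M : LeftComodule A C) :
    Module (LeftDual A C) (LeftComodule.homs (LeftComodule.regular A C) M) where
  smul f h := ⟨h.1.comp (actRight f), fun c => by
    rw [LinearMap.comp_apply, h.2]
    change BalTensor.map LinearMap.id h.1 (Coring.comul (A := A) (actRight f c)) =
      BalTensor.map LinearMap.id (h.1.comp (actRight f)) (Coring.comul (A := A) c)
    rw [comul_actRight, BalTensor.map_map]; rfl⟩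
  one_smul h := Subtype.ext <| LinearMap.ext fun c => congrArg h.1 (actRight_one c)
  mul_smul f g h := Subtype.ext <| LinearMap.ext fun c => congrArg h.1 (actRight_mul f g c)
  smul_zero f := rfl
  smul_add f h h' := rfl
  add_smul f g h := Subtype.ext <| LinearMap.ext fun c =>
    (congrArg h.1 (actRight_add f g c)).trans (map_add h.1 _ _)
  zero_smul h := Subtype.ext <| LinearMap.ext fun c =>
    (congrArg h.1 (zero_smul (LeftDual A C)ᵐᵒᵖ c)).trans (map_zero h.1)

/-- The functor `^C Hom(C, -) : ^C M ⥤ _{*C} M`. -/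
def comoduleHom : LeftComodule A C ⥤ ModuleCat.{u} (LeftDual A C) where
  obj M := ModuleCat.of (LeftDual A C) (LeftComodule.homs (LeftComodule.regular A C) M)
  map {M N} g := ModuleCat.ofHom
    { toFun := fun h => (h ≫ g : LeftComodule.regular A C ⟶ N)
      map_add' := fun h h' => Subtype.ext <| LinearMap.ext fun c => map_add g.1 _ _
      map_smul' := fun f h => rfl }
  map_id M := rfl
  map_comp f g := rfl

/-- `C` as a left module over `Rat(C*)`. -/
instance : Module (Dorroh (RatRightDual A C)) C :=
  Module.compHom C (Dorroh.toRing (RatRightDual A C))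

/-- `C` as a right module over `Rat(*C)`. -/
instance : Module (Dorroh (RatLeftDual A C))ᵐᵒᵖ C :=
  Module.compHom C (RingHom.op (Dorroh.toRing (RatLeftDual A C)))

instance : SMulCommClass (Dorroh (RatRightDual A C)) (Dorroh (RatLeftDual A C))ᵐᵒᵖ C where
  smul_comm x y c := smul_comm (Dorroh.toRing (RatRightDual A C) x)
    (op (Dorroh.toRing (RatLeftDual A C) y.unop)) c

instance : SMulCommClass (Dorroh (RatRightDual A C)) Aᵐᵒᵖ C where
  smul_comm x a c := (map_smul (actLeft (Dorroh.toRing (RatRightDual A C) x)) a c)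

/-- The functor `- ⊗_R C` with `R = Rat(C*)` from all right `R`-modules to all right
`Rat(*C)`-modules. -/
def tensorRat : ModuleCat.{u} (Dorroh (RatRightDual A C))ᵐᵒᵖ ⥤
    ModuleCat.{u} (Dorroh (RatLeftDual A C))ᵐᵒᵖ :=
  tensorRight (Dorroh (RatRightDual A C)) (Dorroh (RatLeftDual A C)) C

/-- `Δ` as a left `Rat(C*)`-linear map. -/
def comulRat : C →ₗ[Dorroh (RatRightDual A C)] BalTensor A C C where
  toFun := Coring.comul
  map_add' := map_add _
  map_smul' x c := comul_actLeft (Dorroh.toRing (RatRightDual A C) x) c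

/-- `c ↦ n ⊗ c` as a right `A`-linear map. -/
def tmulRat {N : Type u} [AddCommGroup N] [Module (Dorroh (RatRightDual A C))ᵐᵒᵖ N] (n : N) :
    C →ₗ[Aᵐᵒᵖ] BalTensor (Dorroh (RatRightDual A C)) N C where
  toFun c := tmul _ n c
  map_add' c d := map_add _ c d
  map_smul' a c := rfl

/-- The coaction `n ⊗ c ↦ Σ (n ⊗ c₁) ⊗ c₂` of `N ⊗_R C`, as an additive map. -/
def tensorCoact (N : Type u) [AddCommGroup N] [Module (Dorroh (RatRightDual A C))ᵐᵒᵖ N] :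
    BalTensor (Dorroh (RatRightDual A C)) N C →+
      BalTensor A (BalTensor (Dorroh (RatRightDual A C)) N C) C :=
  BalTensor.assocInv.comp (BalTensor.map LinearMap.id (comulRat A C))

theorem tensorCoact_tmul {N : Type u} [AddCommGroup N]
    [Module (Dorroh (RatRightDual A C))ᵐᵒᵖ N] (n : N) (c : C) :
    tensorCoact A C N (tmul _ n c) =
      BalTensor.map (tmulRat A C n) LinearMap.id (Coring.comul (A := A) c) := by
  change BalTensor.assocInv (tmul _ n (Coring.comul (A := A) c)) = _
  generalize Coring.comul (A := A) c = y
  induction y using BalTensor.induction with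
  | zero => simp only [map_zero]
  | pure c d => rfl
  | add x y hx hy => simp only [map_add, hx, hy]

/-- The coaction `n ⊗ c ↦ Σ (n ⊗ c₁) ⊗ c₂` of `N ⊗_R C`. -/
def tensorCoactL (N : Type u) [AddCommGroup N] [Module (Dorroh (RatRightDual A C))ᵐᵒᵖ N] :
    BalTensor (Dorroh (RatRightDual A C)) N C →ₗ[Aᵐᵒᵖ]
      BalTensor A (BalTensor (Dorroh (RatRightDual A C)) N C) C where
  toFun := tensorCoact A C N
  map_add' := map_add _
  map_smul' := fun a x => by
    rw [RingHom.id_apply]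
    induction x using BalTensor.induction with
    | zero => rw [smul_zero, map_zero, smul_zero]
    | pure n c =>
      rw [BalTensor.op_smul_tmul, tensorCoact_tmul, tensorCoact_tmul]
      induction a using MulOpposite.rec' with
      | _ a =>
      rw [Coring.comul_op_smul]
      generalize Coring.comul (A := A) c = y
      induction y using BalTensor.induction with
      | zero => rw [smul_zero, map_zero, smul_zero]
      | pure c d => rfl
      | add x y hx hy => rw [smul_add, map_add, map_add, smul_add, hx, hy]
    | add x y hx hy => rw [smul_add, map_add, map_add, smul_add, hx, hy]

theorem tensorCoactL_tmul {N : Type u} [AddCommGroup N]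
    [Module (Dorroh (RatRightDual A C))ᵐᵒᵖ N] (n : N) (c : C) :
    tensorCoactL A C N (tmul _ n c) =
      BalTensor.map (tmulRat A C n) LinearMap.id (comulR (A := A) c) :=
  tensorCoact_tmul A C n c

theorem tensorCoactL_comp {N : Type u} [AddCommGroup N]
    [Module (Dorroh (RatRightDual A C))ᵐᵒᵖ N] (n : N) (c d : C) :
    BalTensor.assoc (tmul A (tensorCoactL A C N (tmul _ n c)) d) =
      BalTensor.map (tmulRat A C n) LinearMap.id
        (BalTensor.assoc (tmul A (comulR (A := A) c) d)) := by
  rw [tensorCoactL_tmul]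
  generalize comulR (A := A) c = z
  induction z using BalTensor.induction with
  | zero => rw [map_zero, map_zero, AddMonoidHom.zero_apply, map_zero, map_zero, AddMonoidHom.zero_apply,
      map_zero, map_zero]
  | add x y hx hy => rw [map_add, map_add, map_add, AddMonoidHom.add_apply,
      AddMonoidHom.add_apply, map_add, map_add, map_add, hx, hy]
  | pure c e => rfl

theorem tensorCoactL_coassoc {N : Type u} [AddCommGroup N]
    [Module (Dorroh (RatRightDual A C))ᵐᵒᵖ N] (x : BalTensor (Dorroh (RatRightDual A C)) N C) :
    BalTensor.assoc (BalTensor.map (tensorCoactL A C N) LinearMap.id (tensorCoactL A C N x)) =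
      BalTensor.map LinearMap.id (comulL (A := A) (C := C)) (tensorCoactL A C N x) := by
  induction x using BalTensor.induction with
  | zero => rw [map_zero, map_zero, map_zero, map_zero]
  | add x y hx hy => rw [map_add, map_add, map_add, map_add, hx, hy]
  | pure n c =>
    have h := congrArg (BalTensor.map (N := BalTensor A C C) (tmulRat A C n) LinearMap.id)
      (Coring.coassoc (A := A) c)
    rw [tensorCoactL_tmul]
    refine Eq.trans ?_ (h.trans ?_)
    · change _ = BalTensor.map (tmulRat A C n) LinearMap.id
        (BalTensor.assoc (BalTensor.map comulR LinearMap.id (comulR (A := A) c)))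
      generalize comulR (A := A) c = y
      induction y using BalTensor.induction with
      | zero => rw [map_zero, map_zero, map_zero, map_zero, map_zero, map_zero]
      | add x y hx hy => rw [map_add, map_add, map_add, map_add, map_add, map_add, hx, hy]
      | pure c d => exact tensorCoactL_comp A C n c d
    · rw [BalTensor.map_map, BalTensor.map_map]
      rfl

theorem tensorCoactL_counit {N : Type u} [AddCommGroup N]
    [Module (Dorroh (RatRightDual A C))ᵐᵒᵖ N] (x : BalTensor (Dorroh (RatRightDual A C)) N C) :
    evalRight (1 : LeftDual A C) (tensorCoactL A C N x) = x := by
  induction x using BalTensor.induction with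
  | zero => rw [map_zero, map_zero]
  | add x y hx hy => rw [map_add, map_add, hx, hy]
  | pure n c =>
    have h := congrArg (tmulRat A C n) (actRight_one (A := A) c)
    refine Eq.trans ?_ h
    rw [tensorCoactL_tmul]
    change _ = tmulRat A C n (evalRight 1 (comulR (A := A) c))
    generalize comulR (A := A) c = y
    induction y using BalTensor.induction with
    | zero => rw [map_zero, map_zero, map_zero, map_zero]
    | add x y hx hy => rw [map_add, map_add, map_add, map_add, hx, hy]
    | pure c d => rfl

/-- `f ⊗_R C` as a right `A`-linear map. -/
def tensorRatMap {N N' : Type u} [AddCommGroup N] [Module (Dorroh (RatRightDual A C))ᵐᵒᵖ N]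
    [AddCommGroup N'] [Module (Dorroh (RatRightDual A C))ᵐᵒᵖ N']
    (f : N →ₗ[(Dorroh (RatRightDual A C))ᵐᵒᵖ] N') :
    BalTensor (Dorroh (RatRightDual A C)) N C →ₗ[Aᵐᵒᵖ]
      BalTensor (Dorroh (RatRightDual A C)) N' C where
  toFun := BalTensor.map f LinearMap.id
  map_add' := map_add _
  map_smul' := fun a x => by
    rw [RingHom.id_apply]
    induction x using BalTensor.induction with
    | zero => rw [smul_zero, map_zero, smul_zero]
    | pure n x => rfl
    | add x y hx hy => rw [smul_add, map_add, map_add, smul_add, hx, hy]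

/-- The right `C`-comodule `N ⊗_R C`. -/
def tensorComoduleObj (N : ModuleCat.{u} (Dorroh (RatRightDual A C))ᵐᵒᵖ) : RightComodule A C where
  carrier := BalTensor (Dorroh (RatRightDual A C)) N C
  coact := tensorCoactL A C N
  coassoc := tensorCoactL_coassoc A C
  counit := tensorCoactL_counit A C

/-- The functor `- ⊗_R C` with `R = Rat(C*)` from all right `R`-modules to right `C`-comodules. -/
def tensorComodule : ModuleCat.{u} (Dorroh (RatRightDual A C))ᵐᵒᵖ ⥤ RightComodule A C where
  obj N := tensorComoduleObj A C N
  map {N N'} f :=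
    ⟨tensorRatMap A C f.hom, fun x => by
      change tensorCoact A C N' (BalTensor.map f.hom LinearMap.id x) =
        BalTensor.map _ LinearMap.id (tensorCoact A C N x)
      induction x using BalTensor.induction with
      | zero => simp only [map_zero]
      | add x y hx hy => simp only [map_add, hx, hy]
      | pure n c =>
        rw [BalTensor.map_tmul, LinearMap.id_apply, tensorCoact_tmul, tensorCoact_tmul,
          BalTensor.map_map]
        rfl⟩
  map_id N := Subtype.ext <| LinearMap.ext fun x => BalTensor.map_id x
  map_comp f g := Subtype.ext <| LinearMap.ext fun x =>
    (BalTensor.map_map f.hom LinearMap.id g.hom LinearMap.id x).symm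

end Comodules

section StructureFunctors

variable (A C : Type u) [Ring A] [AddCommGroup C] [Module A C] [Module Aᵐᵒᵖ C]
  [SMulCommClass A Aᵐᵒᵖ C] [Coring A C]

/-- The functor `S ⊗_S ^C Hom(C, -)` with `S = Rat(*C)` from left `C`-comodules to all left
`S`-modules. -/
noncomputable def firmComoduleHom : LeftComodule A C ⥤ ModuleCat.{u} (Dorroh (RatLeftDual A C)) :=
  comoduleHom A C ⋙ ModuleCat.restrictScalars (Dorroh.toRing (RatLeftDual A C)) ⋙
    tensorLeft (Dorroh (RatLeftDual A C)) (Dorroh (RatLeftDual A C)) (RatLeftDual A C)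

end StructureFunctors

end QFCoring

namespace QFCoring

set_option linter.unusedSectionVars false

/-! ### Balanced tensor products -/

section BalTensorLemmas

variable {B M N P : Type*} [Ring B] [AddCommGroup M] [Module Bᵐᵒᵖ M] [AddCommGroup N] [Module B N]
  [AddCommGroup P]

/-! Write △ for the Morita map. Everything passes through one condition, `HasTraceUnits`: every
finite subset of C is fixed by the left action of a single element of the image of △.

The bridge is a duality. An element p of Q̃ corresponds to a right *C-linear map q : C → *C by
q(c)(d) = p(d)(c), and then d · q(c) = p(d) · c (`exists_qTilde`, `QTilde.op_flip_smul`). Hence Σ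
z_l · j_l(c) = △(Σ z_l ⊗ p_l) · c, so being locally quasi-Frobenius amounts to having trace units
together with weak local projectivity on the right (`IsLeftLocallyQuasiFrobenius.hasTraceUnits`,
`HasTraceUnits.isLeftLocallyQuasiFrobenius`). Trace units make Rat(C*) dense and △ onto. They also
make △ injective, because (△(y) c) ⊗ p = y p(c) in C ⊗ Q̃ (`tmul_moritaMap_smul`). Conversely,
density and surjectivity of △ give trace units back.

Trace units act as a local partition of unity, and this yields all the categorical properties. In a
left comodule, m = Σ p_i(z_i) m, and each map d ↦ p_i(d) m is colinear; so C generates, and a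
*C-linear map between the groups of colinear maps out of C is glued from its values on these maps
(`HasTraceUnits.exists_hom_of_linear`). In N ⊗_R C an element of Q̃ contracts n ⊗ c to n p(c), which
recovers a linear map N → N' from a *C-linear map N ⊗ C → N' ⊗ C (`exists_linearMap_of_linear`). In
C ⊗_S X one has p(z) w = z ⊗ w', where w' ∈ X depends naturally on w and X, so injectivity of X → Y
passes to C ⊗_S X → C ⊗_S Y (`HasTraceUnits.isFlatRight`).

For the converses, a generator must detect the projection of Rat(C*) onto its quotient by the image
of △; colinear maps C → Rat(C*) are elements of Q̃, so the projection kills all of them and is zero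
(`surjective_of_isSeparator`).

The converses for faithfulness of - ⊗_R C and for flatness share a device. To an additive map θ : C
→ C* (or C → *C) attach its linearity defect, which vanishes exactly when θ comes from Q̃. The
endomorphism of C given by a rational element is linear and of finite rank. Expanding it in a finite
dual basis gives additive maps θ_x with Σ defect(θ_x) ⊗ x = 0, although the single defects need not
vanish (`exists_sum_tmul_eq_zero`, `exists_sum_tmul_coeval_eq_zero`). For - ⊗_R C, a universal
C*-module is built with a generator n and the relations n θ(z) = ι_z(defect θ). The vanishing sums
give n ⊗ C = 0, faithfulness gives n r = 0 for r in R, and the relation witnessing n r = 0 has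
defect zero: it expresses r through values of elements of Q̃ (`TensorFaithful.surjective`). For
flatness, the vanishing sum is lifted along the injection of the additive maps modulo the kernel of
the defect (`IsFlatRight.hasTraceUnits`). -/

theorem BalTensor.eq_of_eq_on_tmul {f g : BalTensor B M N →+ P}
    (h : ∀ m n, f (tmul B m n) = g (tmul B m n)) (x : BalTensor B M N) : f x = g x :=
  DFunLike.congr_fun (BalTensor.hom_ext h) x

theorem BalTensor.map_id_bijective {N' : Type*} [AddCommGroup N'] [Module B N'] (f : N →ₗ[B] N')
    (hf : Function.Bijective f) :
    Function.Bijective (BalTensor.map (LinearMap.id : M →ₗ[Bᵐᵒᵖ] M) f) := by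
  let e := LinearEquiv.ofBijective f hf
  refine Function.bijective_iff_has_inverse.2
    ⟨BalTensor.map LinearMap.id e.symm.toLinearMap, fun x => ?_, fun x => ?_⟩
  · rw [BalTensor.map_map, ← BalTensor.map_id x, BalTensor.map_map]
    congr 1
    congr 1
    ext n
    exact e.symm_apply_apply n
  · rw [BalTensor.map_map, ← BalTensor.map_id x, BalTensor.map_map]
    congr 1
    congr 1
    ext n
    exact e.apply_symm_apply n

theorem BalTensor.map_bijective_id {M' : Type*} [AddCommGroup M'] [Module Bᵐᵒᵖ M']
    (f : M →ₗ[Bᵐᵒᵖ] M') (hf : Function.Bijective f) :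
    Function.Bijective (BalTensor.map f (LinearMap.id : N →ₗ[B] N)) := by
  let e := LinearEquiv.ofBijective f hf
  refine Function.bijective_iff_has_inverse.2
    ⟨BalTensor.map e.symm.toLinearMap LinearMap.id, fun x => ?_, fun x => ?_⟩
  · rw [BalTensor.map_map, ← BalTensor.map_id x, BalTensor.map_map]
    congr 1
    congr 1
    ext n
    exact e.symm_apply_apply n
  · rw [BalTensor.map_map, ← BalTensor.map_id x, BalTensor.map_map]
    congr 1
    congr 1
    ext n
    exact e.apply_symm_apply n

theorem BalTensor.assoc_bijective {B' Q : Type*} [Ring B'] [Module B'ᵐᵒᵖ N]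
    [SMulCommClass B B'ᵐᵒᵖ N] [AddCommGroup Q] [Module B' Q] :
    Function.Bijective (BalTensor.assoc (B := B) (B' := B') (M := M) (N := N) (Q := Q)) :=
  Function.bijective_iff_has_inverse.2
    ⟨BalTensor.assocInv, BalTensor.assocInv_assoc, BalTensor.assoc_assocInv⟩

end BalTensorLemmas

/-! ### Weakly locally projective modules -/

section WeaklyLocallyProjective

variable {R X : Type u} [Ring R] [AddCommGroup X] [Module R X]

/-- Lift the identity of X along the free cover R^(X) → X on the span of E; the coordinates of the
lift are the required functionals, and the supports of the lifted elements of E index the sum. -/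
theorem IsWeaklyLocallyProjective.exists_dualBasis (h : IsWeaklyLocallyProjective R X)
    (E : Finset X) :
    ∃ (s : Finset X) (f : X → X →ₗ[R] R), ∀ e ∈ E, e = ∑ x ∈ s, f x e • x := by
  classical
  obtain ⟨φ, hφ⟩ := h (Submodule.span R E) ⟨E, rfl⟩ (X →₀ R) X
    (Finsupp.linearCombination R id) LinearMap.id (Finsupp.linearCombination_id_surjective R X)
  refine ⟨E.biUnion fun e => (φ e).support, fun x => (Finsupp.lapply x).comp φ, fun e he => ?_⟩
  have h1 := hφ e (Submodule.subset_span he)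
  rw [LinearMap.id_apply, Finsupp.linearCombination_apply, Finsupp.sum_of_support_subset
    (s := E.biUnion fun e => (φ e).support) _ (fun x hx => Finset.mem_biUnion.2 ⟨e, he, hx⟩) _
    (by simp)] at h1
  exact h1.symm

end WeaklyLocallyProjective

/-! ### Finite dual bases of the coring, and separation of tensors by the dual rings -/

section Coring

variable {A C : Type u} [Ring A] [AddCommGroup C] [Module A C] [Module Aᵐᵒᵖ C]
  [SMulCommClass A Aᵐᵒᵖ C]

/-- A finite left dual basis of the coring on a finite set. -/
theorem exists_leftDualBasis (hC : IsWeaklyLocallyProjective A C) (E : Finset C) :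
    ∃ (s : Finset C) (f : C → LeftDual A C), ∀ e ∈ E, e = ∑ x ∈ s, f x e • x :=
  hC.exists_dualBasis E

theorem exists_rightDualBasis (hC : IsWeaklyLocallyProjective Aᵐᵒᵖ C) (E : Finset C) :
    ∃ (s : Finset C) (f : C → RightDual A C), ∀ e ∈ E, e = ∑ x ∈ s, op (f x e) • x := by
  obtain ⟨s, f, h⟩ := hC.exists_dualBasis E
  refine ⟨s, fun x => ({ toFun := fun c => (f x c).unop
                         map_add' := fun c d => congrArg unop (map_add (f x) c d)
                         map_smul' := fun a c => congrArg unop (map_smul (f x) a c) } : C →ₗ[Aᵐᵒᵖ] A), fun e he => h e he⟩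

/-- E collects the right legs of one presentation of t. Every dual basis on E then works, which is
what allows the additive step to use the same basis for both summands. -/
theorem exists_eq_sum_tmul_evalRight {M : Type*} [AddCommGroup M] [Module Aᵐᵒᵖ M] (t : BalTensor A M C) :
    ∃ E : Finset C, ∀ (s : Finset C) (f : C → LeftDual A C),
      (∀ e ∈ E, e = ∑ x ∈ s, f x e • x) → t = ∑ x ∈ s, tmul A (evalRight (f x) t) x := by
  classical
  induction t using BalTensor.induction with
  | zero => exact ⟨∅, fun s f _ => by simp⟩
  | pure m c =>
    refine ⟨{c}, fun s f h => ?_⟩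
    conv_lhs => rw [h c (Finset.mem_singleton_self c), map_sum]
    exact Finset.sum_congr rfl fun x _ => by rw [evalRight_tmul, tmul_balanced]
  | add x y hx hy =>
    obtain ⟨E, hE⟩ := hx
    obtain ⟨E', hE'⟩ := hy
    refine ⟨E ∪ E', fun s f h => ?_⟩
    conv_lhs => rw [hE s f fun e he => h e (Finset.mem_union_left _ he),
      hE' s f fun e he => h e (Finset.mem_union_right _ he)]
    simp only [map_add, AddMonoidHom.add_apply, Finset.sum_add_distrib]

/-- The canonical map M ⊗_A C → Hom(*C, M) is injective: all coefficients of t in a finite dual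
basis are values of that map. Tensors may therefore be compared after evaluation. -/
theorem evalRight_eq_zero (hC : IsWeaklyLocallyProjective A C) {M : Type*} [AddCommGroup M]
    [Module Aᵐᵒᵖ M] {t : BalTensor A M C} (h : ∀ f : LeftDual A C, evalRight f t = 0) : t = 0 := by
  obtain ⟨E, hE⟩ := exists_eq_sum_tmul_evalRight t
  obtain ⟨s, f, hf⟩ := exists_leftDualBasis hC E
  rw [hE s f hf]
  exact Finset.sum_eq_zero fun x _ => by rw [h, map_zero, AddMonoidHom.zero_apply]

theorem exists_eq_sum_tmul_evalLeft {M : Type*} [AddCommGroup M] [Module A M] (t : BalTensor A C M) :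
    ∃ E : Finset C, ∀ (s : Finset C) (f : C → RightDual A C),
      (∀ e ∈ E, e = ∑ x ∈ s, op (f x e) • x) → t = ∑ x ∈ s, tmul A x (evalLeft (f x) t) := by
  classical
  induction t using BalTensor.induction with
  | zero => exact ⟨∅, fun s f _ => by simp⟩
  | pure c m =>
    refine ⟨{c}, fun s f h => ?_⟩
    conv_lhs => rw [h c (Finset.mem_singleton_self c), map_sum, AddMonoidHom.finsetSum_apply]
    exact Finset.sum_congr rfl fun x _ => by rw [evalLeft_tmul, tmul_balanced]
  | add x y hx hy =>
    obtain ⟨E, hE⟩ := hx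
    obtain ⟨E', hE'⟩ := hy
    refine ⟨E ∪ E', fun s f h => ?_⟩
    conv_lhs => rw [hE s f fun e he => h e (Finset.mem_union_left _ he),
      hE' s f fun e he => h e (Finset.mem_union_right _ he)]
    simp only [map_add, Finset.sum_add_distrib]

theorem evalLeft_eq_zero (hC : IsWeaklyLocallyProjective Aᵐᵒᵖ C) {M : Type*} [AddCommGroup M]
    [Module A M] {t : BalTensor A C M} (h : ∀ f : RightDual A C, evalLeft f t = 0) : t = 0 := by
  obtain ⟨E, hE⟩ := exists_eq_sum_tmul_evalLeft t
  obtain ⟨s, f, hf⟩ := exists_rightDualBasis hC E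
  rw [hE s f hf]
  exact Finset.sum_eq_zero fun x _ => by rw [h, map_zero]

theorem evalRight_injective (hC : IsWeaklyLocallyProjective A C) {M : Type*} [AddCommGroup M]
    [Module Aᵐᵒᵖ M] {t t' : BalTensor A M C}
    (h : ∀ f : LeftDual A C, evalRight f t = evalRight f t') : t = t' :=
  sub_eq_zero.1 (evalRight_eq_zero hC fun f => by rw [map_sub, h, sub_self])

theorem evalLeft_injective (hC : IsWeaklyLocallyProjective Aᵐᵒᵖ C) {M : Type*} [AddCommGroup M]
    [Module A M] {t t' : BalTensor A C M}
    (h : ∀ f : RightDual A C, evalLeft f t = evalLeft f t') : t = t' :=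
  sub_eq_zero.1 (evalLeft_eq_zero hC fun f => by rw [map_sub, h, sub_self])

/-- `*C` separates the points of `C`. -/
theorem eq_of_leftDual (hC : IsWeaklyLocallyProjective A C) {c d : C}
    (h : ∀ f : LeftDual A C, f c = f d) : c = d := by
  classical
  obtain ⟨s, f, hf⟩ := exists_leftDualBasis hC {c, d}
  rw [hf c (by simp), hf d (by simp)]
  exact Finset.sum_congr rfl fun x _ => by rw [h]

/-- `C*` separates the points of `C`. -/
theorem eq_of_rightDual (hC : IsWeaklyLocallyProjective Aᵐᵒᵖ C) {c d : C}
    (h : ∀ f : RightDual A C, f c = f d) : c = d := by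
  classical
  obtain ⟨s, f, hf⟩ := exists_rightDualBasis hC {c, d}
  rw [hf c (by simp), hf d (by simp)]
  exact Finset.sum_congr rfl fun x _ => by rw [h]

/-! ### The two dual rings acting on the coring -/

variable [Coring A C]

theorem LeftDual.mul_apply' (f g : LeftDual A C) (c : C) : (f * g) c = g (op f • c) := rfl

theorem RightDual.mul_apply' (f g : RightDual A C) (c : C) : (f * g) c = f (g • c) := rfl

/-- `g(c · s) = s(g · c)` for `g` in `C*` and `s` in `*C`. -/
theorem rightDual_op_smul (g : RightDual A C) (s : LeftDual A C) (c : C) :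
    g (op s • c) = s (g • c) := by
  change g (evalRight s (Coring.comul (A := A) c)) = s (evalLeft g (Coring.comul (A := A) c))
  generalize Coring.comul (A := A) c = x
  induction x using BalTensor.induction with
  | zero => simp only [map_zero]
  | pure x y => simp
  | add x y hx hy => simp only [map_add, hx, hy]

/-- The left A-action on C is the restriction of the C*-action along a ↦ aε; hence C*-linear maps
are automatically left A-linear. -/
theorem RightDual.smul_one_smul (a : A) (c : C) : (a • (1 : RightDual A C)) • c = a • c := by
  conv_rhs => rw [← one_smul (RightDual A C) c]
  change evalLeft _ (Coring.comul (A := A) c) = a • evalLeft _ (Coring.comul (A := A) c)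
  generalize Coring.comul (A := A) c = x
  induction x using BalTensor.induction with
  | zero => simp only [map_zero, smul_zero]
  | pure x y => simp [mul_smul]
  | add x y hx hy => simp only [map_add, hx, hy, smul_add]

theorem LeftDual.smul_one_smul (a : A) (c : C) :
    op (op a • (1 : LeftDual A C)) • c = op a • c := by
  conv_rhs => rw [← one_smul (LeftDual A C)ᵐᵒᵖ c]
  change evalRight _ (Coring.comul (A := A) c) = op a • evalRight _ (Coring.comul (A := A) c)
  generalize Coring.comul (A := A) c = x
  induction x using BalTensor.induction with
  | zero => simp only [map_zero, smul_zero]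
  | pure x y => simp [mul_smul]
  | add x y hx hy => simp only [map_add, hx, hy, smul_add]

theorem RightDual.smul_mul (a : A) (f g : RightDual A C) : (a • f) * g = a • (f * g) := rfl

theorem RightDual.smul_one_mul (a : A) (f : RightDual A C) :
    (a • (1 : RightDual A C)) * f = a • f := by
  rw [RightDual.smul_mul, one_mul]

theorem LeftDual.mul_smul_one (a : A) (f : LeftDual A C) :
    f * (op a • (1 : LeftDual A C)) = op a • f := by
  ext c
  change (op a • (1 : LeftDual A C)) (op f • c) = _
  rw [LeftDual.op_smul_apply, LeftDual.op_smul_apply]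
  conv_rhs => rw [← mul_one f, LeftDual.mul_apply']

/-- The ring morphism `A → C*`. -/
def RightDual.ofRing : A →+* RightDual A C where
  toFun a := a • 1
  map_one' := one_smul _ _
  map_zero' := zero_smul _ _
  map_add' a b := add_smul _ _ _
  map_mul' a b := by rw [RightDual.smul_one_mul, mul_smul]

theorem RightDual.ofRing_apply (a : A) : RightDual.ofRing (C := C) a = a • 1 := rfl

theorem RightDual.mul_ofRing_apply (f : RightDual A C) (a : A) (c : C) :
    (f * (RightDual.ofRing a : RightDual A C)) c = f (a • c) := by
  rw [RightDual.mul_apply', RightDual.ofRing_apply, RightDual.smul_one_smul]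

theorem LeftDual.smul_one_mul_apply (a : A) (f : LeftDual A C) (c : C) :
    ((op a • (1 : LeftDual A C)) * f) c = f (op a • c) := by
  rw [LeftDual.mul_apply', LeftDual.smul_one_smul]

/-! ### Density -/

/-- The sets of functionals with prescribed values on a finite subset of C form a neighbourhood
basis. -/
theorem ratRightDualDense_iff : RatRightDualDense A C ↔ ∀ (f : RightDual A C) (E : Finset C),
    ∃ r ∈ RatRightDual A C, ∀ c ∈ E, r c = f c := by
  let : TopologicalSpace A := ⊥
  have : DiscreteTopology A := ⟨rfl⟩
  let := finiteTopologyRightDual A C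
  have hi : Topology.IsInducing (fun (f : RightDual A C) (c : C) => f c) := ⟨rfl⟩
  constructor
  · intro h f E
    have hU : IsOpen {g : RightDual A C | ∀ c ∈ E, g c = f c} := by
      have : {g : RightDual A C | ∀ c ∈ E, g c = f c} =
          ⋂ c ∈ E, (fun g : RightDual A C => g c) ⁻¹' {f c} := by
        ext g; simp
      rw [this]
      refine isOpen_biInter_finset fun c _ => (isOpen_discrete {f c}).preimage ?_
      exact (continuous_apply c).comp hi.continuous
    obtain ⟨r, hr, hr'⟩ := Dense.inter_open_nonempty h _ hU ⟨f, fun c _ => rfl⟩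
    exact ⟨r, hr', hr⟩
  · intro h
    refine dense_iff_inter_open.2 ?_
    rintro U hU ⟨f, hf⟩
    obtain ⟨V, hV, rfl⟩ := hi.isOpen_iff.1 hU
    obtain ⟨E, W, hW, hWV⟩ := isOpen_pi_iff.1 hV _ hf
    obtain ⟨r, hr, hrE⟩ := h f E
    refine ⟨r, hWV fun c hc => ?_, hr⟩
    change r c ∈ W c
    rw [hrE c hc]
    exact (hW c hc).2

theorem ratLeftDualDense_iff : RatLeftDualDense A C ↔ ∀ (f : LeftDual A C) (E : Finset C),
    ∃ r ∈ RatLeftDual A C, ∀ c ∈ E, r c = f c := by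
  let : TopologicalSpace A := ⊥
  have : DiscreteTopology A := ⟨rfl⟩
  let := finiteTopologyLeftDual A C
  have hi : Topology.IsInducing (fun (f : LeftDual A C) (c : C) => f c) := ⟨rfl⟩
  constructor
  · intro h f E
    have hU : IsOpen {g : LeftDual A C | ∀ c ∈ E, g c = f c} := by
      have : {g : LeftDual A C | ∀ c ∈ E, g c = f c} =
          ⋂ c ∈ E, (fun g : LeftDual A C => g c) ⁻¹' {f c} := by
        ext g; simp
      rw [this]
      refine isOpen_biInter_finset fun c _ => (isOpen_discrete {f c}).preimage ?_
      exact (continuous_apply c).comp hi.continuous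
    obtain ⟨r, hr, hr'⟩ := Dense.inter_open_nonempty h _ hU ⟨f, fun c _ => rfl⟩
    exact ⟨r, hr', hr⟩
  · intro h
    refine dense_iff_inter_open.2 ?_
    rintro U hU ⟨f, hf⟩
    obtain ⟨V, hV, rfl⟩ := hi.isOpen_iff.1 hU
    obtain ⟨E, W, hW, hWV⟩ := isOpen_pi_iff.1 hV _ hf
    obtain ⟨r, hr, hrE⟩ := h f E
    refine ⟨r, hWV fun c hc => ?_, hr⟩
    change r c ∈ W c
    rw [hrE c hc]
    exact (hW c hc).2

/-- A tensor has finitely many left legs, so evaluation on it is continuous for the finite topology.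
This turns density into local units. -/
theorem exists_evalLeft_congr {M : Type*} [AddCommGroup M] [Module A M] (t : BalTensor A C M) :
    ∃ E : Finset C, ∀ f g : RightDual A C, (∀ c ∈ E, f c = g c) → evalLeft f t = evalLeft g t := by
  classical
  induction t using BalTensor.induction with
  | zero => exact ⟨∅, fun f g _ => by simp⟩
  | pure c m => exact ⟨{c}, fun f g h => by simp [h c (Finset.mem_singleton_self c)]⟩
  | add x y hx hy =>
    obtain ⟨E, hE⟩ := hx
    obtain ⟨E', hE'⟩ := hy
    refine ⟨E ∪ E', fun f g h => ?_⟩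
    rw [map_add, map_add, hE f g fun c hc => h c (Finset.mem_union_left _ hc),
      hE' f g fun c hc => h c (Finset.mem_union_right _ hc)]

theorem exists_evalRight_congr {M : Type*} [AddCommGroup M] [Module Aᵐᵒᵖ M]
    (t : BalTensor A M C) :
    ∃ E : Finset C, ∀ f g : LeftDual A C, (∀ c ∈ E, f c = g c) →
      evalRight f t = evalRight g t := by
  classical
  induction t using BalTensor.induction with
  | zero => exact ⟨∅, fun f g _ => by simp⟩
  | pure m c => exact ⟨{c}, fun f g h => by simp [h c (Finset.mem_singleton_self c)]⟩
  | add x y hx hy =>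
    obtain ⟨E, hE⟩ := hx
    obtain ⟨E', hE'⟩ := hy
    refine ⟨E ∪ E', fun f g h => ?_⟩
    rw [map_add, map_add, hE f g fun c hc => h c (Finset.mem_union_left _ hc),
      hE' f g fun c hc => h c (Finset.mem_union_right _ hc)]

/-- Local units for the left action on `C`. -/
theorem RatRightDualDense.exists_smul_eq (h : RatRightDualDense A C) (E : Finset C) :
    ∃ r ∈ RatRightDual A C, ∀ c ∈ E, r • c = c := by
  classical
  choose F hF using fun c : C => exists_evalLeft_congr (Coring.comul (A := A) c)
  obtain ⟨r, hr, hr'⟩ := ratRightDualDense_iff.1 h 1 (E.biUnion F)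
  refine ⟨r, hr, fun c hc => ?_⟩
  conv_rhs => rw [← one_smul (RightDual A C) c]
  exact hF c r 1 fun x hx => hr' x (Finset.mem_biUnion.2 ⟨c, hc, hx⟩)

theorem RatLeftDualDense.exists_smul_eq (h : RatLeftDualDense A C) (E : Finset C) :
    ∃ r ∈ RatLeftDual A C, ∀ c ∈ E, op r • c = c := by
  classical
  choose F hF using fun c : C => exists_evalRight_congr (Coring.comul (A := A) c)
  obtain ⟨r, hr, hr'⟩ := ratLeftDualDense_iff.1 h 1 (E.biUnion F)
  refine ⟨r, hr, fun c hc => ?_⟩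
  conv_rhs => rw [← one_smul (LeftDual A C)ᵐᵒᵖ c]
  exact hF c r 1 fun x hx => hr' x (Finset.mem_biUnion.2 ⟨c, hc, hx⟩)

/-- Left local units of `Rat(C*)`. -/
theorem RatRightDualDense.exists_mul_eq (h : RatRightDualDense A C)
    (E : Finset (RatRightDual A C)) : ∃ e ∈ RatRightDual A C, ∀ r ∈ E, e * r.1 = r.1 := by
  classical
  choose t ht using fun r : RatRightDual A C => r.2
  choose F hF using fun r : RatRightDual A C => exists_evalLeft_congr (t r)
  obtain ⟨e, he, he'⟩ := ratRightDualDense_iff.1 h 1 (E.biUnion F)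
  refine ⟨e, he, fun r hr => ?_⟩
  rw [ht, hF r e 1 fun x hx => he' x (Finset.mem_biUnion.2 ⟨r, hr, hx⟩), ← ht, one_mul]

/-- Right local units of `Rat(*C)`. -/
theorem RatLeftDualDense.exists_mul_eq (h : RatLeftDualDense A C)
    (E : Finset (RatLeftDual A C)) : ∃ e ∈ RatLeftDual A C, ∀ r ∈ E, r.1 * e = r.1 := by
  classical
  choose t ht using fun r : RatLeftDual A C => r.2
  choose F hF using fun r : RatLeftDual A C => exists_evalRight_congr (t r)
  obtain ⟨e, he, he'⟩ := ratLeftDualDense_iff.1 h 1 (E.biUnion F)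
  refine ⟨e, he, fun r hr => ?_⟩
  rw [ht, hF r e 1 fun x hx => he' x (Finset.mem_biUnion.2 ⟨r, hr, hx⟩), ← ht, mul_one]

/-- `Rat(*C)` is a right ideal of `*C`. -/
theorem RatLeftDual.mul_mem {s : LeftDual A C} (hs : s ∈ RatLeftDual A C) (f : LeftDual A C) :
    s * f ∈ RatLeftDual A C := by
  obtain ⟨t, ht⟩ := hs
  refine ⟨BalTensor.map LinearMap.id (actRight f) t, fun g => ?_⟩
  rw [mul_assoc, ht]
  clear ht
  induction t using BalTensor.induction with
  | zero => simp
  | pure c h => rfl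
  | add x y hx hy => simp only [map_add, hx, hy]

end Coring

/-! ### The Morita context -/

section Morita

variable {A C : Type u} [Ring A] [AddCommGroup C] [Module A C] [Module Aᵐᵒᵖ C]
  [SMulCommClass A Aᵐᵒᵖ C]

/-- The map `*C ⊗_A C → C`, `s ⊗ c ↦ s(d) c`. -/
def evalAtLeft (d : C) : BalTensor A (LeftDual A C) C →+ C :=
  BalTensor.lift
    (AddMonoidHom.mk' (fun s => DistribSMul.toAddMonoidHom C (s d))
      (fun s s' => by ext c; simp [add_smul]))
    (fun s a c => by simp [mul_smul])

@[simp]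
theorem evalAtLeft_tmul (d : C) (s : LeftDual A C) (c : C) :
    evalAtLeft d (tmul A s c) = s d • c := rfl

/-- The map `C ⊗_A C* → C`, `c ⊗ r ↦ c r(d)`. -/
def evalAtRight (d : C) : BalTensor A C (RightDual A C) →+ C :=
  BalTensor.lift
    (AddMonoidHom.mk' (fun c => AddMonoidHom.mk' (fun r : RightDual A C => op (r d) • c)
        (fun r r' => by simp [add_smul]))
      (fun c c' => by ext r; simp))
    (fun c a r => by simp [mul_smul])

@[simp]
theorem evalAtRight_tmul (d : C) (c : C) (r : RightDual A C) :
    evalAtRight d (tmul A c r) = op (r d) • c := rfl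

variable [Coring A C]

/-- A rational element acts on C with finite rank: if Σ sᵢ ⊗ cᵢ witnesses rationality of s, then d ·
s = Σ sᵢ(d) cᵢ. It suffices to compare values of elements of *C. -/
theorem op_smul_eq_evalAtLeft (hC : IsWeaklyLocallyProjective A C) {s : LeftDual A C}
    {t : BalTensor A (LeftDual A C) C} (ht : ∀ g : LeftDual A C, s * g = evalRight g t) (d : C) :
    op s • d = evalAtLeft d t := by
  refine eq_of_leftDual hC fun g => ?_
  rw [← LeftDual.mul_apply', ht]
  clear ht
  induction t using BalTensor.induction with
  | zero => simp
  | pure s c => simp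
  | add x y hx hy => simp only [map_add, LeftDual.add_apply, hx, hy]

theorem smul_eq_evalAtRight (hC : IsWeaklyLocallyProjective Aᵐᵒᵖ C) {r : RightDual A C}
    {t : BalTensor A C (RightDual A C)} (ht : ∀ g : RightDual A C, g * r = evalLeft g t) (d : C) :
    r • d = evalAtRight d t := by
  refine eq_of_rightDual hC fun g => ?_
  rw [← RightDual.mul_apply', ht]
  clear ht
  induction t using BalTensor.induction with
  | zero => simp
  | pure s c => simp
  | add x y hx hy => simp only [map_add, RightDual.add_apply, hx, hy]

theorem QTilde.coe_apply_smul (p : QTilde A C) (g : RightDual A C) (c : C) :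
    (p (g • c)).1 = g * (p c).1 :=
  congrArg Subtype.val (LinearMap.map_smul (R := RightDual A C) p g c)

theorem QTilde.apply_smul (p : QTilde A C) (g : RightDual A C) (c : C) :
    p (g • c) = g • p c :=
  LinearMap.map_smul (R := RightDual A C) p g c

theorem QTilde.smul_apply (f : LeftDual A C) (p : QTilde A C) (c : C) :
    (f • p) c = p (op f • c) := rfl

theorem QTilde.ext {p p' : QTilde A C} (h : ∀ c, p c = p' c) : p = p' := DFunLike.ext _ _ h

theorem QTilde.coe_apply_smul_ring (p : QTilde A C) (a : A) (c : C) :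
    (p (a • c)).1 = a • (p c).1 := by
  rw [← RightDual.smul_one_smul, QTilde.coe_apply_smul, RightDual.smul_one_mul]

/-- An additive map from `C` to `C*` that is left `C*`-linear takes values in `Rat(C*)`. -/
theorem mem_ratRightDual_of_linear (θ : C →+ RightDual A C)
    (h : ∀ (g : RightDual A C) (c : C), θ (g • c) = g * θ c) (c : C) :
    θ c ∈ RatRightDual A C := by
  have hA : ∀ (a : A) (c : C), θ (a • c) = a • θ c := fun a c => by
    rw [← RightDual.smul_one_smul, h, RightDual.smul_one_mul]
  refine ⟨BalTensor.map LinearMap.id ⟨θ.toAddHom, hA⟩ (Coring.comul (A := A) c), fun g => ?_⟩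
  rw [← h]
  change θ (evalLeft g (Coring.comul (A := A) c)) = _
  generalize Coring.comul (A := A) c = x
  induction x using BalTensor.induction with
  | zero => simp
  | pure x y => exact hA _ _
  | add x y hx hy => simp only [map_add, hx, hy]

/-- The witness is (q ⊗ id)Δ(c), because q(c) f = q(c · f) = q(c₁ f(c₂)). -/
theorem mem_ratLeftDual_of_linear (q : C →+ LeftDual A C)
    (h : ∀ (f : LeftDual A C) (c : C), q (op f • c) = q c * f) (c : C) :
    q c ∈ RatLeftDual A C := by
  have hA : ∀ (a : A) (c : C), q (op a • c) = op a • q c := fun a c => by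
    rw [← LeftDual.smul_one_smul, h, LeftDual.mul_smul_one]
  refine ⟨BalTensor.map ⟨q.toAddHom, fun a c => hA a.unop c⟩ LinearMap.id
    (Coring.comul (A := A) c), fun g => ?_⟩
  rw [← h]
  change q (evalRight g (Coring.comul (A := A) c)) = _
  generalize Coring.comul (A := A) c = x
  induction x using BalTensor.induction with
  | zero => simp
  | pure x y => exact hA _ _
  | add x y hx hy => simp only [map_add, hx, hy]

/-- A left `C*`-linear additive map `C → C*` as an element of `Q̃`. -/
def QTilde.ofLinear (θ : C →+ RightDual A C)
    (h : ∀ (g : RightDual A C) (c : C), θ (g • c) = g * θ c) : QTilde A C :=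
  ({ toFun := fun c => ⟨θ c, mem_ratRightDual_of_linear θ h c⟩
     map_add' := fun c d => Subtype.ext (map_add θ c d)
     map_smul' := fun g c => Subtype.ext (h g c) } : C →ₗ[RightDual A C] RatRightDual A C)

/-- The map `C → *C` with `q(c)(d) = q̃(d)(c)` associated with `q̃`. -/
def QTilde.flip (p : QTilde A C) : C →+ LeftDual A C :=
  AddMonoidHom.mk' (fun c => ({ toFun := fun d => (p d).1 c
                                map_add' := fun d d' => by rw [map_add]; rfl
                                map_smul' := fun a d => by
                                  rw [QTilde.coe_apply_smul_ring]; rfl } : C →ₗ[A] A))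
    (fun c c' => LeftDual.ext fun d => map_add (p d).1 c c')

@[simp]
theorem QTilde.flip_apply (p : QTilde A C) (c d : C) : p.flip c d = (p d).1 c := rfl

/-- The exchange identity d · q(c) = q̃(d) · c on which the proof rests. Any g in C* takes both
sides to (g q̃(d))(c). -/
theorem QTilde.op_flip_smul (hC : IsWeaklyLocallyProjective Aᵐᵒᵖ C) (p : QTilde A C) (c d : C) :
    op (p.flip c) • d = (p d).1 • c := by
  refine eq_of_rightDual hC fun g => ?_
  rw [rightDual_op_smul, QTilde.flip_apply, QTilde.coe_apply_smul, RightDual.mul_apply']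

theorem QTilde.flip_op_smul (hC : IsWeaklyLocallyProjective Aᵐᵒᵖ C) (p : QTilde A C)
    (f : LeftDual A C) (c : C) : p.flip (op f • c) = p.flip c * f := by
  ext d
  rw [QTilde.flip_apply, rightDual_op_smul, LeftDual.mul_apply', QTilde.op_flip_smul hC]

theorem QTilde.flip_mem (hC : IsWeaklyLocallyProjective Aᵐᵒᵖ C) (p : QTilde A C) (c : C) :
    p.flip c ∈ RatLeftDual A C :=
  mem_ratLeftDual_of_linear p.flip (p.flip_op_smul hC) c

/-- Every right `*C`-linear map `C → *C` comes from `Q̃`. -/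
theorem exists_qTilde (hC : IsWeaklyLocallyProjective A C) (q : C →+ LeftDual A C)
    (hq : ∀ (f : LeftDual A C) (c : C), q (op f • c) = q c * f) :
    ∃ p : QTilde A C, (∀ c d : C, (p d).1 c = q c d) ∧
      ∀ c d : C, op (q c) • d = (p d).1 • c := by
  have hA : ∀ (a : A) (c : C), q (op a • c) = op a • q c := fun a c => by
    rw [← LeftDual.smul_one_smul, hq, LeftDual.mul_smul_one]
  let θ : C →+ RightDual A C := AddMonoidHom.mk'
    (fun d => ({ toFun := fun c => q c d
                 map_add' := fun c c' => by rw [map_add]; rfl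
                 map_smul' := fun a c => congrArg (fun z : LeftDual A C => z d) (hA a.unop c) } :
                 C →ₗ[Aᵐᵒᵖ] A))
    (fun d d' => RightDual.ext fun c => map_add (q c) d d')
  have hθ : ∀ c d, θ d c = q c d := fun _ _ => rfl
  -- The exchange identity comes first here, tested against *C by means of the *C-linearity of q;
  -- the C*-linearity of θ is then deduced from it.
  have h1 : ∀ c d : C, op (q c) • d = θ d • c := fun c d => by
    refine eq_of_leftDual hC fun f => ?_
    rw [← LeftDual.mul_apply', ← hq, ← rightDual_op_smul]
    rfl
  have h2 : ∀ (g : RightDual A C) (c : C), θ (g • c) = g * θ c := fun g d => by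
    ext c
    rw [RightDual.mul_apply', ← h1, rightDual_op_smul]
    rfl
  exact ⟨QTilde.ofLinear θ h2, hθ, h1⟩

/-- `(q̃ r)(c) = q̃(c) r`. -/
def QTilde.mulRight : QTilde A C →+ RatRightDual A C →+ QTilde A C :=
  AddMonoidHom.mk' (fun p => AddMonoidHom.mk'
      (fun r => ({ toFun := fun c => p c * r
                   map_add' := fun c d => by rw [map_add, add_mul]
                   map_smul' := fun g c => Subtype.ext (by
                    change (p (g • c)).1 * r.1 = g * ((p c).1 * r.1)
                    rw [QTilde.coe_apply_smul, mul_assoc]) } :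
                  C →ₗ[RightDual A C] RatRightDual A C))
      (fun r r' => QTilde.ext fun c => mul_add _ _ _))
    (fun p p' => AddMonoidHom.ext fun r => QTilde.ext fun c => add_mul _ _ _)

theorem QTilde.mulRight_apply (p : QTilde A C) (r : RatRightDual A C) (c : C) :
    QTilde.mulRight p r c = p c * r := rfl

/-- The right action of `Rat(C*)` on `C ⊗_{*C} Q̃`. -/
def moritaMulRight : BalTensor (LeftDual A C) C (QTilde A C) →+ RatRightDual A C →+
    BalTensor (LeftDual A C) C (QTilde A C) :=
  BalTensor.lift
    (AddMonoidHom.mk' (fun c => AddMonoidHom.mk' (fun p => (tmul _ c).comp (QTilde.mulRight p))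
        (fun p p' => by ext r; simp))
      (fun c c' => by ext p r; simp))
    (fun c f p => by
      ext r
      exact tmul_balanced c f (QTilde.mulRight p r))

@[simp]
theorem moritaMulRight_tmul (c : C) (p : QTilde A C) (r : RatRightDual A C) :
    moritaMulRight (tmul _ c p) r = tmul _ c (QTilde.mulRight p r) := rfl

@[simp]
theorem moritaMap_tmul (c : C) (p : QTilde A C) : moritaMap A C (tmul _ c p) = p c := rfl

theorem moritaMap_moritaMulRight (y : BalTensor (LeftDual A C) C (QTilde A C))
    (r : RatRightDual A C) : moritaMap A C (moritaMulRight y r) = moritaMap A C y * r := by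
  induction y using BalTensor.induction with
  | zero => simp
  | pure c p => rfl
  | add x y hx hy => simp only [map_add, AddMonoidHom.add_apply, add_mul, hx, hy]

/-- The exchange identity one level up: evaluated at d, the left side is p'(d · q(c)) = p'(p(d) · c)
= p(d) p'(c), with q the flip of p. -/
theorem QTilde.flip_smul (hC : IsWeaklyLocallyProjective Aᵐᵒᵖ C) (p p' : QTilde A C) (c : C) :
    p.flip c • p' = QTilde.mulRight p (p' c) := by
  refine QTilde.ext fun d => ?_
  rw [QTilde.smul_apply, QTilde.op_flip_smul hC, QTilde.apply_smul]
  rfl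

/-- For y = d ⊗ p' with flip q', one has p'(d) · c = d · q'(c); moving q'(c) across the tensor sign
gives d ⊗ q'(c) p = d ⊗ p' p(c). -/
theorem tmul_moritaMap_smul (hC : IsWeaklyLocallyProjective Aᵐᵒᵖ C)
    (y : BalTensor (LeftDual A C) C (QTilde A C)) (c : C) (p : QTilde A C) :
    tmul (LeftDual A C) ((moritaMap A C y).1 • c) p = moritaMulRight y (p c) := by
  induction y using BalTensor.induction with
  | zero =>
    rw [map_zero, map_zero]
    change tmul (LeftDual A C) ((0 : RightDual A C) • c) p = 0
    rw [zero_smul, map_zero, AddMonoidHom.zero_apply]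
  | pure d p' =>
    rw [moritaMap_tmul, ← QTilde.op_flip_smul hC, tmul_balanced, QTilde.flip_smul hC,
      moritaMulRight_tmul]
  | add x y hx hy =>
    rw [map_add, map_add, AddMonoidHom.add_apply, ← hx, ← hy]
    change tmul (LeftDual A C) (((moritaMap A C x).1 + (moritaMap A C y).1) • c) p = _
    rw [add_smul, map_add, AddMonoidHom.add_apply]

variable (A C) in
/-- The image of the Morita map contains local units for the left action on `C`. -/
def HasTraceUnits : Prop :=
  ∀ E : Finset C, ∃ y : BalTensor (LeftDual A C) C (QTilde A C),
    ∀ c ∈ E, (moritaMap A C y).1 • c = c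

/-- If △(y) fixes the C-legs of x, then x = y △(x), so x is determined by its image. -/
theorem moritaMap_injective (hC : IsWeaklyLocallyProjective Aᵐᵒᵖ C) (h : HasTraceUnits A C) :
    Function.Injective (moritaMap A C) := by
  classical
  have key : ∀ x : BalTensor (LeftDual A C) C (QTilde A C), ∃ E : Finset C,
      ∀ y, (∀ c ∈ E, (moritaMap A C y).1 • c = c) →
        x = moritaMulRight y (moritaMap A C x) := by
    intro x
    induction x using BalTensor.induction with
    | zero => exact ⟨∅, fun y _ => by simp⟩
    | pure c p =>
      refine ⟨{c}, fun y hy => ?_⟩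
      rw [moritaMap_tmul, ← tmul_moritaMap_smul hC, hy c (Finset.mem_singleton_self c)]
    | add x x' hx hx' =>
      obtain ⟨E, hE⟩ := hx
      obtain ⟨E', hE'⟩ := hx'
      refine ⟨E ∪ E', fun y hy => ?_⟩
      conv_lhs => rw [hE y fun c hc => hy c (Finset.mem_union_left _ hc),
        hE' y fun c hc => hy c (Finset.mem_union_right _ hc)]
      rw [map_add, map_add]
  refine (injective_iff_map_eq_zero _).2 fun x hx => ?_
  obtain ⟨E, hE⟩ := key x
  obtain ⟨y, hy⟩ := h E
  rw [hE y hy, hx, map_zero]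

/-- If r fixes c then (f * r)(c) = f(r · c) = f(c); and f * r stays rational because Rat(C*) is a
left ideal. -/
theorem HasTraceUnits.dense (h : HasTraceUnits A C) : RatRightDualDense A C :=
  ratRightDualDense_iff.2 fun f E => by
    obtain ⟨y, hy⟩ := h E
    exact ⟨f * (moritaMap A C y).1, RatRightDual.mul_mem f (moritaMap A C y).2, fun c hc => by
      rw [RightDual.mul_apply', hy c hc]⟩

/-- A trace unit fixing the C-legs of the tensor witnessing rationality of r agrees with ε on those
legs, so △(y) r = r; the left side is △(y r). -/
theorem HasTraceUnits.surjective (h : HasTraceUnits A C) :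
    Function.Surjective (moritaMap A C) := by
  intro r
  obtain ⟨t, ht⟩ := r.2
  obtain ⟨E, hE⟩ := exists_evalLeft_congr t
  obtain ⟨y, hy⟩ := h E
  refine ⟨moritaMulRight y r, ?_⟩
  rw [moritaMap_moritaMulRight]
  refine Subtype.ext ?_
  change (moritaMap A C y).1 * r.1 = r.1
  conv_rhs => rw [← one_mul r.1]
  rw [ht, ht]
  refine hE _ _ fun c hc => ?_
  conv_rhs => rw [← hy c hc]
  rw [← RightDual.mul_apply', one_mul]

/-- Density provides local units in Rat(C*), and surjectivity turns them into traces. -/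
theorem HasTraceUnits.of_surjective (hd : RatRightDualDense A C)
    (h : Function.Surjective (moritaMap A C)) : HasTraceUnits A C := fun E => by
  obtain ⟨r, hr, hE⟩ := hd.exists_smul_eq E
  obtain ⟨y, hy⟩ := h ⟨r, hr⟩
  exact ⟨y, fun c hc => by rw [hy]; exact hE c hc⟩

/-- Finite rank endomorphisms that are local units witness weak local projectivity. -/
theorem isWeaklyLocallyProjective_of_evalAtRight
    (h : ∀ E : Finset C, ∃ t : BalTensor A C (RightDual A C), ∀ c ∈ E, evalAtRight c t = c) :
    IsWeaklyLocallyProjective Aᵐᵒᵖ C := by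
  rintro _ ⟨F, rfl⟩ M N _ _ _ _ g f hg
  obtain ⟨t, ht⟩ := h F
  have key : ∀ t : BalTensor A C (RightDual A C), ∃ φ : C →ₗ[Aᵐᵒᵖ] M,
      ∀ d, g (φ d) = f (evalAtRight d t) := by
    intro t
    induction t using BalTensor.induction with
    | zero => exact ⟨0, fun d => by simp⟩
    | pure x r =>
      obtain ⟨m, hm⟩ := hg (f x)
      refine ⟨{ toFun := fun d => op (r d) • m
                map_add' := fun d d' => by rw [map_add, MulOpposite.op_add, add_smul]
                map_smul' := fun a d => by
                  induction a using MulOpposite.rec' with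
                  | _ a => rw [RightDual.apply_smul, MulOpposite.op_mul, mul_smul]; rfl }, fun d => ?_⟩
      change g (op (r d) • m) = f (op (r d) • x)
      rw [map_smul, map_smul, hm]
    | add x y hx hy =>
      obtain ⟨φ, hφ⟩ := hx
      obtain ⟨φ', hφ'⟩ := hy
      exact ⟨φ + φ', fun d => by rw [LinearMap.add_apply, map_add, map_add, map_add, hφ, hφ']⟩
  obtain ⟨φ, hφ⟩ := key t
  refine ⟨φ, fun e he => ?_⟩
  -- Both sides are linear and agree on the generators F, hence on their span.
  have hle : Submodule.span Aᵐᵒᵖ (F : Set C) ≤ LinearMap.eqLocus (g.comp φ) f :=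
    Submodule.span_le.2 fun c hc => by
      change g (φ c) = f c
      rw [hφ, ht c hc]
  exact hle he

/-- The components of j are right *C-linear, hence flips of elements p_l of Q̃. Read through the
exchange identity, c = Σ z_l · j_l(c) says that △(Σ z_l ⊗ p_l) fixes c. -/
theorem IsLeftLocallyQuasiFrobenius.hasTraceUnits {B : Type*} [Ring B] {ι : B →+* A}
    (hC : IsWeaklyLocallyProjective A C) (h : IsLeftLocallyQuasiFrobenius A C ι) :
    HasTraceUnits A C ∧ IsWeaklyLocallyProjective Aᵐᵒᵖ C := by
  obtain ⟨I, j, -, hj, hz⟩ := h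
  let q : I → C →+ LeftDual A C := fun l => (Pi.evalAddMonoidHom _ l).comp j
  choose p hp hp' using fun l => exists_qTilde hC (q l) fun f c => hj f c l
  constructor
  · intro E
    obtain ⟨z, -, hzE⟩ := hz E
    refine ⟨z.sum fun l zl => tmul _ zl (p l), fun c hc => ?_⟩
    conv_rhs => rw [hzE c hc]
    rw [Finsupp.sum, map_sum, AddSubmonoidClass.coe_finsetSum, Finset.sum_smul, Finsupp.sum]
    exact Finset.sum_congr rfl fun l _ => (hp' l c (z l)).symm
  · refine isWeaklyLocallyProjective_of_evalAtRight fun E => ?_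
    obtain ⟨z, -, hzE⟩ := hz E
    let θ : I → C →ₗ[A] RightDual A C := fun l =>
      { toFun := fun d => (p l d).1
        map_add' := fun d d' => by rw [map_add]; rfl
        map_smul' := fun a d => QTilde.coe_apply_smul_ring (p l) a d }
    -- Writing out z_l · j_l(c) = z_l₁ j_l(c)(z_l₂) = z_l₁ p_l(z_l₂)(c) displays the identity on E
    -- as a finite rank map with coefficients in C*.
    refine ⟨z.sum fun l zl => BalTensor.map LinearMap.id (θ l) (Coring.comul (A := A) zl),
      fun c hc => ?_⟩
    conv_rhs => rw [hzE c hc]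
    rw [Finsupp.sum, map_sum, Finsupp.sum]
    refine Finset.sum_congr rfl fun l _ => ?_
    change _ = evalRight (j c l) (Coring.comul (A := A) (z l))
    generalize Coring.comul (A := A) (z l) = x
    induction x using BalTensor.induction with
    | zero => simp
    | pure x y =>
      rw [BalTensor.map_tmul, evalAtRight_tmul, evalRight_tmul]
      exact congrArg (fun a => op a • x) (hp l c y)
    | add x y hx hy => simp only [map_add, hx, hy]

/-- Take all of Q̃ as index set and p ↦ flip of p as components: a trace Σ z_i ⊗ p_i then supplies
the family z, and its entries are k-central since k acts centrally on the whole of C. -/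
theorem HasTraceUnits.isLeftLocallyQuasiFrobenius {k : Type w} [CommRing k] [Algebra k A]
    (hk : ∀ (x : k) (c : C),
      algebraMap k A x • c = (op (algebraMap k A x) : Aᵐᵒᵖ) • c)
    (hC : IsWeaklyLocallyProjective Aᵐᵒᵖ C) (h : HasTraceUnits A C) :
    IsLeftLocallyQuasiFrobenius A C (algebraMap k A) := by
  refine ⟨QTilde A C, AddMonoidHom.mk' (fun c p => p.flip c)
    (fun c d => funext fun p => map_add p.flip c d), fun b c p => ?_,
    fun f c p => p.flip_op_smul hC f c, fun E => ?_⟩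
  · change p.flip (algebraMap k A b • c) = algebraMap k A b • p.flip c
    ext d
    rw [LeftDual.smul_apply, hk, ← hk b d, LeftDual.apply_smul, QTilde.flip_apply,
      RightDual.apply_smul, QTilde.flip_apply, Algebra.commutes]
  · obtain ⟨y, hy⟩ := h E
    have key : ∀ y : BalTensor (LeftDual A C) C (QTilde A C), ∃ z : QTilde A C →₀ C,
        ∀ c : C, (moritaMap A C y).1 • c = z.sum fun p zp => op (p.flip c) • zp := by
      intro y
      classical
      induction y using BalTensor.induction with
      | zero => exact ⟨0, fun c => by rw [map_zero, Finsupp.sum_zero_index]; exact zero_smul _ c⟩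
      | pure d p =>
        refine ⟨Finsupp.single p d, fun c => ?_⟩
        rw [moritaMap_tmul, ← QTilde.op_flip_smul hC]
        exact (Finsupp.sum_single_index (h := fun p zp => op (QTilde.flip p c) • zp)
          (smul_zero _)).symm
      | add x y hx hy =>
        obtain ⟨z, hz⟩ := hx
        obtain ⟨z', hz'⟩ := hy
        refine ⟨z + z', fun c => ?_⟩
        rw [Finsupp.sum_add_index' (fun _ => smul_zero _) (fun _ => smul_add _), ← hz, ← hz',
          ← add_smul, map_add]
        rfl
    obtain ⟨z, hz⟩ := key y
    exact ⟨z, fun b p => hk b _, fun c hc => (hy c hc).symm.trans (hz c)⟩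

end Morita

/-! ### Firm modules -/

section FirmLemmas

variable (R : Type u) [NonUnitalRing R]

@[simp]
theorem mulRight_tmul (N : Type u) [AddCommGroup N] [Module (Dorroh R)ᵐᵒᵖ N] (n : N) (r : R) :
    mulRight R N (tmul _ n r) = op (Dorroh.of r) • n := rfl

@[simp]
theorem mulLeft_tmul (N : Type u) [AddCommGroup N] [Module (Dorroh R) N] (r : R) (n : N) :
    mulLeft R N (tmul _ r n) = Dorroh.of r • n := rfl

/-- The multiplication map of a bimodule as a left linear map. -/
def mulRightL (P X : Type u) [Ring P] [AddCommGroup X] [Module (Dorroh R)ᵐᵒᵖ X] [Module P X]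
    [SMulCommClass P (Dorroh R)ᵐᵒᵖ X] : BalTensor (Dorroh R) X R →ₗ[P] X where
  toFun := mulRight R X
  map_add' := map_add _
  map_smul' x w := by
    rw [RingHom.id_apply]
    induction w using BalTensor.induction with
    | zero => rw [smul_zero, map_zero, smul_zero]
    | pure n r =>
      rw [BalTensor.smul_tmul, mulRight_tmul, mulRight_tmul]
      exact (smul_comm x _ n).symm
    | add a b ha hb => rw [smul_add, map_add, map_add, smul_add, ha, hb]

/-- The multiplication map of a bimodule as a right linear map. -/
def mulLeftL (P X : Type u) [Ring P] [AddCommGroup X] [Module (Dorroh R) X] [Module Pᵐᵒᵖ X]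
    [SMulCommClass (Dorroh R) Pᵐᵒᵖ X] : BalTensor (Dorroh R) R X →ₗ[Pᵐᵒᵖ] X where
  toFun := mulLeft R X
  map_add' := map_add _
  map_smul' x w := by
    rw [RingHom.id_apply]
    induction w using BalTensor.induction with
    | zero => rw [smul_zero, map_zero, smul_zero]
    | pure r n => rw [BalTensor.op_smul_tmul, mulLeft_tmul, mulLeft_tmul, smul_comm]
    | add a b ha hb => rw [smul_add, map_add, map_add, smul_add, ha, hb]

/-- Up to associativity, the multiplication map of N ⊗_P X is N ⊗_P - applied to that of X. -/
theorem mulRight_tensor_bijective (P X N : Type u) [Ring P] [AddCommGroup X]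
    [Module (Dorroh R)ᵐᵒᵖ X] [Module P X] [SMulCommClass P (Dorroh R)ᵐᵒᵖ X] [AddCommGroup N]
    [Module Pᵐᵒᵖ N] (h : Function.Bijective (mulRight R X)) :
    Function.Bijective (mulRight R (BalTensor P N X)) := by
  have h1 : ⇑(mulRight R (BalTensor P N X)) =
      BalTensor.map LinearMap.id (mulRightL R P X) ∘ BalTensor.assoc := by
    funext w
    induction w using BalTensor.induction with
    | zero => simp
    | pure x r =>
      induction x using BalTensor.induction with
      | zero => simp
      | pure n x => rfl
      | add a b ha hb =>
        simp only [Function.comp_apply, map_add, AddMonoidHom.add_apply] at ha hb ⊢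
        rw [ha, hb]
    | add a b ha hb =>
      simp only [Function.comp_apply, map_add] at ha hb ⊢
      rw [ha, hb]
  rw [h1]
  exact (BalTensor.map_id_bijective _ h).comp BalTensor.assoc_bijective

theorem mulLeft_tensor_bijective (P X N : Type u) [Ring P] [AddCommGroup X]
    [Module (Dorroh R) X] [Module Pᵐᵒᵖ X] [SMulCommClass (Dorroh R) Pᵐᵒᵖ X] [AddCommGroup N]
    [Module P N] (h : Function.Bijective (mulLeft R X)) :
    Function.Bijective (mulLeft R (BalTensor P X N)) := by
  have h1 : ⇑(mulLeft R (BalTensor P X N)) =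
      BalTensor.map (mulLeftL R P X) LinearMap.id ∘ BalTensor.assocInv := by
    funext w
    induction w using BalTensor.induction with
    | zero => simp
    | pure r x =>
      induction x using BalTensor.induction with
      | zero => simp
      | pure n x => rfl
      | add a b ha hb =>
        simp only [Function.comp_apply, map_add] at ha hb ⊢
        rw [ha, hb]
    | add a b ha hb =>
      simp only [Function.comp_apply, map_add] at ha hb ⊢
      rw [ha, hb]
  rw [h1]
  exact (BalTensor.map_bijective_id _ h).comp (Function.bijective_iff_has_inverse.2
    ⟨BalTensor.assoc, BalTensor.assoc_assocInv, BalTensor.assocInv_assoc⟩)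

variable {R}

theorem Dorroh.of_smul (r s : R) : Dorroh.of r • s = r * s := by
  change (0 : ℤ) • s + r * s = r * s
  rw [zero_smul, zero_add]

theorem Dorroh.op_of_smul (r s : R) : op (Dorroh.of r) • s = s * r := by
  change (0 : ℤ) • s + s * r = s * r
  rw [zero_smul, zero_add]

theorem Dorroh.eq_intCast_add_of (x : Dorroh R) : x = (x.fst : Dorroh R) + Dorroh.of x.snd := by
  have h1 : (x.fst • (1 : Dorroh R)).fst = x.fst • (1 : Dorroh R).fst :=
    map_zsmul (AddMonoidHom.mk' (Dorroh.fst (R := R)) fun _ _ => rfl) x.fst 1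
  have h2 : (x.fst • (1 : Dorroh R)).snd = x.fst • (1 : Dorroh R).snd :=
    map_zsmul (AddMonoidHom.mk' (Dorroh.snd (R := R)) fun _ _ => rfl) x.fst 1
  rw [← zsmul_one]
  refine Dorroh.ext' ?_ ?_
  · rw [Dorroh.fst_add, h1]
    change _ = x.fst • (1 : ℤ) + 0
    simp
  · rw [Dorroh.snd_add, h2]
    change _ = x.fst • (0 : R) + x.snd
    simp

/-- If e fixes the R-legs of w on the left, then r ⊗ n = e r ⊗ n = e ⊗ r n shows w = e ⊗ μ(w), with
μ the multiplication map. -/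
theorem mulLeft_injective (hR : ∀ E : Finset R, ∃ e, ∀ r ∈ E, e * r = r) (N : Type u)
    [AddCommGroup N] [Module (Dorroh R) N] : Function.Injective (mulLeft R N) := by
  classical
  have key : ∀ w : BalTensor (Dorroh R) R N, ∃ E : Finset R, ∀ e, (∀ r ∈ E, e * r = r) →
      w = tmul _ e (mulLeft R N w) := by
    intro w
    induction w using BalTensor.induction with
    | zero => exact ⟨∅, fun e _ => by simp⟩
    | pure r n =>
      refine ⟨{r}, fun e he => ?_⟩
      rw [mulLeft_tmul, ← tmul_balanced, Dorroh.op_of_smul, he r (Finset.mem_singleton_self r)]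
    | add x y hx hy =>
      obtain ⟨E, hE⟩ := hx
      obtain ⟨E', hE'⟩ := hy
      refine ⟨E ∪ E', fun e he => ?_⟩
      conv_lhs => rw [hE e fun c hc => he c (Finset.mem_union_left _ hc),
        hE' e fun c hc => he c (Finset.mem_union_right _ hc)]
      rw [map_add, map_add]
  refine (injective_iff_map_eq_zero _).2 fun w hw => ?_
  obtain ⟨E, hE⟩ := key w
  obtain ⟨e, he⟩ := hR E
  rw [hE e he, hw, map_zero]

theorem mulRight_injective (hR : ∀ E : Finset R, ∃ e, ∀ r ∈ E, r * e = r) (N : Type u)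
    [AddCommGroup N] [Module (Dorroh R)ᵐᵒᵖ N] : Function.Injective (mulRight R N) := by
  classical
  have key : ∀ w : BalTensor (Dorroh R) N R, ∃ E : Finset R, ∀ e, (∀ r ∈ E, r * e = r) →
      w = tmul _ (mulRight R N w) e := by
    intro w
    induction w using BalTensor.induction with
    | zero => exact ⟨∅, fun e _ => by simp⟩
    | pure n r =>
      refine ⟨{r}, fun e he => ?_⟩
      rw [mulRight_tmul, tmul_balanced, Dorroh.of_smul, he r (Finset.mem_singleton_self r)]
    | add x y hx hy =>
      obtain ⟨E, hE⟩ := hx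
      obtain ⟨E', hE'⟩ := hy
      refine ⟨E ∪ E', fun e he => ?_⟩
      conv_lhs => rw [hE e fun c hc => he c (Finset.mem_union_left _ hc),
        hE' e fun c hc => he c (Finset.mem_union_right _ hc)]
      rw [map_add, map_add, AddMonoidHom.add_apply]
  refine (injective_iff_map_eq_zero _).2 fun w hw => ?_
  obtain ⟨E, hE⟩ := key w
  obtain ⟨e, he⟩ := hR E
  rw [hE e he, hw, map_zero, AddMonoidHom.zero_apply]

/-- On R ⊗_R R the left and right multiplication maps coincide, so one-sided units make R firm on
both sides. -/
theorem mulRight_self_bijective_of_left_units (hR : ∀ E : Finset R, ∃ e, ∀ r ∈ E, e * r = r) :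
    Function.Bijective (mulRight R R) := by
  have h1 : mulRight R R = mulLeft R R := BalTensor.hom_ext fun r s => by
    rw [mulRight_tmul, mulLeft_tmul, Dorroh.of_smul, Dorroh.op_of_smul]
  rw [h1]
  refine ⟨mulLeft_injective hR R, fun r => ?_⟩
  obtain ⟨e, he⟩ := hR {r}
  exact ⟨tmul _ e r, by rw [mulLeft_tmul, Dorroh.of_smul, he r (Finset.mem_singleton_self r)]⟩

theorem mulLeft_self_bijective_of_right_units (hR : ∀ E : Finset R, ∃ e, ∀ r ∈ E, r * e = r) :
    Function.Bijective (mulLeft R R) := by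
  have h1 : mulLeft R R = mulRight R R := BalTensor.hom_ext fun r s => by
    rw [mulRight_tmul, mulLeft_tmul, Dorroh.of_smul, Dorroh.op_of_smul]
  rw [h1]
  refine ⟨mulRight_injective hR R, fun r => ?_⟩
  obtain ⟨e, he⟩ := hR {r}
  exact ⟨tmul _ r e, by rw [mulRight_tmul, Dorroh.op_of_smul, he r (Finset.mem_singleton_self r)]⟩

end FirmLemmas

/-! ### Firmness of the coring over Rat(*C), and lifting maps along - ⊗_R C -/

section TensorFunctor

variable {A C : Type u} [Ring A] [AddCommGroup C] [Module A C] [Module Aᵐᵒᵖ C]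
  [SMulCommClass A Aᵐᵒᵖ C] [Coring A C]

theorem RatRightDualDense.units (h : RatRightDualDense A C) (E : Finset (RatRightDual A C)) :
    ∃ e, ∀ r ∈ E, e * r = r := by
  obtain ⟨e, he, hE⟩ := h.exists_mul_eq E
  exact ⟨⟨e, he⟩, fun r hr => Subtype.ext (hE r hr)⟩

theorem RatLeftDualDense.units (h : RatLeftDualDense A C) (E : Finset (RatLeftDual A C)) :
    ∃ e, ∀ r ∈ E, r * e = r := by
  obtain ⟨e, he, hE⟩ := h.exists_mul_eq E
  exact ⟨⟨e, he⟩, fun r hr => Subtype.ext (hE r hr)⟩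

theorem Dorroh.toRing_of {T : Type*} [Ring T] (S : NonUnitalSubring T) (s : S) :
    Dorroh.toRing S (Dorroh.of s) = s := by
  change (0 : ℤ) • (1 : T) + (s : T) = s
  rw [zero_smul, zero_add]

theorem Dorroh.toRing_mul_coe {T : Type*} [Ring T] (S : NonUnitalSubring T) (x : Dorroh S)
    (s : S) : Dorroh.toRing S x * s = ((x • s : S) : T) := by
  change (x.fst • (1 : T) + (x.snd : T)) * s = x.fst • (s : T) + (x.snd : T) * s
  rw [add_mul, smul_mul_assoc, one_mul]

theorem ratRight_of_smul (r : RatRightDual A C) (c : C) : Dorroh.of r • c = r.1 • c := by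
  change Dorroh.toRing _ (Dorroh.of r) • c = _
  rw [Dorroh.toRing_of]

theorem ratLeft_op_of_smul (s : RatLeftDual A C) (c : C) :
    op (Dorroh.of s) • c = op s.1 • c := by
  change op (Dorroh.toRing _ (Dorroh.of s)) • c = _
  rw [Dorroh.toRing_of]

instance : SMulCommClass (Dorroh (RatRightDual A C)) (LeftDual A C)ᵐᵒᵖ C where
  smul_comm x f c := smul_comm (Dorroh.toRing (RatRightDual A C) x) f c

theorem ratLeft_op_of_smul_tensor {N : Type u} [AddCommGroup N]
    [Module (Dorroh (RatRightDual A C))ᵐᵒᵖ N] (s : RatLeftDual A C)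
    (x : BalTensor (Dorroh (RatRightDual A C)) N C) : op (Dorroh.of s) • x = op s.1 • x := by
  induction x using BalTensor.induction with
  | zero => rw [smul_zero, smul_zero]
  | pure n c => rw [BalTensor.op_smul_tmul, BalTensor.op_smul_tmul, ratLeft_op_of_smul]
  | add x y hx hy => rw [smul_add, smul_add, hx, hy]

theorem mulLeft_ratRight_bijective (hd : RatRightDualDense A C) :
    Function.Bijective (mulLeft (RatRightDual A C) C) := by
  refine ⟨mulLeft_injective hd.units C, fun c => ?_⟩
  obtain ⟨r, hr, hc⟩ := hd.exists_smul_eq {c}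
  exact ⟨tmul _ ⟨r, hr⟩ c, by
    rw [mulLeft_tmul, ratRight_of_smul]; exact hc c (Finset.mem_singleton_self c)⟩

theorem exists_of_smul_eq {X : Type u} [AddCommGroup X] [Module (Dorroh (RatLeftDual A C)) X]
    (w : BalTensor (Dorroh (RatLeftDual A C)) C X) : ∃ E : Finset C,
      ∀ r : RatRightDual A C, (∀ c ∈ E, r.1 • c = c) → Dorroh.of r • w = w := by
  classical
  induction w using BalTensor.induction with
  | zero => exact ⟨∅, fun r _ => smul_zero _⟩
  | pure c s =>
    refine ⟨{c}, fun r hr => ?_⟩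
    rw [BalTensor.smul_tmul, ratRight_of_smul, hr c (Finset.mem_singleton_self c)]
  | add x y hx hy =>
    obtain ⟨E, hE⟩ := hx
    obtain ⟨E', hE'⟩ := hy
    refine ⟨E ∪ E', fun r hr => ?_⟩
    rw [smul_add, hE r fun c hc => hr c (Finset.mem_union_left _ hc),
      hE' r fun c hc => hr c (Finset.mem_union_right _ hc)]

/-- The coring is firm over `Rat(*C)`. -/
theorem HasTraceUnits.mulRight_bijective (hC : IsWeaklyLocallyProjective Aᵐᵒᵖ C)
    (h : HasTraceUnits A C) : Function.Bijective (mulRight (RatLeftDual A C) C) := by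
  classical
  -- For y = z ⊗ p with flip q, the map c ↦ z ⊗ q(c) is an approximate inverse of multiplication:
  -- both composites are the action of △(y), which is the identity on the relevant finite sets for
  -- suitable y.
  have hΦ : ∀ y : BalTensor (LeftDual A C) C (QTilde A C),
      ∃ Φ : C →+ BalTensor (Dorroh (RatLeftDual A C)) C (RatLeftDual A C),
        (∀ w, Φ (mulRight _ C w) = Dorroh.of (moritaMap A C y) • w) ∧
        ∀ c, mulRight _ C (Φ c) = (moritaMap A C y).1 • c := by
    intro y
    induction y using BalTensor.induction with
    | zero =>
      refine ⟨0, fun w => ?_, fun c => ?_⟩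
      · rw [map_zero, AddMonoidHom.zero_apply]
        exact (zero_smul _ w).symm
      · rw [map_zero, AddMonoidHom.zero_apply, map_zero]
        exact (zero_smul _ c).symm
    | pure z p =>
      refine ⟨AddMonoidHom.mk' (fun c => tmul _ z ⟨p.flip c, p.flip_mem hC c⟩) fun c d => ?_,
        fun w => ?_, fun c => ?_⟩
      · rw [← map_add]
        exact congrArg _ (Subtype.ext (map_add p.flip c d))
      · rw [moritaMap_tmul]
        induction w using BalTensor.induction with
        | zero => rw [map_zero, map_zero, smul_zero]
        | pure c s =>
          rw [BalTensor.smul_tmul, ratRight_of_smul, ← QTilde.op_flip_smul hC, AddMonoidHom.mk'_apply,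
            ← ratLeft_op_of_smul ⟨p.flip c, p.flip_mem hC c⟩, tmul_balanced, Dorroh.of_smul]
          refine congrArg _ (Subtype.ext ?_)
          rw [mulRight_tmul, ratLeft_op_of_smul]
          exact p.flip_op_smul hC _ _
        | add x y hx hy => rw [map_add, map_add, smul_add, hx, hy]
      · rw [AddMonoidHom.mk'_apply, mulRight_tmul, ratLeft_op_of_smul, moritaMap_tmul]
        exact QTilde.op_flip_smul hC _ _ _
    | add x y hx hy =>
      obtain ⟨Φ, h1, h2⟩ := hx
      obtain ⟨Φ', h1', h2'⟩ := hy
      refine ⟨Φ + Φ', fun w => ?_, fun c => ?_⟩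
      · rw [AddMonoidHom.add_apply, h1, h1', map_add, Dorroh.of_add, add_smul]
      · rw [AddMonoidHom.add_apply, map_add, h2, h2', map_add, ← add_smul]
        rfl
  constructor
  · refine (injective_iff_map_eq_zero _).2 fun w hw => ?_
    obtain ⟨E, hE⟩ := exists_of_smul_eq w
    obtain ⟨y, hy⟩ := h E
    obtain ⟨Φ, h1, -⟩ := hΦ y
    rw [← hE _ hy, ← h1, hw, map_zero]
  · intro c
    obtain ⟨y, hy⟩ := h {c}
    obtain ⟨Φ, -, h2⟩ := hΦ y
    exact ⟨Φ c, by rw [h2, hy c (Finset.mem_singleton_self c)]⟩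

/-- An element of `Q̃` as a left `Rat(C*)`-linear map. -/
def QTilde.toRat (p : QTilde A C) : C →ₗ[Dorroh (RatRightDual A C)] RatRightDual A C where
  toFun := p
  map_add' := map_add p
  map_smul' x c := by
    refine Subtype.ext ?_
    change (p (Dorroh.toRing _ x • c)).1 = _
    rw [QTilde.coe_apply_smul, Dorroh.toRing_mul_coe, RingHom.id_apply]

section

variable {N N' : Type u} [AddCommGroup N] [Module (Dorroh (RatRightDual A C))ᵐᵒᵖ N]
  [AddCommGroup N'] [Module (Dorroh (RatRightDual A C))ᵐᵒᵖ N']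

/-- The map `N ⊗_R C → N`, `n ⊗ c ↦ n q̃(c)`. -/
def QTilde.eval (N : Type u) [AddCommGroup N] [Module (Dorroh (RatRightDual A C))ᵐᵒᵖ N] :
    QTilde A C →+ BalTensor (Dorroh (RatRightDual A C)) N C →+ N :=
  AddMonoidHom.mk' (fun p => (QFCoring.mulRight _ N).comp (BalTensor.map LinearMap.id p.toRat))
    (fun p p' => BalTensor.hom_ext fun n c => by
      change op (Dorroh.of (p c + p' c)) • n = op (Dorroh.of (p c)) • n + op (Dorroh.of (p' c)) • n
      rw [Dorroh.of_add, MulOpposite.op_add, add_smul])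

@[simp]
theorem QTilde.eval_tmul (p : QTilde A C) (n : N) (c : C) :
    QTilde.eval N p (tmul _ n c) = op (Dorroh.of (p c)) • n := rfl

theorem QTilde.eval_smul (f : LeftDual A C) (p : QTilde A C)
    (x : BalTensor (Dorroh (RatRightDual A C)) N C) :
    QTilde.eval N (f • p) x = QTilde.eval N p (op f • x) := by
  induction x using BalTensor.induction with
  | zero => rw [smul_zero, map_zero, map_zero]
  | pure n c => rfl
  | add x y hx hy => rw [smul_add, map_add, map_add, hx, hy]

theorem QTilde.eval_mulRight (p : QTilde A C) (r : RatRightDual A C)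
    (x : BalTensor (Dorroh (RatRightDual A C)) N C) :
    QTilde.eval N (QTilde.mulRight p r) x = op (Dorroh.of r) • QTilde.eval N p x := by
  induction x using BalTensor.induction with
  | zero => rw [map_zero, map_zero, smul_zero]
  | pure n c =>
    rw [QTilde.eval_tmul, QTilde.eval_tmul, smul_smul, ← MulOpposite.op_mul, Dorroh.mul_of,
      QTilde.mulRight_apply]
    change _ = op (Dorroh.of ((0 : ℤ) • r + p c * r)) • n
    rw [zero_smul, zero_add]
  | add x y hx hy => rw [map_add, map_add, smul_add, hx, hy]

/-- On x = n ⊗ d this is n p(d) ⊗ c = n ⊗ p(d) · c, followed by the exchange identity. It is how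
evaluation by Q̃ is related to the *C-action on N ⊗_R C. -/
theorem QTilde.tmul_eval (hC : IsWeaklyLocallyProjective Aᵐᵒᵖ C) (p : QTilde A C)
    (x : BalTensor (Dorroh (RatRightDual A C)) N C) (c : C) :
    tmul _ (QTilde.eval N p x) c = op (p.flip c) • x := by
  induction x using BalTensor.induction with
  | zero => rw [map_zero, map_zero, smul_zero, AddMonoidHom.zero_apply]
  | pure n d =>
    rw [QTilde.eval_tmul, tmul_balanced, ratRight_of_smul, ← QTilde.op_flip_smul hC]
    rfl
  | add x y hx hy => rw [map_add, map_add, smul_add, AddMonoidHom.add_apply, hx, hy]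

/-- N is generated by elements n p(z), and F(n) p(z) depends only on F(n) ⊗ z. -/
theorem eq_zero_of_map_eq_zero (hs : Function.Surjective (moritaMap A C))
    (hN : Function.Surjective (mulRight (RatRightDual A C) N))
    (F : N →ₗ[(Dorroh (RatRightDual A C))ᵐᵒᵖ] N')
    (h : ∀ x, BalTensor.map F (LinearMap.id : C →ₗ[Dorroh (RatRightDual A C)] C) x = 0) :
    F = 0 := by
  ext n
  obtain ⟨w, rfl⟩ := hN n
  rw [LinearMap.zero_apply]
  induction w using BalTensor.induction with
  | zero => rw [map_zero, map_zero]
  | pure n r =>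
    rw [mulRight_tmul, map_smul]
    obtain ⟨y, rfl⟩ := hs r
    induction y using BalTensor.induction with
    | zero =>
      rw [map_zero, ← mulRight_tmul, map_zero, map_zero]
    | pure z p =>
      rw [moritaMap_tmul, ← QTilde.eval_tmul]
      have h1 := h (tmul _ n z)
      rw [BalTensor.map_tmul, LinearMap.id_apply] at h1
      rw [h1, map_zero]
    | add x y hx hy => rw [map_add, Dorroh.of_add, MulOpposite.op_add, add_smul, hx, hy, add_zero]
  | add x y hx hy => rw [map_add, map_add, hx, hy, add_zero]

/-! ### Recovering a map N → N' from a *C-linear map on the tensor products -/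

section Full

variable (φ : BalTensor (Dorroh (RatRightDual A C)) N C →+
  BalTensor (Dorroh (RatRightDual A C)) N' C)
  (hφ : ∀ (f : LeftDual A C) x, φ (op f • x) = op f • φ x)

/-- The map `C ⊗_{*C} Q̃ → N'`, `c ⊗ q̃ ↦ q̃(φ(n ⊗ c))`. -/
def liftMorita : N →+ BalTensor (LeftDual A C) C (QTilde A C) →+ N' :=
  AddMonoidHom.mk' (fun n => BalTensor.lift
      (AddMonoidHom.mk' (fun c => AddMonoidHom.mk' (fun p => QTilde.eval N' p (φ (tmul _ n c)))
          (fun p p' => by rw [map_add, AddMonoidHom.add_apply]))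
        (fun c c' => by ext p; simp))
      (fun c f p => by
        change QTilde.eval N' p (φ (op f • tmul _ n c)) = QTilde.eval N' (f • p) (φ (tmul _ n c))
        rw [hφ, QTilde.eval_smul]))
    (fun n n' => BalTensor.hom_ext fun c p => by
      change QTilde.eval N' p (φ (tmul _ (n + n') c)) =
        QTilde.eval N' p (φ (tmul _ n c)) + QTilde.eval N' p (φ (tmul _ n' c))
      rw [map_add, AddMonoidHom.add_apply, map_add, map_add])

theorem liftMorita_tmul (n : N) (c : C) (p : QTilde A C) :
    liftMorita φ hφ n (tmul _ c p) = QTilde.eval N' p (φ (tmul _ n c)) := rfl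

theorem liftMorita_smul (x : Dorroh (RatRightDual A C)) (n : N)
    (y : BalTensor (LeftDual A C) C (QTilde A C)) :
    liftMorita φ hφ (op x • n) y = liftMorita φ hφ n (x • y) := by
  induction y using BalTensor.induction with
  | zero => rw [smul_zero, map_zero, map_zero]
  | pure c p => rw [BalTensor.smul_tmul, liftMorita_tmul, liftMorita_tmul, tmul_balanced]
  | add x y hx hy => rw [smul_add, map_add, map_add, hx, hy]

theorem liftMorita_moritaMulRight (n : N) (y : BalTensor (LeftDual A C) C (QTilde A C))
    (r : RatRightDual A C) :
    liftMorita φ hφ n (moritaMulRight y r) = op (Dorroh.of r) • liftMorita φ hφ n y := by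
  induction y using BalTensor.induction with
  | zero => rw [map_zero, AddMonoidHom.zero_apply, map_zero, smul_zero]
  | pure c p =>
    rw [moritaMulRight_tmul, liftMorita_tmul, liftMorita_tmul, QTilde.eval_mulRight]
  | add x y hx hy => rw [map_add, map_add, smul_add, AddMonoidHom.add_apply, map_add, hx, hy]

/-- The candidate image of n △(y), tensored with c, agrees with φ(n △(y) ⊗ c); this is
`QTilde.tmul_eval` combined with *C-linearity of φ and the exchange identity. -/
theorem tmul_liftMorita (hC : IsWeaklyLocallyProjective Aᵐᵒᵖ C) (n : N)
    (y : BalTensor (LeftDual A C) C (QTilde A C)) (c : C) :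
    tmul _ (liftMorita φ hφ n y) c = φ (tmul _ n ((moritaMap A C y).1 • c)) := by
  induction y using BalTensor.induction with
  | zero =>
    rw [map_zero, map_zero, AddMonoidHom.zero_apply, map_zero]
    change _ = φ (tmul _ n ((0 : RightDual A C) • c))
    rw [zero_smul, map_zero, map_zero]
  | pure z p =>
    rw [liftMorita_tmul, moritaMap_tmul, QTilde.tmul_eval hC, ← hφ, ← QTilde.op_flip_smul hC]
    rfl
  | add x y hx hy =>
    rw [map_add, map_add, AddMonoidHom.add_apply, hx, hy, map_add, ← map_add, ← map_add,
      ← add_smul]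
    rfl

theorem moritaMap_smul (x : Dorroh (RatRightDual A C))
    (y : BalTensor (LeftDual A C) C (QTilde A C)) :
    moritaMap A C (x • y) = x • moritaMap A C y := by
  induction y using BalTensor.induction with
  | zero => rw [smul_zero, map_zero, smul_zero]
  | pure c p => exact p.toRat.map_smul x c
  | add x y hx hy => rw [smul_add, map_add, map_add, smul_add, hx, hy]

/-- The functor `- ⊗_R C` is full. -/
theorem exists_linearMap_of_linear (hC : IsWeaklyLocallyProjective Aᵐᵒᵖ C)
    (hm : Function.Bijective (moritaMap A C))
    (hN : Function.Bijective (mulRight (RatRightDual A C) N))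
    (hφ : ∀ (f : LeftDual A C) x, φ (op f • x) = op f • φ x) :
    ∃ F : N →ₗ[(Dorroh (RatRightDual A C))ᵐᵒᵖ] N',
      ∀ x, φ x = BalTensor.map F (LinearMap.id : C →ₗ[Dorroh (RatRightDual A C)] C) x := by
  let e := AddEquiv.ofBijective (moritaMap A C) hm
  have he : ∀ r, moritaMap A C (e.symm r) = r := e.apply_symm_apply
  have he' : ∀ y, e.symm (moritaMap A C y) = y := e.symm_apply_apply
  -- The intended map sends n p(c) to the contraction of φ(n ⊗ c) by p. Injectivity of △ makes this
  -- independent of how an element of R is written as a trace; firmness of N then replaces N ⊗_R R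
  -- by N.
  let θ : BalTensor (Dorroh (RatRightDual A C)) N (RatRightDual A C) →+ N' :=
    BalTensor.lift
      (AddMonoidHom.mk' (fun n => (liftMorita φ hφ n).comp e.symm.toAddMonoidHom)
        (fun n n' => by rw [map_add]; rfl))
      (fun n x r => by
        change liftMorita φ hφ (op x • n) (e.symm r) = liftMorita φ hφ n (e.symm (x • r))
        rw [liftMorita_smul]
        congr 1
        refine hm.1 ?_
        rw [moritaMap_smul, he, he])
  have hθ : ∀ n y, θ (tmul _ n (moritaMap A C y)) = liftMorita φ hφ n y := fun n y => by
    change liftMorita φ hφ n (e.symm _) = _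
    rw [he']
  have hθl : ∀ (x : (Dorroh (RatRightDual A C))ᵐᵒᵖ) w, θ (x • w) = x • θ w := by
    intro x w
    induction w using BalTensor.induction with
    | zero => rw [smul_zero, map_zero, smul_zero]
    | pure n r =>
      obtain ⟨y, rfl⟩ := hm.2 r
      -- A Dorroh scalar splits into an integer, for which additivity is enough, and an element of
      -- R.
      have hx : x = op ((x.unop.fst : Dorroh (RatRightDual A C)) + Dorroh.of x.unop.snd) :=
        MulOpposite.unop_injective (Dorroh.eq_intCast_add_of x.unop)
      rw [hx, MulOpposite.op_add, add_smul, add_smul, map_add]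
      congr 1
      · rw [MulOpposite.op_intCast, Int.cast_smul_eq_zsmul, Int.cast_smul_eq_zsmul, map_zsmul]
      · rw [BalTensor.op_smul_tmul, Dorroh.op_of_smul, ← moritaMap_moritaMulRight, hθ, hθ,
          liftMorita_moritaMulRight]
    | add x y hx hy => rw [smul_add, map_add, map_add, smul_add, hx, hy]
  let m : BalTensor (Dorroh (RatRightDual A C)) N (RatRightDual A C) ≃+ N :=
    AddEquiv.ofBijective _ hN
  have hmul : ∀ (x : (Dorroh (RatRightDual A C))ᵐᵒᵖ) w,
      mulRight (RatRightDual A C) N (x • w) = x • mulRight (RatRightDual A C) N w := by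
    intro x w
    induction w using BalTensor.induction with
    | zero => rw [smul_zero, map_zero, smul_zero]
    | pure n r =>
      rw [BalTensor.op_smul_tmul, mulRight_tmul, mulRight_tmul, smul_smul]
      congr 1
      refine MulOpposite.unop_injective ?_
      exact (Dorroh.of_mul x.unop r).symm
    | add x y hx hy => rw [smul_add, map_add, map_add, smul_add, hx, hy]
  have hms : ∀ (x : (Dorroh (RatRightDual A C))ᵐᵒᵖ) n, m.symm (x • n) = x • m.symm n := by
    intro x n
    refine m.injective ?_
    rw [AddEquiv.apply_symm_apply]
    exact ((hmul x (m.symm n)).trans (congrArg _ (m.apply_symm_apply n))).symm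
  refine ⟨{ toFun := fun n => θ (m.symm n)
            map_add' := fun n n' => by rw [map_add, map_add]
            map_smul' := fun x n => by rw [hms, hθl]; rfl }, fun x => ?_⟩
  refine BalTensor.eq_of_eq_on_tmul (fun n c => ?_) x
  rw [BalTensor.map_tmul, LinearMap.id_apply]
  change _ = tmul _ (θ (m.symm n)) c
  obtain ⟨w, rfl⟩ := m.surjective n
  rw [AddEquiv.symm_apply_apply]
  change φ (tmul _ (mulRight _ N w) c) = _
  induction w using BalTensor.induction with
  | zero => simp only [map_zero, AddMonoidHom.zero_apply]
  | pure n r =>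
    obtain ⟨y, rfl⟩ := hm.2 r
    rw [hθ, tmul_liftMorita φ hφ hC, mulRight_tmul, tmul_balanced, ratRight_of_smul]
  | add x y hx hy =>
    rw [map_add, map_add, AddMonoidHom.add_apply, map_add, hx, hy, map_add, map_add,
      AddMonoidHom.add_apply]

end Full

end

/-- Additive maps that are linear over `Rat(*C)` are linear over `*C`. -/
theorem linear_of_ratLinear {N : Type u} [AddCommGroup N]
    [Module (Dorroh (RatRightDual A C))ᵐᵒᵖ N] {N' : Type u} [AddCommGroup N']
    [Module (Dorroh (RatRightDual A C))ᵐᵒᵖ N']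
    (hS : Function.Surjective (mulRight (RatLeftDual A C) C))
    (φ : BalTensor (Dorroh (RatRightDual A C)) N C →+
      BalTensor (Dorroh (RatRightDual A C)) N' C)
    (hφ : ∀ (s : RatLeftDual A C) x, φ (op (Dorroh.of s) • x) = op (Dorroh.of s) • φ x)
    (f : LeftDual A C) (x : BalTensor (Dorroh (RatRightDual A C)) N C) :
    φ (op f • x) = op f • φ x := by
  have hφ' : ∀ (s : RatLeftDual A C) x, φ (op s.1 • x) = op s.1 • φ x := fun s x => by
    rw [← ratLeft_op_of_smul_tensor, hφ, ratLeft_op_of_smul_tensor]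
  induction x using BalTensor.induction with
  | zero => rw [smul_zero, map_zero, smul_zero]
  | pure n c =>
    obtain ⟨w, rfl⟩ := hS c
    induction w using BalTensor.induction with
    | zero => rw [map_zero, map_zero, smul_zero, map_zero, smul_zero]
    | pure d s =>
      -- With c = d · s, the scalar f is absorbed into s: Rat(*C) is a right ideal, so s f again
      -- lies in it.
      rw [mulRight_tmul, ratLeft_op_of_smul, ← BalTensor.op_smul_tmul, smul_smul,
        ← MulOpposite.op_mul, hφ', smul_smul, ← MulOpposite.op_mul]
      exact hφ' ⟨s.1 * f, RatLeftDual.mul_mem s.2 f⟩ _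
    | add x y hx hy => rw [map_add, map_add, smul_add, map_add, map_add, smul_add, hx, hy]
  | add x y hx hy => rw [smul_add, map_add, map_add, smul_add, hx, hy]

end TensorFunctor

/-! ### Faithfulness of the tensor functor -/

section TestModule

variable {A C : Type u} [Ring A] [AddCommGroup C] [Module A C] [Module Aᵐᵒᵖ C]
  [SMulCommClass A Aᵐᵒᵖ C] [Coring A C]

variable (A C) in
/-- The functor `- ⊗_R C` is faithful on firm modules. -/
def TensorFaithful : Prop :=
  ∀ (N N' : Type u) [AddCommGroup N] [AddCommGroup N']
    [Module (Dorroh (RatRightDual A C))ᵐᵒᵖ N] [Module (Dorroh (RatRightDual A C))ᵐᵒᵖ N']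
    (F : N →ₗ[(Dorroh (RatRightDual A C))ᵐᵒᵖ] N'),
    Function.Bijective (mulRight (RatRightDual A C) N) →
    Function.Bijective (mulRight (RatRightDual A C) N') →
    (∀ x, BalTensor.map F (LinearMap.id : C →ₗ[Dorroh (RatRightDual A C)] C) x = 0) → F = 0

/-- N need not be firm, so faithfulness is applied to r ↦ n ⊗ r from R to N ⊗_R R, both of which are
firm. After tensoring with C this becomes r ⊗ c ↦ n ⊗ r c, which is zero by assumption. -/
theorem TensorFaithful.smul_eq_zero (hf : TensorFaithful A C) (hd : RatRightDualDense A C)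
    {N : Type u} [AddCommGroup N] [Module (Dorroh (RatRightDual A C))ᵐᵒᵖ N] {n : N}
    (hn : ∀ c : C, tmul (Dorroh (RatRightDual A C)) n c = 0) (r : RatRightDual A C) :
    op (Dorroh.of r) • n = 0 := by
  have hR := mulRight_self_bijective_of_left_units hd.units
  let F : RatRightDual A C →ₗ[(Dorroh (RatRightDual A C))ᵐᵒᵖ]
      BalTensor (Dorroh (RatRightDual A C)) N (RatRightDual A C) :=
    { toFun := tmul _ n
      map_add' := map_add _
      map_smul' := fun x r => rfl }
  let μ : BalTensor (Dorroh (RatRightDual A C)) (RatRightDual A C) C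
      →ₗ[Dorroh (RatRightDual A C)] C :=
    { toFun := mulLeft _ C
      map_add' := map_add _
      map_smul' := fun x w => by
        rw [RingHom.id_apply]
        induction w using BalTensor.induction with
        | zero => rw [smul_zero, map_zero, smul_zero]
        | pure r c =>
          rw [BalTensor.smul_tmul, mulLeft_tmul, mulLeft_tmul, smul_smul, Dorroh.mul_of]
          rfl
        | add a b ha hb => rw [smul_add, map_add, map_add, smul_add, ha, hb] }
  have hF : F = 0 := by
    refine hf _ _ F hR (mulRight_tensor_bijective _ _ _ _ hR) fun x => ?_
    refine BalTensor.eq_of_eq_on_tmul (g := 0) (fun r c => ?_) x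
    refine BalTensor.assoc_bijective.1
      ((BalTensor.map_id_bijective μ (mulLeft_ratRight_bijective hd)).1 ?_)
    rw [AddMonoidHom.zero_apply, map_zero, map_zero]
    exact hn _
  have h1 := congrArg (mulRight _ N) (LinearMap.congr_fun hF r)
  rw [LinearMap.zero_apply, map_zero] at h1
  exact h1

/-- A right `C*`-module as a right `Rat(C*)`-module. -/
@[reducible]
def ratRightModule (N : Type*) [AddCommGroup N] [Module (RightDual A C)ᵐᵒᵖ N] :
    Module (Dorroh (RatRightDual A C))ᵐᵒᵖ N :=
  Module.compHom N (RingHom.op (Dorroh.toRing (RatRightDual A C)))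

attribute [local instance] ratRightModule

theorem op_of_smul_ratRightModule {N : Type*} [AddCommGroup N] [Module (RightDual A C)ᵐᵒᵖ N]
    (r : RatRightDual A C) (n : N) : op (Dorroh.of r) • n = op r.1 • n := by
  change op (Dorroh.toRing _ (Dorroh.of r)) • n = _
  rw [Dorroh.toRing_of]

/-- For a C*-module, tensoring with C over Rat(C*) is already balanced over C*: write c = r · c with
r rational and use that g r is rational. -/
theorem op_smul_tmul (hd : RatRightDualDense A C) {N : Type*} [AddCommGroup N]
    [Module (RightDual A C)ᵐᵒᵖ N] (g : RightDual A C) (n : N) (c : C) :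
    tmul (Dorroh (RatRightDual A C)) (op g • n) c = tmul _ n (g • c) := by
  obtain ⟨r, hr, hc⟩ := hd.exists_smul_eq {c}
  have hc := hc c (Finset.mem_singleton_self c)
  conv_lhs => rw [← hc, ← ratRight_of_smul ⟨r, hr⟩, ← tmul_balanced, op_of_smul_ratRightModule,
    smul_smul, ← MulOpposite.op_mul]
  conv_rhs => rw [← hc, smul_smul]
  rw [← ratRight_of_smul ⟨g * r, RatRightDual.mul_mem g hr⟩, ← tmul_balanced,
    op_of_smul_ratRightModule]

/-- `(g, d) ↦ g(s(d) x)`. -/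
def evalForm (s : LeftDual A C) : C →+ RightDual A C → C → RightDual A C :=
  AddMonoidHom.mk' (fun x g d => g (s d • x) • (1 : RightDual A C)) fun x y => by
    funext g d
    rw [smul_add, map_add, add_smul]
    rfl

/-- `x ⊗ y ↦ evalForm s x ⊗ y`. -/
def evalFormTensor (hd : RatRightDualDense A C) (s : LeftDual A C) :
    BalTensor A C C →+ BalTensor (Dorroh (RatRightDual A C)) (RightDual A C → C → RightDual A C) C :=
  BalTensor.lift
    ((tmul (Dorroh (RatRightDual A C))).comp (evalForm s))
    (fun x a y => by
      change tmul _ (evalForm s (op a • x)) y = tmul _ (evalForm s x) (a • y)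
      rw [← RightDual.smul_one_smul a y, ← op_smul_tmul hd]
      refine congrArg (fun z => tmul _ z y) ?_
      funext g d
      change g (s d • op a • x) • (1 : RightDual A C) = (g (s d • x) • 1) * (a • 1)
      rw [RightDual.smul_one_mul, smul_comm, RightDual.apply_smul, mul_smul])

theorem evalFormTensor_tmul (hd : RatRightDualDense A C) (s : LeftDual A C) (x y : C) :
    evalFormTensor hd s (tmul A x y) = tmul _ (evalForm s x) y := rfl

/-- Choose a rational r with r · c = c and witness Σ xᵢ ⊗ ρᵢ. Moving r across the tensor sign
replaces g s(d) by Σ g(s(d) xᵢ) ρᵢ, and moving each ρᵢ back yields Σ xᵢ ⊗ ρᵢ · c = Δ(c). -/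
theorem tmul_eq_evalFormTensor (hC : IsWeaklyLocallyProjective Aᵐᵒᵖ C)
    (hd : RatRightDualDense A C) (s : LeftDual A C) (c : C) :
    tmul (Dorroh (RatRightDual A C))
      (fun (g : RightDual A C) (d : C) => g * (s d • (1 : RightDual A C))) c =
    evalFormTensor hd s (Coring.comul (A := A) c) := by
  obtain ⟨r, hr, hc⟩ := hd.exists_smul_eq {c}
  have hc := hc c (Finset.mem_singleton_self c)
  obtain ⟨u, hu⟩ := id hr
  let m : RightDual A C →ₗ[A] C :=
    { toFun := fun g => g • c
      map_add' := fun g h => add_smul g h c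
      map_smul' := fun a g => by
        rw [← RightDual.smul_one_mul, mul_smul, RightDual.smul_one_smul]; rfl }
  -- Evaluating Σ xᵢ ⊗ ρᵢ · c at g gives (g r) · c = g · c, which is also the value of Δ(c) at g.
  have h1 : BalTensor.map LinearMap.id m u = Coring.comul (A := A) c := by
    refine evalLeft_injective hC fun g => ?_
    change _ = g • c
    conv_rhs => rw [← hc, smul_smul, hu]
    clear hu
    induction u using BalTensor.induction with
    | zero => rw [map_zero, map_zero, map_zero, zero_smul]
    | pure x ρ =>
      rw [BalTensor.map_tmul, evalLeft_tmul, evalLeft_tmul, ← map_smul]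
      rfl
    | add x y hx hy => rw [map_add, map_add, map_add, add_smul, hx, hy]
  have h2 : (fun (g : RightDual A C) (d : C) => g * (s d • (1 : RightDual A C)) * r) =
      fun g d => evalLeft (g * (s d • (1 : RightDual A C))) u := by
    funext g d
    exact hu _
  have h3 : tmul (Dorroh (RatRightDual A C)) (fun (g : RightDual A C) (d : C) =>
      evalLeft (g * (s d • (1 : RightDual A C))) u) c =
      evalFormTensor hd s (BalTensor.map LinearMap.id m u) := by
    clear h1 h2 hu
    induction u using BalTensor.induction with
    | zero =>
      simp only [map_zero]
      exact DFunLike.congr_fun (map_zero (tmul _)) c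
    | pure x ρ =>
      rw [BalTensor.map_tmul, evalFormTensor_tmul]
      change _ = tmul _ (evalForm s x) (ρ • c)
      rw [← op_smul_tmul hd]
      refine congrArg (fun z => tmul _ z c) ?_
      funext g d
      change (g * (s d • (1 : RightDual A C))) x • ρ = (g (s d • x) • (1 : RightDual A C)) * ρ
      rw [RightDual.smul_one_mul]
      exact congrArg (· • ρ) (RightDual.mul_ofRing_apply g (s d) x)
    | add x y hx hy =>
      rw [map_add, map_add, ← hx, ← hy, ← AddMonoidHom.add_apply, ← map_add]
      refine congrArg (fun z => tmul _ z c) ?_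
      funext g d
      exact map_add _ _ _
  rw [← h1, ← h3, ← h2]
  conv_lhs => rw [← hc, ← op_smul_tmul hd]
  rfl

/-- For z = u ⊗ v the coefficients are f_x(g(s(d) u) v) = g(s(d) u) f_x(v); the factor f_x(v) moves
across the tensor sign and rebuilds v from the dual basis. -/
theorem exists_sum_tmul_eq_evalFormTensor (hd : RatRightDualDense A C) (s : LeftDual A C)
    (z : BalTensor A C C) :
    ∃ E : Finset C, ∀ (B : Finset C) (f : C → LeftDual A C), (∀ e ∈ E, e = ∑ x ∈ B, f x e • x) →
      ∑ x ∈ B, tmul (Dorroh (RatRightDual A C)) (fun (g : RightDual A C) (d : C) =>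
        f x (evalLeft g (s d • z)) • (1 : RightDual A C)) x = evalFormTensor hd s z := by
  classical
  induction z using BalTensor.induction with
  | zero =>
    refine ⟨∅, fun B f _ => ?_⟩
    simp only [smul_zero, map_zero, zero_smul]
    exact Finset.sum_eq_zero fun x _ => DFunLike.congr_fun (map_zero (tmul _)) x
  | pure u v =>
    refine ⟨{v}, fun B f h => ?_⟩
    rw [evalFormTensor_tmul]
    conv_rhs => rw [h v (Finset.mem_singleton_self v), map_sum]
    refine Finset.sum_congr rfl fun x _ => ?_
    rw [← RightDual.smul_one_smul, ← op_smul_tmul hd]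
    refine congrArg (fun z => tmul _ z x) ?_
    funext g d
    change f x (g (s d • u) • v) • (1 : RightDual A C) =
      (g (s d • u) • (1 : RightDual A C)) * (f x v • 1)
    rw [LeftDual.apply_smul, RightDual.smul_one_mul, mul_smul]
  | add a b ha hb =>
    obtain ⟨E, hE⟩ := ha
    obtain ⟨E', hE'⟩ := hb
    refine ⟨E ∪ E', fun B f h => ?_⟩
    rw [map_add, ← hE B f fun e he => h e (Finset.mem_union_left _ he),
      ← hE' B f fun e he => h e (Finset.mem_union_right _ he), ← Finset.sum_add_distrib]
    refine Finset.sum_congr rfl fun x _ => ?_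
    rw [← AddMonoidHom.add_apply, ← map_add]
    refine congrArg (fun z => tmul _ z x) ?_
    funext g d
    rw [smul_add, map_add, map_add, add_smul]
    rfl

/-- The summands are the linearity defects of d ↦ f_x(e(d)) ε, for the finite rank map e(d) = Σ
s_i(d) c_i. For one summand s ⊗ c of t, the two halves of the defect give the same tensor, namely
the image of Δ(c) under `evalFormTensor`. Working with tensors of finite rank is essential, since
the left factor is a full function space. -/
theorem exists_sum_tmul_eq_zero (hC : IsWeaklyLocallyProjective Aᵐᵒᵖ C)
    (hd : RatRightDualDense A C) (t : BalTensor A (LeftDual A C) C) :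
    ∃ E : Finset C, ∀ (B : Finset C) (f : C → LeftDual A C), (∀ e ∈ E, e = ∑ x ∈ B, f x e • x) →
      ∑ x ∈ B, tmul (Dorroh (RatRightDual A C)) (fun (g : RightDual A C) (d : C) =>
        g * (f x (evalAtLeft d t) • (1 : RightDual A C)) -
          f x (g • evalAtLeft d t) • (1 : RightDual A C)) x = 0 := by
  classical
  induction t using BalTensor.induction with
  | zero =>
    refine ⟨∅, fun B f _ => ?_⟩
    simp only [smul_zero, map_zero, zero_smul, mul_zero, sub_zero]
    exact Finset.sum_eq_zero fun x _ => DFunLike.congr_fun (map_zero (tmul _)) x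
  | pure s c =>
    obtain ⟨E, hE⟩ := exists_sum_tmul_eq_evalFormTensor hd s (Coring.comul (A := A) c)
    refine ⟨insert c E, fun B f h => ?_⟩
    have h1 : ∑ x ∈ B, tmul (Dorroh (RatRightDual A C)) (fun (g : RightDual A C) (d : C) =>
        g * (f x (s d • c) • (1 : RightDual A C))) x =
        evalFormTensor hd s (Coring.comul (A := A) c) := by
      rw [← tmul_eq_evalFormTensor hC]
      conv_rhs => rw [h c (Finset.mem_insert_self c E), map_sum]
      refine Finset.sum_congr rfl fun x _ => ?_
      rw [← RightDual.smul_one_smul, ← op_smul_tmul hd]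
      refine congrArg (fun z => tmul _ z x) ?_
      funext g d
      change _ = g * (s d • (1 : RightDual A C)) * (f x c • 1)
      rw [mul_assoc, RightDual.smul_one_mul, LeftDual.apply_smul, mul_smul]
    have h2 := hE B f fun e he => h e (Finset.mem_insert_of_mem he)
    rw [← sub_eq_zero.2 (h1.trans h2.symm), ← Finset.sum_sub_distrib]
    refine Finset.sum_congr rfl fun x _ => ?_
    rw [← AddMonoidHom.sub_apply, ← map_sub]
    refine congrArg (fun z => tmul _ z x) ?_
    funext g d
    change g * (f x (s d • c) • (1 : RightDual A C)) -
      f x (evalLeft g (Coring.comul (A := A) (s d • c))) • (1 : RightDual A C) = _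
    rw [Coring.comul_smul]
    rfl
  | add a b ha hb =>
    obtain ⟨E, hE⟩ := ha
    obtain ⟨E', hE'⟩ := hb
    refine ⟨E ∪ E', fun B f h => ?_⟩
    have h1 := congrArg₂ (fun u v => u + v)
      (hE B f fun e he => h e (Finset.mem_union_left _ he))
      (hE' B f fun e he => h e (Finset.mem_union_right _ he))
    simp only [← Finset.sum_add_distrib, add_zero] at h1
    refine (Finset.sum_congr rfl fun x _ => ?_).trans h1
    rw [← AddMonoidHom.add_apply, ← map_add]
    refine congrArg (fun z => tmul _ z x) ?_
    funext g d
    rw [map_add, map_add, add_smul, mul_add, smul_add, map_add, add_smul, Pi.add_apply,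
      Pi.add_apply]
    abel

variable (A C) in
/-- The obstruction `(g, d) ↦ g θ(d) - θ(g d)` to the `C*`-linearity of `θ : C → C*`. -/
def linearityDefect : (C →+ RightDual A C) →ₗ[(RightDual A C)ᵐᵒᵖ]
    (RightDual A C → C → RightDual A C) where
  toFun θ g d := g * θ d - θ (g • d)
  map_add' θ θ' := by
    funext g d
    simp only [AddMonoidHom.add_apply, Pi.add_apply, mul_add]
    abel
  map_smul' f θ := by
    funext g d
    change g * (θ d * f.unop) - θ (g • d) * f.unop = (g * θ d - θ (g • d)) * f.unop
    rw [sub_mul, mul_assoc]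

variable (A C) in
/-- The relations of the test module. -/
noncomputable def testRelation : (C →₀ (C →+ RightDual A C)) →ₗ[(RightDual A C)ᵐᵒᵖ]
    RightDual A C × (C →₀ (RightDual A C → C → RightDual A C)) :=
  LinearMap.prod
    (Finsupp.lsum ℕ fun z =>
      { toFun := fun θ : C →+ RightDual A C => θ z
        map_add' := fun _ _ => rfl
        map_smul' := fun _ _ => rfl })
    (-(Finsupp.mapRange.linearMap (linearityDefect A C)))

theorem testRelation_single (z : C) (θ : C →+ RightDual A C) :
    testRelation A C (Finsupp.single z θ) =
      (θ z, -Finsupp.single z (linearityDefect A C θ)) := by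
  refine Prod.ext ?_ ?_
  · change (Finsupp.single z θ).sum _ = θ z
    exact Finsupp.sum_single_index rfl
  · change -(Finsupp.mapRange (linearityDefect A C) (map_zero _) (Finsupp.single z θ)) = _
    rw [Finsupp.mapRange_single]

/-- If `- ⊗_R C` is faithful and `C` is generated over `Rat(*C)`, the Morita map is onto. -/
theorem TensorFaithful.surjective (hf : TensorFaithful A C)
    (hA : IsWeaklyLocallyProjective A C) (hC : IsWeaklyLocallyProjective Aᵐᵒᵖ C)
    (hd : RatRightDualDense A C)
    (hS : Function.Surjective (mulRight (RatLeftDual A C) C)) :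
    Function.Surjective (moritaMap A C) := by
  classical
  -- The universal C*-module on a generator n and copies ι_z of the space of defects, subject to n
  -- θ(z) = ι_z(defect of θ) for all additive θ and all z.
  let π := (LinearMap.range (testRelation A C)).mkQ
  let n := π (1, 0)
  let ι : C → (RightDual A C → C → RightDual A C) →ₗ[(RightDual A C)ᵐᵒᵖ] _ := fun z =>
    π.comp ((LinearMap.inr _ _ _).comp (Finsupp.lsingle z))
  have hrel : ∀ (θ : C →+ RightDual A C) (z : C), op (θ z) • n = ι z (linearityDefect A C θ) := by
    intro θ z
    rw [← sub_eq_zero]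
    change π (op (θ z) • (1, 0)) - π (0, Finsupp.single z (linearityDefect A C θ)) = 0
    rw [← map_sub]
    refine (Submodule.Quotient.mk_eq_zero _).2 ⟨Finsupp.single z θ, ?_⟩
    rw [testRelation_single]
    refine Prod.ext ?_ ?_
    · change θ z = 1 * θ z - 0
      rw [one_mul, sub_zero]
    · change _ = op (θ z) • (0 : C →₀ _) - _
      rw [smul_zero, zero_sub]
  -- Expand d · s in a dual basis: n ⊗ d · s = Σ n θ_x(d) ⊗ x, where θ_x(d') = f_x(d' · s) ε. The
  -- relations turn this into the image under ι_d of Σ defect(θ_x) ⊗ x, which vanishes because d' ↦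
  -- d' · s has finite rank.
  have hz : ∀ (s : RatLeftDual A C) (d : C),
      tmul (Dorroh (RatRightDual A C)) n (op s.1 • d) = 0 := by
    intro s d
    obtain ⟨t, ht⟩ := s.2
    have ht' := op_smul_eq_evalAtLeft hA ht
    obtain ⟨E, hE⟩ := exists_sum_tmul_eq_zero hC hd t
    obtain ⟨B, f, hB⟩ := exists_leftDualBasis hA (insert (op s.1 • d) E)
    have hE := hE B f fun e he => hB e (Finset.mem_insert_of_mem he)
    let ι' : (RightDual A C → C → RightDual A C) →ₗ[(Dorroh (RatRightDual A C))ᵐᵒᵖ] _ :=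
      { toFun := ι d
        map_add' := map_add _
        map_smul' := fun x m => (ι d).map_smul (op (Dorroh.toRing _ x.unop)) m }
    have h0 := congrArg (BalTensor.map ι' (LinearMap.id : C →ₗ[Dorroh (RatRightDual A C)] C)) hE
    rw [map_sum, map_zero] at h0
    rw [← h0]
    conv_lhs => rw [hB _ (Finset.mem_insert_self _ _), map_sum]
    refine Finset.sum_congr rfl fun x _ => ?_
    rw [BalTensor.map_tmul, LinearMap.id_apply]
    let θ : C →+ RightDual A C := AddMonoidHom.mk'
      (fun d' => f x (op s.1 • d') • (1 : RightDual A C))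
      (fun d' d'' => by rw [smul_add, map_add, add_smul])
    have h1 := hrel θ d
    rw [← RightDual.smul_one_smul, ← op_smul_tmul hd]
    refine congrArg (fun z => tmul _ z x) (h1.trans ?_)
    refine congrArg (ι d) ?_
    funext g d'
    change g * (f x (op s.1 • d') • (1 : RightDual A C)) -
      f x (op s.1 • g • d') • (1 : RightDual A C) = _
    rw [← smul_comm g (op s.1) d', ht']
  have hz' : ∀ c : C, tmul (Dorroh (RatRightDual A C)) n c = 0 := by
    intro c
    obtain ⟨w, rfl⟩ := hS c
    induction w using BalTensor.induction with
    | zero => rw [map_zero, map_zero]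
    | pure d s => rw [mulRight_tmul, ratLeft_op_of_smul, hz]
    | add x y hx hy => rw [map_add, map_add, hx, hy, add_zero]
  intro r
  have hr := hf.smul_eq_zero hd hz' r
  rw [op_of_smul_ratRightModule] at hr
  change π (op r.1 • (1, 0)) = 0 at hr
  obtain ⟨v, hv⟩ := (Submodule.Quotient.mk_eq_zero _).1 hr
  -- The second component of the relation (r, 0) says that every v z is C*-linear, hence an element
  -- of Q̃; the first component then reads r = Σ (v z)(z).
  have hv2 : ∀ z, linearityDefect A C (v z) = 0 := fun z => by
    have h1 := DFunLike.congr_fun (congrArg Prod.snd hv) z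
    change -(linearityDefect A C (v z)) = (op r.1 • (0 : C →₀ _)) z at h1
    rw [smul_zero, Finsupp.zero_apply, neg_eq_zero] at h1
    exact h1
  have hv3 : ∀ (z : C) (g : RightDual A C) (d : C), v z (g • d) = g * v z d := fun z g d =>
    (sub_eq_zero.1 (congrFun (congrFun (hv2 z) g) d)).symm
  refine ⟨∑ z ∈ v.support, tmul _ z (QTilde.ofLinear (v z) (hv3 z)), Subtype.ext ?_⟩
  rw [map_sum, AddSubmonoidClass.coe_finsetSum]
  have h1 := congrArg Prod.fst hv
  change (v.sum fun z θ => θ z) = 1 * r.1 at h1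
  rw [one_mul] at h1
  exact h1

end TestModule

/-! ### Full faithfulness of the tensor functors -/

section TensorCategories

variable {A C : Type u} [Ring A] [AddCommGroup C] [Module A C] [Module Aᵐᵒᵖ C]
  [SMulCommClass A Aᵐᵒᵖ C] [Coring A C]

theorem linearMap_eq_of_map_eq (hs : Function.Surjective (moritaMap A C)) {N N' : Type u}
    [AddCommGroup N] [AddCommGroup N'] [Module (Dorroh (RatRightDual A C))ᵐᵒᵖ N]
    [Module (Dorroh (RatRightDual A C))ᵐᵒᵖ N']
    (hN : Function.Surjective (mulRight (RatRightDual A C) N))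
    {F G : N →ₗ[(Dorroh (RatRightDual A C))ᵐᵒᵖ] N'}
    (h : ∀ x, BalTensor.map F (LinearMap.id : C →ₗ[Dorroh (RatRightDual A C)] C) x =
      BalTensor.map G LinearMap.id x) : F = G := by
  refine sub_eq_zero.1 (eq_zero_of_map_eq_zero hs hN _ fun x => ?_)
  have h1 : BalTensor.map (F - G) (LinearMap.id : C →ₗ[Dorroh (RatRightDual A C)] C) x =
      (BalTensor.map F LinearMap.id - BalTensor.map G LinearMap.id :
        BalTensor (Dorroh (RatRightDual A C)) N C →+ _) x :=
    BalTensor.eq_of_eq_on_tmul (fun n c => by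
      rw [AddMonoidHom.sub_apply, BalTensor.map_tmul, BalTensor.map_tmul, BalTensor.map_tmul,
        LinearMap.sub_apply, map_sub, AddMonoidHom.sub_apply]) x
  rw [h1, AddMonoidHom.sub_apply, h, sub_self]

theorem map_zero_left_apply {N N' : Type u}
    [AddCommGroup N] [AddCommGroup N'] [Module (Dorroh (RatRightDual A C))ᵐᵒᵖ N]
    [Module (Dorroh (RatRightDual A C))ᵐᵒᵖ N'] (x : BalTensor (Dorroh (RatRightDual A C)) N C) :
    BalTensor.map (0 : N →ₗ[(Dorroh (RatRightDual A C))ᵐᵒᵖ] N')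
      (LinearMap.id : C →ₗ[Dorroh (RatRightDual A C)] C) x = 0 :=
  BalTensor.eq_of_eq_on_tmul (g := 0) (fun n c => by
    rw [BalTensor.map_tmul, LinearMap.zero_apply, map_zero, AddMonoidHom.zero_apply,
      AddMonoidHom.zero_apply]) x

/-- Firmness is inherited from that of C over Rat(*C), which also upgrades Rat(*C)-linear maps to
*C-linear ones. -/
theorem HasTraceUnits.tensorRat_fullyFaithful (hC : IsWeaklyLocallyProjective Aᵐᵒᵖ C)
    (hu : HasTraceUnits A C) :
    ∃ h : ∀ N : FirmRight (RatRightDual A C), IsFirmRight (RatLeftDual A C)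
        (((IsFirmRight (RatRightDual A C)).ι ⋙ tensorRat A C).obj N),
      ((IsFirmRight (RatLeftDual A C)).lift
        ((IsFirmRight (RatRightDual A C)).ι ⋙ tensorRat A C) h).Full ∧
      ((IsFirmRight (RatLeftDual A C)).lift
        ((IsFirmRight (RatRightDual A C)).ι ⋙ tensorRat A C) h).Faithful := by
  have hS := hu.mulRight_bijective hC
  refine ⟨fun N => mulRight_tensor_bijective _ _ C N.obj hS, ⟨fun {X Y} φ => ?_⟩,
    ⟨fun {X Y} a b hab => ?_⟩⟩
  · let φ' : BalTensor (Dorroh (RatRightDual A C)) X.obj C →ₗ[(Dorroh (RatLeftDual A C))ᵐᵒᵖ]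
      BalTensor (Dorroh (RatRightDual A C)) Y.obj C := φ.hom.hom
    obtain ⟨F, hF⟩ := exists_linearMap_of_linear φ'.toAddMonoidHom hC
      ⟨moritaMap_injective hC hu, hu.surjective⟩ X.property
      (linear_of_ratLinear hS.2 φ'.toAddMonoidHom fun s x => φ'.map_smul _ x)
    exact ⟨ObjectProperty.homMk (ModuleCat.ofHom F), ObjectProperty.hom_ext _
      (ModuleCat.hom_ext (LinearMap.ext fun x => (hF x).symm))⟩
  · refine ObjectProperty.hom_ext _ (ModuleCat.hom_ext
      (linearMap_eq_of_map_eq hu.surjective X.property.2 fun x => ?_))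
    exact LinearMap.congr_fun (congrArg (fun z => z.hom.hom) hab) x

/-- If F ⊗ C = 0 then the functor cannot distinguish F from the zero map. -/
theorem tensorFaithful_of_tensorRat_faithful
    (h : ∀ N : FirmRight (RatRightDual A C), IsFirmRight (RatLeftDual A C)
        (((IsFirmRight (RatRightDual A C)).ι ⋙ tensorRat A C).obj N))
    (hf : ((IsFirmRight (RatLeftDual A C)).lift
        ((IsFirmRight (RatRightDual A C)).ι ⋙ tensorRat A C) h).Faithful) :
    TensorFaithful A C := by
  intro N N' _ _ _ _ F hN hN' hF
  let X : FirmRight (RatRightDual A C) := ⟨ModuleCat.of _ N, hN⟩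
  let Y : FirmRight (RatRightDual A C) := ⟨ModuleCat.of _ N', hN'⟩
  have h1 : (ObjectProperty.homMk (ModuleCat.ofHom F) : X ⟶ Y) =
      ObjectProperty.homMk (ModuleCat.ofHom 0) := by
    refine hf.map_injective (ObjectProperty.hom_ext _ (ModuleCat.hom_ext
      (LinearMap.ext fun x => ?_)))
    exact (hF x).trans (map_zero_left_apply x).symm
  exact congrArg (fun z : X ⟶ Y => z.hom.hom) h1

/-- If `N ⊗_R C` is firm over `Rat(*C)` for all firm `N`, then `C` is generated over
`Rat(*C)`. -/
theorem mulRight_surjective_of_tensorRat_firm (hd : RatRightDualDense A C)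
    (h : ∀ N : FirmRight (RatRightDual A C), IsFirmRight (RatLeftDual A C)
        (((IsFirmRight (RatRightDual A C)).ι ⋙ tensorRat A C).obj N)) :
    Function.Surjective (mulRight (RatLeftDual A C) C) := by
  -- Firmness is tested on N = R, where multiplication identifies R ⊗_R C with C as right
  -- Rat(*C)-modules.
  have hR : Function.Bijective (mulRight (RatLeftDual A C)
      (BalTensor (Dorroh (RatRightDual A C)) (RatRightDual A C) C)) :=
    h ⟨ModuleCat.of _ (RatRightDual A C), mulRight_self_bijective_of_left_units hd.units⟩
  intro c
  obtain ⟨x, rfl⟩ := (mulLeft_ratRight_bijective hd).2 c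
  obtain ⟨w, rfl⟩ := hR.2 x
  let μ := mulLeftL (RatRightDual A C) (Dorroh (RatLeftDual A C)) C
  refine ⟨BalTensor.map μ LinearMap.id w, ?_⟩
  induction w using BalTensor.induction with
  | zero => simp only [map_zero]
  | pure x s =>
    rw [BalTensor.map_tmul, mulRight_tmul, mulRight_tmul]
    exact (μ.map_smul _ x).symm
  | add x y hx hy => simp only [map_add, hx, hy]

theorem map_evalRight {M N : Type*} [AddCommGroup M] [Module Aᵐᵒᵖ M] [AddCommGroup N]
    [Module Aᵐᵒᵖ N] (φ : M →ₗ[Aᵐᵒᵖ] N) (f : LeftDual A C) (t : BalTensor A M C) :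
    φ (evalRight f t) = evalRight f (BalTensor.map φ LinearMap.id t) := by
  induction t using BalTensor.induction with
  | zero => simp only [map_zero]
  | pure m c => simp
  | add x y hx hy => simp only [map_add, hx, hy]

theorem evalRight_tensorCoactL {N : Type u} [AddCommGroup N]
    [Module (Dorroh (RatRightDual A C))ᵐᵒᵖ N] (f : LeftDual A C)
    (x : BalTensor (Dorroh (RatRightDual A C)) N C) :
    evalRight f (tensorCoactL A C N x) = op f • x := by
  induction x using BalTensor.induction with
  | zero => rw [map_zero, map_zero, smul_zero]
  | pure n c =>
    rw [tensorCoactL_tmul, ← map_evalRight]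
    rfl
  | add x y hx hy => rw [map_add, map_add, smul_add, hx, hy]

/-- The *C-action on N ⊗_R C is obtained from its coaction by evaluation, so colinear maps are
*C-linear and lift to linear maps N → N'. -/
theorem HasTraceUnits.tensorComodule_fullyFaithful (hC : IsWeaklyLocallyProjective Aᵐᵒᵖ C)
    (hu : HasTraceUnits A C) :
    ((IsFirmRight (RatRightDual A C)).ι ⋙ tensorComodule A C).Full ∧
      ((IsFirmRight (RatRightDual A C)).ι ⋙ tensorComodule A C).Faithful := by
  refine ⟨⟨fun {X Y} φ => ?_⟩, ⟨fun {X Y} a b hab => ?_⟩⟩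
  · let φ' : BalTensor (Dorroh (RatRightDual A C)) X.obj C →ₗ[Aᵐᵒᵖ]
      BalTensor (Dorroh (RatRightDual A C)) Y.obj C := φ.1
    have hφ' : ∀ x, tensorCoactL A C Y.obj (φ' x) =
      BalTensor.map φ' LinearMap.id (tensorCoactL A C X.obj x) := φ.2
    obtain ⟨F, hF⟩ := exists_linearMap_of_linear φ'.toAddMonoidHom hC
      ⟨moritaMap_injective hC hu, hu.surjective⟩ X.property (fun f x => by
        change φ' (op f • x) = op f • φ' x
        rw [← evalRight_tensorCoactL, ← evalRight_tensorCoactL, hφ', map_evalRight])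
    exact ⟨ObjectProperty.homMk (ModuleCat.ofHom F),
      Subtype.ext (LinearMap.ext fun x => (hF x).symm)⟩
  · refine ObjectProperty.hom_ext _ (ModuleCat.hom_ext
      (linearMap_eq_of_map_eq hu.surjective X.property.2 fun x => ?_))
    exact LinearMap.congr_fun (congrArg Subtype.val hab) x

theorem tensorFaithful_of_tensorComodule_faithful
    (hf : ((IsFirmRight (RatRightDual A C)).ι ⋙ tensorComodule A C).Faithful) :
    TensorFaithful A C := by
  intro N N' _ _ _ _ F hN hN' hF
  let X : FirmRight (RatRightDual A C) := ⟨ModuleCat.of _ N, hN⟩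
  let Y : FirmRight (RatRightDual A C) := ⟨ModuleCat.of _ N', hN'⟩
  have h1 : (ObjectProperty.homMk (ModuleCat.ofHom F) : X ⟶ Y) =
      ObjectProperty.homMk (ModuleCat.ofHom 0) := by
    refine hf.map_injective (Subtype.ext (LinearMap.ext fun x => ?_))
    exact (hF x).trans (map_zero_left_apply x).symm
  exact congrArg (fun z : X ⟶ Y => z.hom.hom) h1

theorem RatLeftDualDense.mulRight_surjective (h : RatLeftDualDense A C) :
    Function.Surjective (mulRight (RatLeftDual A C) C) := fun c => by
  obtain ⟨s, hs, hc⟩ := h.exists_smul_eq {c}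
  refine ⟨tmul _ c ⟨s, hs⟩, ?_⟩
  rw [mulRight_tmul, ratLeft_op_of_smul]
  exact hc c (Finset.mem_singleton_self c)

end TensorCategories

/-! ### Left comodules as modules over `C*` -/

section LeftComodules

variable {A C : Type u} [Ring A] [AddCommGroup C] [Module A C] [Module Aᵐᵒᵖ C]
  [SMulCommClass A Aᵐᵒᵖ C] [Coring A C]

theorem map_evalLeft {M N : Type*} [AddCommGroup M] [Module A M] [AddCommGroup N]
    [Module A N] (φ : M →ₗ[A] N) (f : RightDual A C) (t : BalTensor A C M) :
    φ (evalLeft f t) = evalLeft f (BalTensor.map LinearMap.id φ t) := by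
  induction t using BalTensor.induction with
  | zero => simp only [map_zero]
  | pure m c => simp
  | add x y hx hy => simp only [map_add, hx, hy]

theorem evalLeft_add {M : Type*} [AddCommGroup M] [Module A M] (f g : RightDual A C)
    (t : BalTensor A C M) : evalLeft (f + g) t = evalLeft f t + evalLeft g t := by
  induction t using BalTensor.induction with
  | zero => simp only [map_zero, add_zero]
  | pure m c => simp [add_smul]
  | add x y hx hy => simp only [map_add, hx, hy]; abel

theorem evalLeft_smul {M : Type*} [AddCommGroup M] [Module A M] (a : A) (f : RightDual A C)
    (t : BalTensor A C M) : evalLeft (a • f) t = a • evalLeft f t := by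
  induction t using BalTensor.induction with
  | zero => simp only [map_zero, smul_zero]
  | pure m c => simp [mul_smul]
  | add x y hx hy => simp only [map_add, hx, hy, smul_add]

theorem evalLeft_evalLeft_assoc {M : Type*} [AddCommGroup M] [Module A M] (f g : RightDual A C)
    (t : BalTensor A C M) :
    evalLeft f (evalLeft g (BalTensor.assoc
      (BalTensor.map (comulR (A := A) (C := C)) LinearMap.id t))) = evalLeft (f * g) t := by
  induction t using BalTensor.induction with
  | zero => simp only [map_zero]
  | pure c m =>
    rw [evalLeft_tmul]
    change _ = f (evalLeft g (Coring.comul (A := A) c)) • m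
    change evalLeft f (evalLeft g (BalTensor.assoc (tmul A (Coring.comul (A := A) c) m))) = _
    generalize Coring.comul (A := A) c = z
    induction z using BalTensor.induction with
    | zero => simp only [map_zero, AddMonoidHom.zero_apply, zero_smul]
    | pure x y =>
      rw [BalTensor.assoc_tmul, evalLeft_tmul, evalLeft_tmul, BalTensor.smul_tmul, evalLeft_tmul]
    | add x y hx hy => simp only [map_add, AddMonoidHom.add_apply, add_smul, hx, hy]
  | add x y hx hy => simp only [map_add, hx, hy]

/-- The left action of `C*` on a left comodule. -/
def LeftComodule.act (M : LeftComodule A C) : RightDual A C →+ M.carrier →+ M.carrier :=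
  AddMonoidHom.mk' (fun g => (evalLeft g).comp M.coact.toAddMonoidHom)
    (fun f g => AddMonoidHom.ext fun _ => evalLeft_add f g _)

theorem LeftComodule.act_apply (M : LeftComodule A C) (g : RightDual A C) (m : M.carrier) :
    M.act g m = evalLeft g (M.coact m) := rfl

theorem LeftComodule.act_one (M : LeftComodule A C) (m : M.carrier) : M.act 1 m = m := M.counit m

theorem LeftComodule.act_smul_one (M : LeftComodule A C) (a : A) (m : M.carrier) :
    M.act (a • 1) m = a • m := by
  rw [M.act_apply, evalLeft_smul, ← M.act_apply, M.act_one]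

theorem LeftComodule.act_mul (M : LeftComodule A C) (f g : RightDual A C) (m : M.carrier) :
    M.act (f * g) m = M.act f (M.act g m) := by
  rw [M.act_apply, ← evalLeft_evalLeft_assoc, M.coassoc, ← map_evalLeft]
  rfl

theorem LeftComodule.hom_act {M N : LeftComodule A C} (h : M ⟶ N) (g : RightDual A C)
    (m : M.carrier) : h.1 (M.act g m) = N.act g (h.1 m) := by
  rw [M.act_apply, N.act_apply, h.2, map_evalLeft]

theorem LeftComodule.regular_hom_smul {M : LeftComodule A C} (h : LeftComodule.regular A C ⟶ M)
    (g : RightDual A C) (c : C) : h.1 (g • c) = M.act g (h.1 c) :=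
  LeftComodule.hom_act h g c

/-- A `C*`-linear map of left comodules is colinear. -/
def LeftComodule.homOfAct (hC : IsWeaklyLocallyProjective Aᵐᵒᵖ C) {M N : LeftComodule A C}
    (h : M.carrier →+ N.carrier) (hh : ∀ g m, h (M.act g m) = N.act g (h m)) : M ⟶ N :=
  ⟨{ toFun := h
     map_add' := map_add h
     map_smul' := fun a m => by
      rw [← M.act_smul_one, hh, N.act_smul_one]; rfl }, fun m =>
    evalLeft_injective hC fun g => by
      rw [← map_evalLeft]
      exact (hh g m).symm⟩

theorem LeftComodule.hom_ext {M N : LeftComodule A C} {f g : M ⟶ N} (h : ∀ m, f.1 m = g.1 m) :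
    f = g := Subtype.ext (LinearMap.ext h)

/-- The colinear map `d ↦ q̃(d) m`. -/
def LeftComodule.homOfElement (hC : IsWeaklyLocallyProjective Aᵐᵒᵖ C) (M : LeftComodule A C) :
    QTilde A C →+ M.carrier →+ LeftComodule.homs (LeftComodule.regular A C) M :=
  AddMonoidHom.mk' (fun p => AddMonoidHom.mk' (fun m => LeftComodule.homOfAct hC
      (AddMonoidHom.mk' (fun d : C => M.act (p d).1 m) (fun d d' => by
        have h : (p (d + d')).1 = (p d).1 + (p d').1 := congrArg Subtype.val (map_add p d d')
        rw [h, map_add]; rfl))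
      (fun g d => by
        change M.act (p (g • d)).1 m = M.act g (M.act (p d).1 m)
        rw [QTilde.coe_apply_smul, M.act_mul]))
      (fun m m' => LeftComodule.hom_ext fun d => map_add (M.act (p d).1) m m'))
    (fun p p' => AddMonoidHom.ext fun m => LeftComodule.hom_ext fun d => by
      change M.act ((p d).1 + (p' d).1) m = M.act (p d).1 m + M.act (p' d).1 m
      rw [map_add]; rfl)

theorem LeftComodule.homOfElement_apply (hC : IsWeaklyLocallyProjective Aᵐᵒᵖ C)
    (M : LeftComodule A C) (p : QTilde A C) (m : M.carrier) (d : C) :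
    (M.homOfElement hC p m).1 d = M.act (p d).1 m := rfl

/-- A trace unit that fixes the C-legs of the coaction of m has the same values on them as ε, which
acts as the identity. -/
theorem HasTraceUnits.exists_act_eq (hu : HasTraceUnits A C) (M : LeftComodule A C)
    (m : M.carrier) : ∃ y, M.act (moritaMap A C y).1 m = m := by
  obtain ⟨E, hE⟩ := exists_evalLeft_congr (M.coact m)
  obtain ⟨y, hy⟩ := hu E
  refine ⟨y, ?_⟩
  conv_rhs => rw [← M.act_one m]
  refine hE _ _ fun c hc => ?_
  conv_rhs => rw [← hy c hc]
  rw [← RightDual.mul_apply', one_mul]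

/-- Every left comodule is generated by the images of colinear maps from `C`. -/
theorem HasTraceUnits.comodule_induction (hC : IsWeaklyLocallyProjective Aᵐᵒᵖ C)
    (hu : HasTraceUnits A C) (M : LeftComodule A C) {P : M.carrier → Prop} (zero : P 0)
    (hom : ∀ (h : LeftComodule.regular A C ⟶ M) (c : C), P (h.1 c))
    (add : ∀ m m', P m → P m' → P (m + m')) (m : M.carrier) : P m := by
  have key : ∀ y, P (M.act (moritaMap A C y).1 m) := by
    intro y
    induction y using BalTensor.induction with
    | zero =>
      rw [map_zero]
      change P (M.act 0 m)
      rw [map_zero]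
      exact zero
    | pure z p => exact hom (M.homOfElement hC p m) z
    | add x y hx hy =>
      rw [map_add]
      change P (M.act ((moritaMap A C x).1 + (moritaMap A C y).1) m)
      rw [map_add]
      exact add _ _ hx hy
  obtain ⟨y, hy⟩ := hu.exists_act_eq M m
  rw [← hy]
  exact key y

theorem HasTraceUnits.hom_ext (hC : IsWeaklyLocallyProjective Aᵐᵒᵖ C) (hu : HasTraceUnits A C)
    {M N : LeftComodule A C} {f g : M ⟶ N}
    (h : ∀ (k : LeftComodule.regular A C ⟶ M) (c : C), f.1 (k.1 c) = g.1 (k.1 c)) : f = g := by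
  refine LeftComodule.hom_ext fun m => ?_
  induction m using hu.comodule_induction hC M with
  | zero => rw [map_zero, map_zero]
  | hom k c => exact h k c
  | add m m' hm hm' => rw [map_add, map_add, hm, hm']

/-- Morphisms that agree on all images of C agree on the sums of such elements, that is, everywhere.
-/
theorem HasTraceUnits.isSeparator (hC : IsWeaklyLocallyProjective Aᵐᵒᵖ C)
    (hu : HasTraceUnits A C) : IsSeparator (LeftComodule.regular A C) := by
  refine (isSeparator_def _).2 fun M N f g h => hu.hom_ext hC fun k c => ?_
  exact LinearMap.congr_fun (congrArg Subtype.val (h k)) c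

/-! ### Rational modules -/

/-- A rational left `C*`-module as a left comodule. -/
noncomputable def LeftComodule.ofRational (hC : IsWeaklyLocallyProjective Aᵐᵒᵖ C) (M : Type u)
    [AddCommGroup M] [Module A M] [Module (RightDual A C) M]
    (hA : ∀ (a : A) (m : M), (a • (1 : RightDual A C)) • m = a • m)
    (hM : ∀ m : M, ∃ t : BalTensor A C M, ∀ g : RightDual A C, g • m = evalLeft g t) :
    LeftComodule A C where
  carrier := M
  coact :=
    -- The chosen witness is unique, since C* separates tensors; additivity, A-linearity and
    -- coassociativity can therefore be checked after evaluation, where they become identities for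
    -- the C*-action.
    { toFun := fun m => (hM m).choose
      map_add' := fun m m' => evalLeft_injective hC fun g => by
        rw [map_add, ← (hM _).choose_spec, ← (hM _).choose_spec, ← (hM _).choose_spec, smul_add]
      map_smul' := fun a m => evalLeft_injective hC fun g => by
        rw [← (hM _).choose_spec, ← hA, smul_smul, (hM m).choose_spec, RingHom.id_apply]
        generalize (hM m).choose = t
        induction t using BalTensor.induction with
        | zero => rw [smul_zero, map_zero, map_zero]
        | pure c m =>
          rw [BalTensor.smul_tmul, evalLeft_tmul, evalLeft_tmul]
          exact congrArg (· • m) (RightDual.mul_ofRing_apply g a c)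
        | add x y hx hy => rw [map_add, smul_add, map_add, hx, hy] }
  coassoc m := evalLeft_injective hC fun g => evalLeft_injective hC fun f => by
    rw [evalLeft_evalLeft_assoc, ← map_evalLeft]
    change evalLeft (f * g) (hM m).choose = evalLeft f (hM (evalLeft g (hM m).choose)).choose
    rw [← (hM _).choose_spec, ← (hM _).choose_spec, ← (hM _).choose_spec, mul_smul]
  counit m := ((hM m).choose_spec 1).symm.trans (one_smul _ m)

theorem LeftComodule.ofRational_act (hC : IsWeaklyLocallyProjective Aᵐᵒᵖ C) (M : Type u)
    [AddCommGroup M] [Module A M] [Module (RightDual A C) M]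
    (hA : ∀ (a : A) (m : M), (a • (1 : RightDual A C)) • m = a • m)
    (hM : ∀ m : M, ∃ t : BalTensor A C M, ∀ g : RightDual A C, g • m = evalLeft g t)
    (g : RightDual A C) (m : M) : (LeftComodule.ofRational hC M hA hM).act g m = g • m :=
  ((hM m).choose_spec g).symm

/-- The given witness lies in C ⊗ C*, but its coefficients in a dual basis are f_x r, and these lie
in the left ideal Rat(C*). This gives a witness in C ⊗ Rat(C*). -/
theorem ratRightDual_rational [Module A (RatRightDual A C)]
    (hC : IsWeaklyLocallyProjective Aᵐᵒᵖ C)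
    (hA : ∀ (a : A) (r : RatRightDual A C), (a • (1 : RightDual A C)) • r = a • r)
    (r : RatRightDual A C) :
    ∃ t : BalTensor A C (RatRightDual A C), ∀ g : RightDual A C, g • r = evalLeft g t := by
  obtain ⟨t, ht⟩ := r.2
  obtain ⟨E, hE⟩ := exists_eq_sum_tmul_evalLeft t
  obtain ⟨s, f, hf⟩ := exists_rightDualBasis hC E
  have hE := hE s f hf
  refine ⟨∑ x ∈ s, tmul A x (f x • r), fun g => Subtype.ext ?_⟩
  change g * r.1 = _
  rw [ht, hE, map_sum, map_sum, AddSubmonoidClass.coe_finsetSum]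
  refine Finset.sum_congr rfl fun x _ => ?_
  rw [evalLeft_tmul, evalLeft_tmul, ← ht, ← hA]
  exact (RightDual.smul_one_mul _ _).symm

theorem moritaMap_smul_rightDual (g : RightDual A C)
    (y : BalTensor (LeftDual A C) C (QTilde A C)) :
    moritaMap A C (g • y) = g • moritaMap A C y := by
  induction y using BalTensor.induction with
  | zero => rw [smul_zero, map_zero, smul_zero]
  | pure c p => exact p.apply_smul g c
  | add x y hx hy => rw [smul_add, map_add, map_add, smul_add, hx, hy]

/-- The image I of △ is a C*-submodule of Rat(C*), and the module and its quotient by I are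
rational, hence comodules. The projection kills every colinear map C → Rat(C*), so it is zero. -/
theorem surjective_of_isSeparator (hC : IsWeaklyLocallyProjective Aᵐᵒᵖ C)
    (h : IsSeparator (LeftComodule.regular A C)) : Function.Surjective (moritaMap A C) := by
  let I : Submodule (RightDual A C) (RatRightDual A C) :=
    { (moritaMap A C).range with
      smul_mem' := by
        rintro g _ ⟨y, rfl⟩
        exact ⟨g • y, moritaMap_smul_rightDual g y⟩ }
  let _ : Module A (RatRightDual A C) := Module.compHom _ (RightDual.ofRing (A := A) (C := C))
  let Q : Type u := RatRightDual A C ⧸ I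
  let _ : Module (RightDual A C) Q := inferInstanceAs (Module (RightDual A C) (_ ⧸ I))
  let _ : Module A Q := Module.compHom Q (RightDual.ofRing (A := A) (C := C))
  have hA : ∀ (a : A) (r : RatRightDual A C), (a • (1 : RightDual A C)) • r = a • r :=
    fun _ _ => rfl
  have hA' : ∀ (a : A) (r : Q), (a • (1 : RightDual A C)) • r = a • r := fun _ _ => rfl
  let π : RatRightDual A C →ₗ[A] Q :=
    { toFun := I.mkQ
      map_add' := map_add _
      map_smul' := fun a r => I.mkQ.map_smul (a • (1 : RightDual A C)) r }
  have hR := ratRightDual_rational hC hA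
  have hQ : ∀ m : Q, ∃ t : BalTensor A C Q, ∀ g : RightDual A C, g • m = evalLeft g t := by
    intro m
    obtain ⟨r, rfl⟩ := I.mkQ_surjective m
    obtain ⟨t, ht⟩ := hR r
    exact ⟨BalTensor.map LinearMap.id π t, fun g => by
      rw [← map_evalLeft, ← ht]; exact (I.mkQ.map_smul g r).symm⟩
  let X := LeftComodule.ofRational hC _ hA hR
  let Y := LeftComodule.ofRational hC Q hA' hQ
  let f : X ⟶ Y := LeftComodule.homOfAct hC (I.mkQ : RatRightDual A C →+ Q) fun g m => by
    exact (congrArg I.mkQ (LeftComodule.ofRational_act hC _ hA hR g m)).trans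
      ((I.mkQ.map_smul g m).trans (LeftComodule.ofRational_act hC Q hA' hQ g _).symm)
  have hf : f = ⟨0, zero_mem _⟩ := by
    refine (isSeparator_def _).1 h _ _ fun k => LeftComodule.hom_ext fun c => ?_
    -- A colinear k is C*-linear, thus an element of Q̃, and k(c) = △(c ⊗ k) lies in I.
    let p : QTilde A C := ({ toFun := fun c => k.1 c
                             map_add' := map_add k.1
                             map_smul' := fun g c => by
                              refine (LeftComodule.regular_hom_smul k g c).trans ?_
                              exact LeftComodule.ofRational_act hC _ hA hR g _ } :
      C →ₗ[RightDual A C] RatRightDual A C)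
    exact (Submodule.Quotient.mk_eq_zero I).2 ⟨tmul _ c p, rfl⟩
  intro r
  have h1 : f.1 r = 0 := by rw [hf]; rfl
  exact (Submodule.Quotient.mk_eq_zero I).1 h1

end LeftComodules

/-! ### The functor `^C Hom(C, -)` -/

section ComoduleHom

variable {A C : Type u} [Ring A] [AddCommGroup C] [Module A C] [Module Aᵐᵒᵖ C]
  [SMulCommClass A Aᵐᵒᵖ C] [Coring A C]

theorem LeftComodule.homs_smul_apply {M : LeftComodule A C} (f : LeftDual A C)
    (h : LeftComodule.homs (LeftComodule.regular A C) M) (c : C) :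
    (f • h).1 c = h.1 (op f • c) := rfl

theorem LeftComodule.homs_ext {M N : LeftComodule A C} {h h' : LeftComodule.homs M N}
    (e : ∀ c, h.1 c = h'.1 c) : h = h' := Subtype.ext (LinearMap.ext e)

theorem LeftComodule.homOfElement_smul (hC : IsWeaklyLocallyProjective Aᵐᵒᵖ C)
    {M : LeftComodule A C} (f : LeftDual A C) (p : QTilde A C) (m : M.carrier) :
    M.homOfElement hC (f • p) m = f • M.homOfElement hC p m := rfl

/-- At d both sides are h(p(d) · c) = h(d · q(c)), with q the flip of p. -/
theorem LeftComodule.homOfElement_hom (hC : IsWeaklyLocallyProjective Aᵐᵒᵖ C)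
    {M : LeftComodule A C} (p : QTilde A C)
    (h : LeftComodule.homs (LeftComodule.regular A C) M) (c : C) :
    M.homOfElement hC p (h.1 c) = p.flip c • h := by
  refine LeftComodule.homs_ext fun d => ?_
  rw [LeftComodule.homOfElement_apply, LeftComodule.homs_smul_apply, QTilde.op_flip_smul hC]
  exact (LeftComodule.regular_hom_smul h _ c).symm

/-! ### Recovering a comodule map from its effect on colinear maps out of C -/

section Full

variable (hC : IsWeaklyLocallyProjective Aᵐᵒᵖ C) {M M' : LeftComodule A C}
  (ψ : LeftComodule.homs (LeftComodule.regular A C) M →+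
    LeftComodule.homs (LeftComodule.regular A C) M')
  (hψ : ∀ (f : LeftDual A C) h, ψ (f • h) = f • ψ h)

/-- The map `c ⊗ q̃ ↦ (m ↦ ψ(q̃(-) m)(c))`. -/
def evalMorita : BalTensor (LeftDual A C) C (QTilde A C) →+ M.carrier →+ M'.carrier :=
  BalTensor.lift
    (AddMonoidHom.mk' (fun z => AddMonoidHom.mk' (fun p => AddMonoidHom.mk'
          (fun m => (ψ (M.homOfElement hC p m)).1 z)
          (fun m m' => by rw [map_add, map_add]; rfl))
        (fun p p' => AddMonoidHom.ext fun m => by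
          change (ψ (M.homOfElement hC (p + p') m)).1 z =
            (ψ (M.homOfElement hC p m)).1 z + (ψ (M.homOfElement hC p' m)).1 z
          rw [map_add, AddMonoidHom.add_apply, map_add]
          rfl))
      (fun z z' => AddMonoidHom.ext fun p => AddMonoidHom.ext fun m =>
        map_add (ψ (M.homOfElement hC p m)).1 z z'))
    (fun z f p => AddMonoidHom.ext fun m => by
      change (ψ (M.homOfElement hC p m)).1 (op f • z) = (ψ (M.homOfElement hC (f • p) m)).1 z
      rw [LeftComodule.homOfElement_smul, hψ]
      rfl)

theorem evalMorita_tmul (z : C) (p : QTilde A C) (m : M.carrier) :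
    evalMorita hC ψ hψ (tmul _ z p) m = (ψ (M.homOfElement hC p m)).1 z := rfl

/-- Once △(y) fixes c, the value at h(c) is ψ(h)(c), whatever y is. This is what makes the local
definitions compatible. -/
theorem evalMorita_hom (y : BalTensor (LeftDual A C) C (QTilde A C))
    (h : LeftComodule.homs (LeftComodule.regular A C) M) (c : C) :
    evalMorita hC ψ hψ y (h.1 c) = (ψ h).1 ((moritaMap A C y).1 • c) := by
  induction y using BalTensor.induction with
  | zero =>
    rw [map_zero, map_zero, AddMonoidHom.zero_apply]
    change _ = (ψ h).1 ((0 : RightDual A C) • c)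
    rw [zero_smul]
    exact (map_zero (ψ h).1).symm
  | pure z p =>
    rw [evalMorita_tmul, LeftComodule.homOfElement_hom, hψ, LeftComodule.homs_smul_apply,
      QTilde.op_flip_smul hC]
    rfl
  | add x y hx hy =>
    rw [map_add, map_add, AddMonoidHom.add_apply, hx, hy]
    change _ = (ψ h).1 (((moritaMap A C x).1 + (moritaMap A C y).1) • c)
    rw [add_smul]
    exact (map_add (ψ h).1 _ _).symm

end Full

/-- The map is the eventual value of `evalMorita` as the trace unit y fixes larger and larger finite
sets. -/
theorem HasTraceUnits.exists_hom_of_linear (hC : IsWeaklyLocallyProjective Aᵐᵒᵖ C)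
    (hu : HasTraceUnits A C) {M M' : LeftComodule A C}
    (ψ : LeftComodule.homs (LeftComodule.regular A C) M →+
      LeftComodule.homs (LeftComodule.regular A C) M')
    (hψ : ∀ (f : LeftDual A C) h, ψ (f • h) = f • ψ h) :
    ∃ a : M ⟶ M', ∀ (h : LeftComodule.homs (LeftComodule.regular A C) M) (c : C),
      a.1 (h.1 c) = (ψ h).1 c := by
  classical
  -- U m m' says that m' is the value at m for all sufficiently large trace units. It is
  -- single-valued, since two finite sets have a common unit, and total, since images of C generate
  -- M.
  let U : M.carrier → M'.carrier → Prop := fun m m' => ∃ E : Finset C, ∀ y,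
    (∀ c ∈ E, (moritaMap A C y).1 • c = c) → evalMorita hC ψ hψ y m = m'
  have huniq : ∀ m m₁ m₂, U m m₁ → U m m₂ → m₁ = m₂ := by
    rintro m m₁ m₂ ⟨E, hE⟩ ⟨E', hE'⟩
    obtain ⟨y, hy⟩ := hu (E ∪ E')
    rw [← hE y fun c hc => hy c (Finset.mem_union_left _ hc),
      ← hE' y fun c hc => hy c (Finset.mem_union_right _ hc)]
  have hhom : ∀ (h : LeftComodule.homs (LeftComodule.regular A C) M) (c : C),
      U (h.1 c) ((ψ h).1 c) := fun h c =>
    ⟨{c}, fun y hy => by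
      rw [evalMorita_hom, hy c (Finset.mem_singleton_self c)]⟩
  have hadd : ∀ m₁ m₁' m₂ m₂', U m₁ m₁' → U m₂ m₂' → U (m₁ + m₂) (m₁' + m₂') := by
    rintro m₁ m₁' m₂ m₂' ⟨E, hE⟩ ⟨E', hE'⟩
    refine ⟨E ∪ E', fun y hy => ?_⟩
    rw [map_add, hE y fun c hc => hy c (Finset.mem_union_left _ hc),
      hE' y fun c hc => hy c (Finset.mem_union_right _ hc)]
  have hex : ∀ m, ∃ m', U m m' := fun m => by
    induction m using hu.comodule_induction hC M with
    | zero => exact ⟨0, ∅, fun y _ => map_zero _⟩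
    | hom h c => exact ⟨_, hhom h c⟩
    | add m m' hm hm' =>
      obtain ⟨n, hn⟩ := hm
      obtain ⟨n', hn'⟩ := hm'
      exact ⟨_, hadd _ _ _ _ hn hn'⟩
  choose a ha using hex
  let a' : M.carrier →+ M'.carrier := AddMonoidHom.mk' a fun m m' =>
    huniq _ _ _ (ha _) (hadd _ _ _ _ (ha m) (ha m'))
  have ha' : ∀ (h : LeftComodule.homs (LeftComodule.regular A C) M) (c : C),
      a' (h.1 c) = (ψ h).1 c := fun h c => huniq _ _ _ (ha _) (hhom h c)
  refine ⟨LeftComodule.homOfAct hC a' fun g m => ?_, ha'⟩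
  induction m using hu.comodule_induction hC M with
  | zero => simp only [map_zero]
  | hom h c =>
    have h1 := LeftComodule.regular_hom_smul h g c
    have h2 := LeftComodule.regular_hom_smul (ψ h : LeftComodule.regular A C ⟶ M') g c
    rw [← h1]
    refine (ha' h (g • c)).trans (h2.trans ?_)
    exact congrArg _ (ha' h c).symm
  | add m m' hm hm' => simp only [map_add, hm, hm']

theorem HasTraceUnits.comoduleHom_fullyFaithful (hC : IsWeaklyLocallyProjective Aᵐᵒᵖ C)
    (hu : HasTraceUnits A C) : (comoduleHom A C).Full ∧ (comoduleHom A C).Faithful := by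
  refine ⟨⟨fun {M M'} φ => ?_⟩, ⟨fun {M M'} a b hab => hu.hom_ext hC fun k c => ?_⟩⟩
  · let ψ : LeftComodule.homs (LeftComodule.regular A C) M →ₗ[LeftDual A C]
      LeftComodule.homs (LeftComodule.regular A C) M' := φ.hom
    obtain ⟨a, ha⟩ := hu.exists_hom_of_linear hC ψ.toAddMonoidHom fun f h => ψ.map_smul f h
    exact ⟨a, ModuleCat.hom_ext (LinearMap.ext fun h => LeftComodule.homs_ext fun c => ha h c)⟩
  · have h1 := LinearMap.congr_fun (congrArg ModuleCat.Hom.hom hab) k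
    exact LinearMap.congr_fun (congrArg Subtype.val h1) c

/-- Faithfulness of Hom out of C, with values in modules, is the separator property. -/
theorem isSeparator_of_comoduleHom_faithful (h : (comoduleHom A C).Faithful) :
    IsSeparator (LeftComodule.regular A C) :=
  (isSeparator_def _).2 fun _ _ _ _ hfg =>
    h.map_injective (ModuleCat.hom_ext (LinearMap.ext fun k => hfg k))

/-! ### The functor `S ⊗_S ^C Hom(C, -)` -/

/-- The left `Rat(*C)`-module `^C Hom(C, M)`. -/
def ratHoms (M : LeftComodule A C) : Type u :=
  LeftComodule.homs (LeftComodule.regular A C) M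

instance (M : LeftComodule A C) : AddCommGroup (ratHoms M) :=
  inferInstanceAs (AddCommGroup (LeftComodule.homs (LeftComodule.regular A C) M))

instance (M : LeftComodule A C) : Module (Dorroh (RatLeftDual A C)) (ratHoms M) :=
  Module.compHom (LeftComodule.homs (LeftComodule.regular A C) M)
    (Dorroh.toRing (RatLeftDual A C))

/-- An element of `^C Hom(C, M)` from a colinear map. -/
def ratHoms.mk {M : LeftComodule A C} (h : LeftComodule.homs (LeftComodule.regular A C) M) :
    ratHoms M := h

/-- The colinear map underlying an element of `^C Hom(C, M)`. -/
def ratHoms.val {M : LeftComodule A C} (h : ratHoms M) :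
    LeftComodule.homs (LeftComodule.regular A C) M := h

theorem ratHoms.of_smul {M : LeftComodule A C} (s : RatLeftDual A C) (h : ratHoms M) :
    Dorroh.of s • h = ratHoms.mk (s.1 • h.val) := by
  change Dorroh.toRing (RatLeftDual A C) (Dorroh.of s) • h.val = s.1 • h.val
  rw [Dorroh.toRing_of]

/-- The functor factors through ^C Hom(C, -), so its faithfulness forces that of the first factor.
-/
theorem isSeparator_of_firmComoduleHom_faithful
    (h : ∀ M : LeftComodule A C, IsFirmLeft (RatLeftDual A C) ((firmComoduleHom A C).obj M))
    (hf : ((IsFirmLeft (RatLeftDual A C)).lift (firmComoduleHom A C) h).Faithful) :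
    IsSeparator (LeftComodule.regular A C) := by
  refine (isSeparator_def _).2 fun M N f g hfg => hf.map_injective (ObjectProperty.hom_ext _ ?_)
  change (firmComoduleHom A C).map f = (firmComoduleHom A C).map g
  have h1 : (comoduleHom A C).map f = (comoduleHom A C).map g :=
    ModuleCat.hom_ext (LinearMap.ext fun k => hfg k)
  simp only [firmComoduleHom, Functor.comp_map, h1]

/-- A compatible family θ_s is of the form c ↦ φ(c · s): put φ(c) = θ_u(c) for any rational u with c
· u = c. Two such u have a common right unit e, and both give θ_e(c). -/
theorem RatLeftDualDense.exists_add (hd : RatLeftDualDense A C) {H : Type u} [AddCommGroup H]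
    (θ : RatLeftDual A C → C →+ H)
    (h1 : ∀ (s e : RatLeftDual A C) (c : C), s * e = s → θ s c = θ e (op s.1 • c)) :
    ∃ φ : C →+ H, ∀ (s : RatLeftDual A C) (c : C), θ s c = φ (op s.1 • c) := by
  classical
  choose u hu' hu'' using fun c : C => hd.exists_smul_eq {c}
  have hu'' : ∀ c, op (u c) • c = c := fun c => hu'' c c (Finset.mem_singleton_self c)
  have h2 : ∀ (e : RatLeftDual A C) (c : C), op e.1 • c = c →
      θ e c = θ ⟨u c, hu' c⟩ c := fun e c hc => by
    obtain ⟨e', he'⟩ := hd.units {e, ⟨u c, hu' c⟩}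
    rw [h1 e e' c (he' _ (by simp)), h1 ⟨u c, hu' c⟩ e' c (he' _ (by simp)), hc, hu'']
  refine ⟨AddMonoidHom.mk' (fun c => θ ⟨u c, hu' c⟩ c) fun c d => ?_, fun s c => ?_⟩
  · obtain ⟨e, he, hcd⟩ := hd.exists_smul_eq {c, d}
    have hc : op e • c = c := hcd c (by simp)
    have hd : op e • d = d := hcd d (by simp)
    rw [← h2 ⟨e, he⟩ c hc, ← h2 ⟨e, he⟩ d hd, ← h2 ⟨e, he⟩ (c + d) (by rw [smul_add, hc, hd]),
      map_add]
  · obtain ⟨e, he⟩ := hd.units {s}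
    have he := he s (Finset.mem_singleton_self s)
    have he' : s.1 * e.1 = s.1 := congrArg Subtype.val he
    -- If s e = s then e fixes c · s, so θ_s(c) = θ_e(c · s) is the value of φ at c · s.
    have h3 : op e.1 • op s.1 • c = op s.1 • c := by
      rw [smul_smul, ← MulOpposite.op_mul, he']
    exact (h1 s e c he).trans (h2 e _ h3)

/-- If s e = s then Ψ_s(h) = s Ψ_e(h), whose value at c is Ψ_e(h)(c · s); this is the compatibility
needed to glue. C*-linearity of the glued map is inherited because the two actions on C commute. -/
theorem RatLeftDualDense.exists_homs (hd : RatLeftDualDense A C)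
    (hC : IsWeaklyLocallyProjective Aᵐᵒᵖ C) {M M' : LeftComodule A C}
    (Ψ : RatLeftDual A C → LeftComodule.homs (LeftComodule.regular A C) M →+
      LeftComodule.homs (LeftComodule.regular A C) M')
    (hmul : ∀ (s t : RatLeftDual A C) h, Ψ (s * t) h = s.1 • Ψ t h) :
    ∃ φ : LeftComodule.homs (LeftComodule.regular A C) M →+
        LeftComodule.homs (LeftComodule.regular A C) M',
      ∀ (s : RatLeftDual A C) h (c : C), (Ψ s h).1 c = (φ h).1 (op s.1 • c) := by
  have hex : ∀ h, ∃ g : C →+ M'.carrier, ∀ (s : RatLeftDual A C) (c : C),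
      (Ψ s h).1 c = g (op s.1 • c) := fun h =>
    hd.exists_add (fun s => (Ψ s h).1.toAddMonoidHom) fun s e c hs => by
      have h1 := hmul s e h
      rw [hs] at h1
      exact congrArg (fun z : LeftComodule.homs (LeftComodule.regular A C) M' => z.1 c) h1
  choose g hg using hex
  have hunit : ∀ c : C, ∃ s : RatLeftDual A C, op s.1 • c = c := fun c => by
    obtain ⟨s, hs, hc⟩ := hd.exists_smul_eq {c}
    exact ⟨⟨s, hs⟩, hc c (Finset.mem_singleton_self c)⟩
  have hact : ∀ h (f : RightDual A C) (c : C), g h (f • c) = M'.act f (g h c) := fun h f c => by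
    obtain ⟨s, hs⟩ := hunit c
    have h1 : op s.1 • f • c = f • c := by rw [← smul_comm f (op s.1) c, hs]
    have h2 := hg h s (f • c)
    have h3 := hg h s c
    rw [h1] at h2
    rw [hs] at h3
    rw [← h2, ← h3]
    exact LeftComodule.regular_hom_smul (Ψ s h) f c
  refine ⟨AddMonoidHom.mk' (fun h => LeftComodule.homOfAct (M := LeftComodule.regular A C) hC
    (g h) (hact h)) fun h h' => LeftComodule.homs_ext fun c => ?_,
    fun s h => hg h s⟩
  change g (h + h') c = g h c + g h' c
  obtain ⟨s, hs⟩ := hunit c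
  have h1 := hg (h + h') s c
  have h2 := hg h s c
  have h3 := hg h' s c
  rw [hs] at h1 h2 h3
  rw [← h1, ← h2, ← h3, map_add]
  rfl

/-- The second hypothesis makes the glued map *C-linear, so that it comes from a morphism of
comodules. -/
theorem HasTraceUnits.exists_hom_of_mul_smul (hC : IsWeaklyLocallyProjective Aᵐᵒᵖ C)
    (hd : RatLeftDualDense A C) (hu : HasTraceUnits A C) {M M' : LeftComodule A C}
    (Ψ : RatLeftDual A C →+ LeftComodule.homs (LeftComodule.regular A C) M →+
      LeftComodule.homs (LeftComodule.regular A C) M')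
    (hmul : ∀ (s t : RatLeftDual A C) h, Ψ (s * t) h = s.1 • Ψ t h)
    (hsmul : ∀ (s t : RatLeftDual A C) (f : LeftDual A C) h,
      Ψ (s * t) (f • h) = Ψ (s * ⟨t.1 * f, RatLeftDual.mul_mem t.2 f⟩) h) :
    ∃ a : M ⟶ M', ∀ (s : RatLeftDual A C) (h : LeftComodule.homs (LeftComodule.regular A C) M)
      (c : C), (Ψ s h).1 c = a.1 (h.1 (op s.1 • c)) := by
  obtain ⟨φ, hφ⟩ := hd.exists_homs hC (fun s => Ψ s) hmul
  obtain ⟨a, ha⟩ := hu.exists_hom_of_linear hC φ fun f h => LeftComodule.homs_ext fun c => by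
    rw [LeftComodule.homs_smul_apply]
    obtain ⟨s, hs, hc⟩ := hd.exists_smul_eq {c}
    have hc := hc c (Finset.mem_singleton_self c)
    obtain ⟨e, he⟩ := hd.units {⟨s, hs⟩}
    have he := he _ (Finset.mem_singleton_self _)
    have he' : s * e.1 = s := congrArg Subtype.val he
    -- Here c · s = c and s e = s: the product s e fixes c and has a second factor into which f can
    -- be absorbed.
    have h1 := hφ (⟨s, hs⟩ * e) (f • h) c
    rw [hsmul, hφ] at h1
    change (φ h).1 (op (s * (e.1 * f)) • c) = (φ (f • h)).1 (op (s * e.1) • c) at h1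
    rw [← mul_assoc, he', MulOpposite.op_mul, mul_smul, hc] at h1
    exact h1.symm
  exact ⟨a, fun s h c => (hφ s h c).trans (ha h _).symm⟩

/-! ### Fullness of S ⊗_S ^C Hom(C, -) -/

section FirmFull

variable {M M' : LeftComodule A C}
  (ψ : BalTensor (Dorroh (RatLeftDual A C)) (RatLeftDual A C) (ratHoms M)
    →ₗ[Dorroh (RatLeftDual A C)]
    BalTensor (Dorroh (RatLeftDual A C)) (RatLeftDual A C) (ratHoms M'))

/-- The identity, from `^C Hom(C, M)` to its underlying left `Rat(*C)`-module. -/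
def ratHoms.mkHom (M : LeftComodule A C) :
    LeftComodule.homs (LeftComodule.regular A C) M →+ ratHoms M := AddMonoidHom.id _

/-- The identity, to `^C Hom(C, M)` from its underlying left `Rat(*C)`-module. -/
def ratHoms.valHom (M : LeftComodule A C) :
    ratHoms M →+ LeftComodule.homs (LeftComodule.regular A C) M := AddMonoidHom.id _

/-- The map `(s, h) ↦ ψ(s ⊗ h)`, multiplied out. -/
def mulOut : RatLeftDual A C →+ LeftComodule.homs (LeftComodule.regular A C) M →+
    LeftComodule.homs (LeftComodule.regular A C) M' :=
  AddMonoidHom.mk' (fun s => (ratHoms.valHom M').comp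
      ((mulLeft _ (ratHoms M')).comp (ψ.toAddMonoidHom.comp ((tmul _ s).comp (ratHoms.mkHom M)))))
    (fun s s' => by
      rw [map_add, AddMonoidHom.add_comp, AddMonoidHom.comp_add, AddMonoidHom.comp_add,
        AddMonoidHom.comp_add])

theorem mulOut_apply (s : RatLeftDual A C) (h : LeftComodule.homs (LeftComodule.regular A C) M) :
    mulOut ψ s h = ratHoms.val (mulLeft _ (ratHoms M') (ψ (tmul _ s (ratHoms.mk h)))) := rfl

/-- For w = t ⊗ n: s w = s t ⊗ n = s ⊗ t n. Elements of S·(S ⊗ N) are thus determined by their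
multiplied-out form. -/
theorem of_smul_eq_tmul_mulLeft {N : Type u} [AddCommGroup N]
    [Module (Dorroh (RatLeftDual A C)) N] (s : RatLeftDual A C)
    (w : BalTensor (Dorroh (RatLeftDual A C)) (RatLeftDual A C) N) :
    Dorroh.of s • w = tmul _ s (mulLeft _ N w) := by
  induction w using BalTensor.induction with
  | zero => rw [smul_zero, map_zero, map_zero]
  | pure t n =>
    rw [BalTensor.smul_tmul, mulLeft_tmul, ← tmul_balanced, Dorroh.of_smul, Dorroh.op_of_smul]
  | add x y hx hy => rw [smul_add, map_add, map_add, hx, hy]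

theorem tmul_mul_eq {N : Type u} [AddCommGroup N] [Module (Dorroh (RatLeftDual A C)) N]
    (s t : RatLeftDual A C) (n : N) :
    tmul (Dorroh (RatLeftDual A C)) (s * t) n = tmul _ s (Dorroh.of t • n) := by
  rw [← tmul_balanced, Dorroh.op_of_smul]

/-- S-linearity gives s ψ(t ⊗ h), and `of_smul_eq_tmul_mulLeft` multiplies out the remaining factor.
Since S has right local units, ψ is thereby recovered from `mulOut`. -/
theorem map_tmul_mul (s t : RatLeftDual A C)
    (h : LeftComodule.homs (LeftComodule.regular A C) M) :
    ψ (tmul _ (s * t) (ratHoms.mk h)) = tmul _ s (ratHoms.mk (mulOut ψ t h)) := by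
  rw [← Dorroh.of_smul, ← BalTensor.smul_tmul, map_smul, of_smul_eq_tmul_mulLeft]
  rfl

theorem mulOut_mul (s t : RatLeftDual A C)
    (h : LeftComodule.homs (LeftComodule.regular A C) M) :
    mulOut ψ (s * t) h = s.1 • mulOut ψ t h := by
  rw [mulOut_apply, map_tmul_mul, mulLeft_tmul, ratHoms.of_smul]
  rfl

/-- Although ψ is linear only over S, the product t f lies in S, and s t ⊗ f h = s ⊗ (t f) h. -/
theorem mulOut_smul (s t : RatLeftDual A C) (f : LeftDual A C)
    (h : LeftComodule.homs (LeftComodule.regular A C) M) :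
    mulOut ψ (s * t) (f • h) = mulOut ψ (s * ⟨t.1 * f, RatLeftDual.mul_mem t.2 f⟩) h := by
  rw [mulOut_apply, mulOut_apply, tmul_mul_eq, tmul_mul_eq, ratHoms.of_smul, ratHoms.of_smul]
  congr 5
  exact (mul_smul t.1 f h).symm

/-- The functor `S ⊗_S ^C Hom(C, -)` is full. -/
theorem HasTraceUnits.exists_hom_of_ratLinear (hC : IsWeaklyLocallyProjective Aᵐᵒᵖ C)
    (hd : RatLeftDualDense A C) (hu : HasTraceUnits A C) :
    ∃ a : M ⟶ M', ∀ (s : RatLeftDual A C) (h : LeftComodule.regular A C ⟶ M),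
      ψ (tmul _ s (ratHoms.mk h)) = tmul _ s (ratHoms.mk (h ≫ a)) := by
  obtain ⟨a, ha⟩ := hu.exists_hom_of_mul_smul hC hd (mulOut ψ) (mulOut_mul ψ) (mulOut_smul ψ)
  refine ⟨a, fun s h => ?_⟩
  obtain ⟨e, he⟩ := hd.units {s}
  have he := he s (Finset.mem_singleton_self s)
  rw [← he, map_tmul_mul, tmul_mul_eq, ratHoms.of_smul]
  congr 2
  exact LeftComodule.homs_ext fun c => ha e h c

end FirmFull

/-- S is firm on the left because of its right local units, and S ⊗_S - inherits this. For
faithfulness, take s with c · s = c: multiplying out s ⊗ h and evaluating at c returns h(c). -/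
theorem HasTraceUnits.firmComoduleHom_fullyFaithful (hC : IsWeaklyLocallyProjective Aᵐᵒᵖ C)
    (hd : RatLeftDualDense A C) (hu : HasTraceUnits A C) :
    ∃ h : ∀ M : LeftComodule A C, IsFirmLeft (RatLeftDual A C) ((firmComoduleHom A C).obj M),
      ((IsFirmLeft (RatLeftDual A C)).lift (firmComoduleHom A C) h).Full ∧
      ((IsFirmLeft (RatLeftDual A C)).lift (firmComoduleHom A C) h).Faithful := by
  refine ⟨fun M => mulLeft_tensor_bijective _ _ _ (ratHoms M)
    (mulLeft_self_bijective_of_right_units hd.units), ⟨fun {M M'} φ => ?_⟩,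
    ⟨fun {M M'} a b hab => hu.hom_ext hC fun k c => ?_⟩⟩
  · let ψ : BalTensor (Dorroh (RatLeftDual A C)) (RatLeftDual A C) (ratHoms M)
      →ₗ[Dorroh (RatLeftDual A C)]
      BalTensor (Dorroh (RatLeftDual A C)) (RatLeftDual A C) (ratHoms M') := φ.hom.hom
    obtain ⟨a, ha⟩ := hu.exists_hom_of_ratLinear ψ hC hd
    refine ⟨a, ObjectProperty.hom_ext _ (ModuleCat.hom_ext (LinearMap.ext fun x => ?_))⟩
    exact BalTensor.eq_of_eq_on_tmul
      (f := ((firmComoduleHom A C).map a).hom.toAddMonoidHom) (g := ψ.toAddMonoidHom)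
      (fun s h => (ha s h).symm) x
  · obtain ⟨s, hs, hc⟩ := hd.exists_smul_eq {c}
    have hc := hc c (Finset.mem_singleton_self c)
    have h1 : tmul (Dorroh (RatLeftDual A C)) (⟨s, hs⟩ : RatLeftDual A C)
        (ratHoms.mk (k ≫ a) : ratHoms M') = tmul _ ⟨s, hs⟩ (ratHoms.mk (k ≫ b)) :=
      LinearMap.congr_fun (congrArg (fun z => z.hom.hom) hab)
        (tmul (Dorroh (RatLeftDual A C)) (⟨s, hs⟩ : RatLeftDual A C) (ratHoms.mk k))
    have h2 := congrArg (mulLeft (RatLeftDual A C) (ratHoms M')) h1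
    rw [mulLeft_tmul, mulLeft_tmul, ratHoms.of_smul, ratHoms.of_smul] at h2
    have h3 : (k ≫ a : LeftComodule.regular A C ⟶ M').1 (op s • c) =
        (k ≫ b : LeftComodule.regular A C ⟶ M').1 (op s • c) :=
      LinearMap.congr_fun (congrArg Subtype.val h2) c
    rw [hc] at h3
    exact h3

end ComoduleHom

/-! ### Flatness over `Rat(*C)` -/

section Flat

variable {A C : Type u} [Ring A] [AddCommGroup C] [Module A C] [Module Aᵐᵒᵖ C]
  [SMulCommClass A Aᵐᵒᵖ C] [Coring A C]

theorem QTilde.of_flip_op_smul (hC : IsWeaklyLocallyProjective Aᵐᵒᵖ C) (p : QTilde A C)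
    (b : Dorroh (RatLeftDual A C)) (c : C) :
    Dorroh.of (⟨p.flip (op b • c), p.flip_mem hC _⟩ : RatLeftDual A C) =
      Dorroh.of ⟨p.flip c, p.flip_mem hC c⟩ * b := by
  rw [Dorroh.of_mul]
  refine congrArg Dorroh.of (Subtype.ext ?_)
  change p.flip (op (Dorroh.toRing _ b) • c) = b.fst • p.flip c + p.flip c * b.snd.1
  rw [p.flip_op_smul hC]
  change p.flip c * (b.fst • (1 : LeftDual A C) + b.snd.1) = _
  rw [mul_add, mul_smul_comm, mul_one]

/-- The map `c ⊗ x ↦ p̃(-)(c) x`. -/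
def QTilde.contract (hC : IsWeaklyLocallyProjective Aᵐᵒᵖ C) (p : QTilde A C) (X : Type u)
    [AddCommGroup X] [Module (Dorroh (RatLeftDual A C)) X] :
    BalTensor (Dorroh (RatLeftDual A C)) C X →+ X :=
  BalTensor.lift
    (AddMonoidHom.mk' (fun c => DistribSMul.toAddMonoidHom X
        (Dorroh.of (⟨p.flip c, p.flip_mem hC c⟩ : RatLeftDual A C)))
      (fun c d => AddMonoidHom.ext fun x => by
        change Dorroh.of (⟨p.flip (c + d), _⟩ : RatLeftDual A C) • x =
          Dorroh.of (⟨p.flip c, _⟩ : RatLeftDual A C) • x +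
            Dorroh.of (⟨p.flip d, _⟩ : RatLeftDual A C) • x
        rw [← add_smul, ← Dorroh.of_add]
        exact congrArg (fun s : RatLeftDual A C => Dorroh.of s • x)
          (Subtype.ext (map_add p.flip c d))))
    (fun c b x => by
      change Dorroh.of (⟨p.flip (op b • c), _⟩ : RatLeftDual A C) • x =
        Dorroh.of (⟨p.flip c, _⟩ : RatLeftDual A C) • b • x
      rw [p.of_flip_op_smul hC, mul_smul])

theorem QTilde.contract_tmul (hC : IsWeaklyLocallyProjective Aᵐᵒᵖ C) (p : QTilde A C) {X : Type u}
    [AddCommGroup X] [Module (Dorroh (RatLeftDual A C)) X] (c : C) (x : X) :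
    p.contract hC X (tmul _ c x) =
      Dorroh.of (⟨p.flip c, p.flip_mem hC c⟩ : RatLeftDual A C) • x := rfl

/-- For w = c ⊗ x, with q the flip of p: p(z) · c ⊗ x = z · q(c) ⊗ x = z ⊗ q(c) x. -/
theorem QTilde.of_apply_smul (hC : IsWeaklyLocallyProjective Aᵐᵒᵖ C) (p : QTilde A C) {X : Type u}
    [AddCommGroup X] [Module (Dorroh (RatLeftDual A C)) X] (z : C)
    (w : BalTensor (Dorroh (RatLeftDual A C)) C X) :
    Dorroh.of (p z) • w = tmul _ z (p.contract hC X w) := by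
  induction w using BalTensor.induction with
  | zero => rw [map_zero, map_zero, smul_zero]
  | pure c x =>
    rw [QTilde.contract_tmul, ← tmul_balanced, ratLeft_op_of_smul, QTilde.op_flip_smul hC,
      BalTensor.smul_tmul, ratRight_of_smul]
  | add x y hx hy => rw [map_add, map_add, smul_add, hx, hy]

theorem QTilde.contract_map (hC : IsWeaklyLocallyProjective Aᵐᵒᵖ C) (p : QTilde A C)
    {X Y : Type u} [AddCommGroup X] [Module (Dorroh (RatLeftDual A C)) X] [AddCommGroup Y]
    [Module (Dorroh (RatLeftDual A C)) Y] (f : X →ₗ[Dorroh (RatLeftDual A C)] Y)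
    (w : BalTensor (Dorroh (RatLeftDual A C)) C X) :
    p.contract hC Y (BalTensor.map LinearMap.id f w) = f (p.contract hC X w) := by
  induction w using BalTensor.induction with
  | zero => simp only [map_zero]
  | pure c x => rw [BalTensor.map_tmul, QTilde.contract_tmul, QTilde.contract_tmul, map_smul]; rfl
  | add x y hx hy => simp only [map_add, hx, hy]

/-- A trace unit writes w as Σ z_i ⊗ w_i, where the contractions w_i ∈ X are natural in X. If w dies
in C ⊗ Y, the w_i die in Y, hence already in X. -/
theorem HasTraceUnits.isFlatRight (hC : IsWeaklyLocallyProjective Aᵐᵒᵖ C)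
    (hu : HasTraceUnits A C) : IsFlatRight (RatLeftDual A C) C := by
  intro X Y _ _ _ _ f hf
  refine (injective_iff_map_eq_zero _).2 fun w hw => ?_
  obtain ⟨E, hE⟩ := exists_of_smul_eq w
  obtain ⟨y, hy⟩ := hu E
  rw [← hE _ hy]
  clear hy hE
  induction y using BalTensor.induction with
  | zero => rw [map_zero]; exact zero_smul _ w
  | pure z p =>
    rw [moritaMap_tmul, QTilde.of_apply_smul hC, hf (a₁ := p.contract hC X w) (a₂ := 0)
      (by rw [← QTilde.contract_map, hw, map_zero, map_zero]), map_zero]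
  | add x y hx hy => rw [map_add, Dorroh.of_add, add_smul, hx, hy, add_zero]

/-- A left `*C`-module as a left `Rat(*C)`-module. -/
@[reducible]
def ratLeftModule (N : Type*) [AddCommGroup N] [Module (LeftDual A C) N] :
    Module (Dorroh (RatLeftDual A C)) N :=
  Module.compHom N (Dorroh.toRing (RatLeftDual A C))

attribute [local instance] ratLeftModule

theorem of_smul_ratLeftModule {N : Type*} [AddCommGroup N] [Module (LeftDual A C) N]
    (s : RatLeftDual A C) (n : N) : Dorroh.of s • n = s.1 • n := by
  change Dorroh.toRing _ (Dorroh.of s) • n = _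
  rw [Dorroh.toRing_of]

/-- By density, tensoring C over Rat(*C) with a *C-module is already balanced over *C. -/
theorem tmul_op_smul (hd : RatLeftDualDense A C) {N : Type*} [AddCommGroup N]
    [Module (LeftDual A C) N] (f : LeftDual A C) (n : N) (c : C) :
    tmul (Dorroh (RatLeftDual A C)) (op f • c) n = tmul _ c (f • n) := by
  obtain ⟨s, hs, hc⟩ := hd.exists_smul_eq {c}
  have hc := hc c (Finset.mem_singleton_self c)
  conv_rhs => rw [← hc, ← ratLeft_op_of_smul ⟨s, hs⟩, tmul_balanced, of_smul_ratLeftModule,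
    smul_smul]
  conv_lhs => rw [← hc, smul_smul, ← MulOpposite.op_mul]
  rw [← ratLeft_op_of_smul ⟨s * f, RatLeftDual.mul_mem hs f⟩, tmul_balanced,
    of_smul_ratLeftModule]

theorem LeftDual.smul_one_mul_smul_one (a b : A) :
    (op a • (1 : LeftDual A C)) * (op b • 1) = op (a * b) • 1 := by
  rw [LeftDual.mul_smul_one, smul_smul, ← MulOpposite.op_mul]

/-- `(d, f) ↦ f(y r(d))`. -/
def coevalForm (r : RightDual A C) : C →+ C → LeftDual A C → LeftDual A C :=
  AddMonoidHom.mk' (fun y d f => op (f (op (r d) • y)) • (1 : LeftDual A C)) fun x y => by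
    funext d f
    rw [smul_add, map_add, MulOpposite.op_add, add_smul]
    rfl

/-- `x ⊗ y ↦ x ⊗ coevalForm r y`. -/
def coevalFormTensor (hd : RatLeftDualDense A C) (r : RightDual A C) :
    BalTensor A C C →+ BalTensor (Dorroh (RatLeftDual A C)) C (C → LeftDual A C → LeftDual A C) :=
  BalTensor.lift
    (AddMonoidHom.mk' (fun x => (tmul (Dorroh (RatLeftDual A C)) x).comp (coevalForm r))
      fun x x' => by rw [map_add, AddMonoidHom.add_comp])
    (fun x a y => by
      change tmul _ (op a • x) (coevalForm r y) = tmul _ x (coevalForm r (a • y))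
      rw [← LeftDual.smul_one_smul a x, tmul_op_smul hd]
      refine congrArg (tmul _ x) ?_
      funext d f
      change (op a • (1 : LeftDual A C)) * (op (f (op (r d) • y)) • 1) =
        op (f (op (r d) • a • y)) • (1 : LeftDual A C)
      rw [LeftDual.smul_one_mul_smul_one, ← smul_comm a (op (r d)), LeftDual.apply_smul])

theorem coevalFormTensor_tmul (hd : RatLeftDualDense A C) (r : RightDual A C) (x y : C) :
    coevalFormTensor hd r (tmul A x y) = tmul _ x (coevalForm r y) := rfl

/-- Mirror image of `tmul_eq_evalFormTensor`: a local unit s of c is moved across the tensor sign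
and expanded by its rationality witness. -/
theorem tmul_eq_coevalFormTensor (hC : IsWeaklyLocallyProjective A C)
    (hd : RatLeftDualDense A C) (r : RightDual A C) (c : C) :
    tmul (Dorroh (RatLeftDual A C)) c
      (fun (d : C) (f : LeftDual A C) => (op (r d) • (1 : LeftDual A C)) * f) =
    coevalFormTensor hd r (Coring.comul (A := A) c) := by
  obtain ⟨s, hs, hc⟩ := hd.exists_smul_eq {c}
  have hc := hc c (Finset.mem_singleton_self c)
  obtain ⟨u, hu⟩ := id hs
  let m : LeftDual A C →ₗ[Aᵐᵒᵖ] C :=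
    { toFun := fun g => op g • c
      map_add' := fun g h => add_smul (op g) (op h) c
      map_smul' := fun a g => by
        induction a using MulOpposite.rec' with
        | _ a =>
        rw [← LeftDual.mul_smul_one, MulOpposite.op_mul, mul_smul, LeftDual.smul_one_smul]; rfl }
  have h1 : BalTensor.map m LinearMap.id u = Coring.comul (A := A) c := by
    refine evalRight_injective hC fun g => ?_
    change _ = op g • c
    conv_rhs => rw [← hc, smul_smul, ← MulOpposite.op_mul, hu]
    clear hu
    induction u using BalTensor.induction with
    | zero => rw [map_zero, map_zero, map_zero, MulOpposite.op_zero, zero_smul]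
    | pure ρ x =>
      rw [BalTensor.map_tmul, evalRight_tmul, evalRight_tmul, ← map_smul]
      rfl
    | add x y hx hy => rw [map_add, map_add, map_add, MulOpposite.op_add, add_smul, hx, hy]
  have h2 : (fun (d : C) (f : LeftDual A C) => s * ((op (r d) • (1 : LeftDual A C)) * f)) =
      fun d f => evalRight ((op (r d) • (1 : LeftDual A C)) * f) u := by
    funext d f
    exact hu _
  have h3 : tmul (Dorroh (RatLeftDual A C)) c (fun (d : C) (f : LeftDual A C) =>
      evalRight ((op (r d) • (1 : LeftDual A C)) * f) u) =
      coevalFormTensor hd r (BalTensor.map m LinearMap.id u) := by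
    clear h1 h2 hu
    induction u using BalTensor.induction with
    | zero =>
      simp only [map_zero]
      exact map_zero (tmul _ c)
    | pure ρ x =>
      rw [BalTensor.map_tmul, coevalFormTensor_tmul]
      change _ = tmul _ (op ρ • c) (coevalForm r x)
      rw [tmul_op_smul hd]
      refine congrArg (tmul _ c) ?_
      funext d f
      change op (((op (r d) • (1 : LeftDual A C)) * f) x) • ρ =
        ρ * (op (f (op (r d) • x)) • (1 : LeftDual A C))
      rw [LeftDual.mul_smul_one, LeftDual.smul_one_mul_apply]
    | add x y hx hy =>
      rw [map_add, map_add, ← hx, ← hy, ← map_add]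
      refine congrArg (tmul _ c) ?_
      funext d f
      exact map_add _ _ _
  rw [← h1, ← h3, ← h2]
  conv_lhs => rw [← hc, tmul_op_smul hd]
  rfl

theorem exists_sum_tmul_eq_coevalFormTensor (hd : RatLeftDualDense A C) (r : RightDual A C)
    (z : BalTensor A C C) :
    ∃ E : Finset C, ∀ (B : Finset C) (g : C → RightDual A C),
      (∀ e ∈ E, e = ∑ x ∈ B, op (g x e) • x) →
      ∑ x ∈ B, tmul (Dorroh (RatLeftDual A C)) x (fun (d : C) (f : LeftDual A C) =>
        op (g x (evalRight f (op (r d) • z))) • (1 : LeftDual A C)) = coevalFormTensor hd r z := by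
  classical
  induction z using BalTensor.induction with
  | zero =>
    refine ⟨∅, fun B f _ => ?_⟩
    simp only [smul_zero, map_zero, zero_smul, MulOpposite.op_zero]
    exact Finset.sum_eq_zero fun x _ => map_zero (tmul _ x)
  | pure u v =>
    refine ⟨{u}, fun B g h => ?_⟩
    rw [coevalFormTensor_tmul]
    conv_rhs => rw [h u (Finset.mem_singleton_self u), map_sum, AddMonoidHom.finsetSum_apply]
    refine Finset.sum_congr rfl fun x _ => ?_
    rw [← LeftDual.smul_one_smul, tmul_op_smul hd]
    refine congrArg (tmul _ x) ?_
    funext d f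
    change op (g x (op (f (op (r d) • v)) • u)) • (1 : LeftDual A C) =
      (op (g x u) • (1 : LeftDual A C)) * (op (f (op (r d) • v)) • 1)
    rw [RightDual.apply_smul, LeftDual.smul_one_mul_smul_one]
  | add a b ha hb =>
    obtain ⟨E, hE⟩ := ha
    obtain ⟨E', hE'⟩ := hb
    refine ⟨E ∪ E', fun B f h => ?_⟩
    rw [map_add, ← hE B f fun e he => h e (Finset.mem_union_left _ he),
      ← hE' B f fun e he => h e (Finset.mem_union_right _ he), ← Finset.sum_add_distrib]
    refine Finset.sum_congr rfl fun x _ => ?_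
    rw [← map_add]
    refine congrArg (tmul _ x) ?_
    funext d f
    rw [smul_add, map_add, map_add, MulOpposite.op_add, add_smul]
    rfl

/-- The right-handed counterpart of `exists_sum_tmul_eq_zero`: for one summand c ⊗ r of t, both
halves of the defects give the image of Δ(c) under `coevalFormTensor`. -/
theorem exists_sum_tmul_coeval_eq_zero (hC : IsWeaklyLocallyProjective A C)
    (hd : RatLeftDualDense A C) (t : BalTensor A C (RightDual A C)) :
    ∃ E : Finset C, ∀ (B : Finset C) (g : C → RightDual A C),
      (∀ e ∈ E, e = ∑ x ∈ B, op (g x e) • x) →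
      ∑ x ∈ B, tmul (Dorroh (RatLeftDual A C)) x (fun (d : C) (f : LeftDual A C) =>
        (op (g x (evalAtRight d t)) • (1 : LeftDual A C)) * f -
          op (g x (op f • evalAtRight d t)) • (1 : LeftDual A C)) = 0 := by
  classical
  induction t using BalTensor.induction with
  | zero =>
    refine ⟨∅, fun B f _ => ?_⟩
    simp only [smul_zero, map_zero, zero_smul, zero_mul, sub_zero, MulOpposite.op_zero]
    exact Finset.sum_eq_zero fun x _ => map_zero (tmul _ x)
  | pure c r =>
    obtain ⟨E, hE⟩ := exists_sum_tmul_eq_coevalFormTensor hd r (Coring.comul (A := A) c)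
    refine ⟨insert c E, fun B g h => ?_⟩
    have h1 : ∑ x ∈ B, tmul (Dorroh (RatLeftDual A C)) x (fun (d : C) (f : LeftDual A C) =>
        (op (g x (op (r d) • c)) • (1 : LeftDual A C)) * f) =
        coevalFormTensor hd r (Coring.comul (A := A) c) := by
      rw [← tmul_eq_coevalFormTensor hC]
      conv_rhs => rw [h c (Finset.mem_insert_self c E), map_sum, AddMonoidHom.finsetSum_apply]
      refine Finset.sum_congr rfl fun x _ => ?_
      rw [← LeftDual.smul_one_smul, tmul_op_smul hd]
      refine congrArg (tmul _ x) ?_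
      funext d f
      change _ = (op (g x c) • (1 : LeftDual A C)) * ((op (r d) • (1 : LeftDual A C)) * f)
      rw [← mul_assoc, LeftDual.smul_one_mul_smul_one, RightDual.apply_smul]
    have h2 := hE B g fun e he => h e (Finset.mem_insert_of_mem he)
    rw [← sub_eq_zero.2 (h1.trans h2.symm), ← Finset.sum_sub_distrib]
    refine Finset.sum_congr rfl fun x _ => ?_
    rw [← map_sub]
    refine congrArg (tmul _ x) ?_
    funext d f
    change (op (g x (op (r d) • c)) • (1 : LeftDual A C)) * f -
      op (g x (evalRight f (Coring.comul (A := A) (op (r d) • c)))) • (1 : LeftDual A C) = _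
    rw [Coring.comul_op_smul]
    rfl
  | add a b ha hb =>
    obtain ⟨E, hE⟩ := ha
    obtain ⟨E', hE'⟩ := hb
    refine ⟨E ∪ E', fun B f h => ?_⟩
    have h1 := congrArg₂ (fun u v => u + v)
      (hE B f fun e he => h e (Finset.mem_union_left _ he))
      (hE' B f fun e he => h e (Finset.mem_union_right _ he))
    simp only [← Finset.sum_add_distrib, add_zero] at h1
    refine (Finset.sum_congr rfl fun x _ => ?_).trans h1
    rw [← map_add]
    refine congrArg (tmul _ x) ?_
    funext d f
    rw [map_add, map_add, MulOpposite.op_add, add_smul, add_mul, smul_add, map_add,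
      MulOpposite.op_add, add_smul, Pi.add_apply, Pi.add_apply]
    abel

variable (A C) in
/-- The obstruction `(d, f) ↦ θ(d) f - θ(d f)` to the right `*C`-linearity of `θ : C → *C`. -/
def rightLinearityDefect : (C →+ LeftDual A C) →ₗ[LeftDual A C]
    (C → LeftDual A C → LeftDual A C) where
  toFun θ d f := θ d * f - θ (op f • d)
  map_add' θ θ' := by
    funext d f
    simp only [AddMonoidHom.add_apply, Pi.add_apply, add_mul]
    abel
  map_smul' h θ := by
    funext d f
    change h * θ d * f - h * θ (op f • d) = h * (θ d * f - θ (op f • d))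
    rw [mul_sub, mul_assoc]

variable (A C) in
/-- The additive group of the endomorphisms `d ↦ △(y) d` of `C`. -/
def moritaEnd : AddSubgroup (C → C) :=
  (AddMonoidHom.mk' (fun (y : BalTensor (LeftDual A C) C (QTilde A C)) (d : C) =>
    (moritaMap A C y).1 • d) fun y y' => funext fun d => by
      rw [map_add]; exact add_smul _ _ d).range

/-- The map `c ⊗ [θ] ↦ (d ↦ c θ(d))`. -/
def coevalQuotient (hC : IsWeaklyLocallyProjective A C) :
    BalTensor (Dorroh (RatLeftDual A C)) C
      ((C →+ LeftDual A C) ⧸ LinearMap.ker (rightLinearityDefect A C)) →+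
      (C → C) ⧸ moritaEnd A C :=
  BalTensor.lift
    (AddMonoidHom.mk' (fun c => QuotientAddGroup.lift
        (LinearMap.ker (rightLinearityDefect A C)).toAddSubgroup
        ((QuotientAddGroup.mk' (moritaEnd A C)).comp (AddMonoidHom.mk'
          (fun (θ : C →+ LeftDual A C) (d : C) => op (θ d) • c) fun θ θ' => funext fun d =>
            add_smul (op (θ d)) (op (θ' d)) c))
        (fun θ hθ => by
          refine (QuotientAddGroup.eq_zero_iff _).2 ?_
          obtain ⟨p, -, hp⟩ := exists_qTilde hC θ fun f d =>
            (sub_eq_zero.1 (congrFun (congrFun hθ d) f)).symm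
          exact ⟨tmul _ c p, funext fun d => (hp d c).symm⟩))
      (fun c c' => AddMonoidHom.ext fun x => by
        obtain ⟨θ, rfl⟩ := QuotientAddGroup.mk_surjective x
        exact congrArg (QuotientAddGroup.mk' (moritaEnd A C))
          (funext fun d => smul_add (op (θ d)) c c')))
    (fun c b x => by
      obtain ⟨θ, rfl⟩ := QuotientAddGroup.mk_surjective x
      refine congrArg (QuotientAddGroup.mk' (moritaEnd A C)) (funext fun d => ?_)
      change op (θ d) • op (Dorroh.toRing _ b) • c = op (Dorroh.toRing _ b * θ d) • c
      rw [MulOpposite.op_mul, mul_smul])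

/-- Start from a rational local unit r of F. Its finite rank action, expanded in a dual basis, gives
additive maps θ_x whose defects satisfy Σ x ⊗ defect(θ_x) = 0. Flatness lifts this to Σ x ⊗ [θ_x] =
0 modulo linear maps, so d ↦ Σ x · θ_x(d) is the action of a trace, and it fixes F. -/
theorem IsFlatRight.hasTraceUnits (hf : IsFlatRight (RatLeftDual A C) C)
    (hA : IsWeaklyLocallyProjective A C) (hC : IsWeaklyLocallyProjective Aᵐᵒᵖ C)
    (hd : RatRightDualDense A C) (hS : RatLeftDualDense A C) : HasTraceUnits A C := by
  classical
  intro F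
  obtain ⟨r, hr, hF⟩ := hd.exists_smul_eq F
  obtain ⟨t, ht⟩ := id hr
  have ht' := smul_eq_evalAtRight hC ht
  obtain ⟨E, hE⟩ := exists_sum_tmul_coeval_eq_zero hA hS t
  obtain ⟨B, g, hB⟩ := exists_rightDualBasis hC (F ∪ E)
  have hE := hE B g fun e he => hB e (Finset.mem_union_right _ he)
  let θ : C → C →+ LeftDual A C := fun x => AddMonoidHom.mk'
    (fun d => op (g x (r • d)) • (1 : LeftDual A C))
    (fun d d' => by rw [smul_add, map_add, MulOpposite.op_add, add_smul])
  let K := LinearMap.ker (rightLinearityDefect A C)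
  -- The defect becomes injective modulo its kernel, so flatness can be applied to it.
  let δ : ((C →+ LeftDual A C) ⧸ K) →ₗ[LeftDual A C] _ := K.liftQ (rightLinearityDefect A C) le_rfl
  have hδ : Function.Injective δ :=
    LinearMap.ker_eq_bot.1 (Submodule.ker_liftQ_eq_bot _ _ _ le_rfl)
  let δ' : ((C →+ LeftDual A C) ⧸ K) →ₗ[Dorroh (RatLeftDual A C)]
      (C → LeftDual A C → LeftDual A C) :=
    { toFun := δ
      map_add' := map_add δ
      map_smul' := fun b x => δ.map_smul (Dorroh.toRing _ b) x }
  have h0 : ∑ x ∈ B, tmul (Dorroh (RatLeftDual A C)) x (Submodule.Quotient.mk (p := K) (θ x)) = 0 := by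
    refine hf _ _ δ' hδ ?_
    rw [map_sum, map_zero, ← hE]
    refine Finset.sum_congr rfl fun x _ => ?_
    rw [BalTensor.map_tmul, LinearMap.id_apply]
    refine congrArg (tmul _ x) ?_
    funext d f
    change (op (g x (r • d)) • (1 : LeftDual A C)) * f -
      op (g x (r • op f • d)) • (1 : LeftDual A C) = _
    rw [smul_comm r (op f) d, ht']
  -- The map c ⊗ [θ] ↦ (d ↦ c · θ(d)) is well defined only modulo actions of traces; the vanishing
  -- sum therefore exhibits d ↦ Σ x g_x(r · d) as such an action.
  have h1 := congrArg (coevalQuotient hA) h0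
  rw [map_sum, map_zero] at h1
  change ∑ x ∈ B, QuotientAddGroup.mk' (moritaEnd A C) (fun d => op (θ x d) • x) = 0 at h1
  rw [← map_sum] at h1
  obtain ⟨y, hy⟩ := (QuotientAddGroup.eq_zero_iff _).1 h1
  refine ⟨y, fun c hc => (congrFun hy c).trans ?_⟩
  rw [Finset.sum_apply]
  conv_rhs => rw [hB c (Finset.mem_union_left _ hc)]
  refine Finset.sum_congr rfl fun x _ => ?_
  change op (op (g x (r • c)) • (1 : LeftDual A C)) • x = _
  rw [LeftDual.smul_one_smul, hF c hc]

end Flat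

end QFCoring

/-! ### Assembly of the equivalences -/

theorem theorem4p4 {k : Type w} [CommRing k] {A C : Type u} [Ring A] [Algebra k A]
    [AddCommGroup C] [Module A C] [Module Aᵐᵒᵖ C] [SMulCommClass A Aᵐᵒᵖ C] [QFCoring.Coring A C]
    (hk : ∀ (x : k) (c : C),
      algebraMap k A x • c = (MulOpposite.op (algebraMap k A x) : Aᵐᵒᵖ) • c)
    (hC : QFCoring.IsWeaklyLocallyProjective A C) :
    List.TFAE [
      QFCoring.IsLeftLocallyQuasiFrobenius A C (algebraMap k A),
      QFCoring.IsWeaklyLocallyProjective Aᵐᵒᵖ C ∧ QFCoring.RatRightDualDense A C ∧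
        Function.Surjective (QFCoring.moritaMap A C),
      QFCoring.IsWeaklyLocallyProjective Aᵐᵒᵖ C ∧ QFCoring.RatRightDualDense A C ∧
        ∃ h : ∀ N : QFCoring.FirmRight (QFCoring.RatRightDual A C),
            QFCoring.IsFirmRight (QFCoring.RatLeftDual A C)
              (((QFCoring.IsFirmRight (QFCoring.RatRightDual A C)).ι ⋙
                QFCoring.tensorRat A C).obj N),
          ((QFCoring.IsFirmRight (QFCoring.RatLeftDual A C)).lift
            ((QFCoring.IsFirmRight (QFCoring.RatRightDual A C)).ι ⋙
              QFCoring.tensorRat A C) h).Full ∧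
          ((QFCoring.IsFirmRight (QFCoring.RatLeftDual A C)).lift
            ((QFCoring.IsFirmRight (QFCoring.RatRightDual A C)).ι ⋙
              QFCoring.tensorRat A C) h).Faithful ] ∧
    (QFCoring.IsWeaklyLocallyProjective Aᵐᵒᵖ C → QFCoring.RatRightDualDense A C →
      Function.Surjective (QFCoring.moritaMap A C) →
        Function.Bijective (QFCoring.moritaMap A C)) ∧
    (QFCoring.RatLeftDualDense A C → List.TFAE [
      QFCoring.IsLeftLocallyQuasiFrobenius A C (algebraMap k A),
      QFCoring.IsWeaklyLocallyProjective Aᵐᵒᵖ C ∧ QFCoring.RatRightDualDense A C ∧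
        ((QFCoring.IsFirmRight (QFCoring.RatRightDual A C)).ι ⋙
          QFCoring.tensorComodule A C).Full ∧
        ((QFCoring.IsFirmRight (QFCoring.RatRightDual A C)).ι ⋙
          QFCoring.tensorComodule A C).Faithful,
      QFCoring.IsWeaklyLocallyProjective Aᵐᵒᵖ C ∧ QFCoring.RatRightDualDense A C ∧
        CategoryTheory.IsSeparator (QFCoring.LeftComodule.regular A C),
      QFCoring.IsWeaklyLocallyProjective Aᵐᵒᵖ C ∧ QFCoring.RatRightDualDense A C ∧
        QFCoring.IsFlatRight (QFCoring.RatLeftDual A C) C,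
      QFCoring.IsWeaklyLocallyProjective Aᵐᵒᵖ C ∧ QFCoring.RatRightDualDense A C ∧
        (QFCoring.comoduleHom A C).Full ∧ (QFCoring.comoduleHom A C).Faithful,
      QFCoring.IsWeaklyLocallyProjective Aᵐᵒᵖ C ∧ QFCoring.RatRightDualDense A C ∧
        ∃ h : ∀ M : QFCoring.LeftComodule A C,
            QFCoring.IsFirmLeft (QFCoring.RatLeftDual A C)
              ((QFCoring.firmComoduleHom A C).obj M),
          ((QFCoring.IsFirmLeft (QFCoring.RatLeftDual A C)).lift
            (QFCoring.firmComoduleHom A C) h).Full ∧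
          ((QFCoring.IsFirmLeft (QFCoring.RatLeftDual A C)).lift
            (QFCoring.firmComoduleHom A C) h).Faithful ]) := by
  have hQF : QFCoring.IsWeaklyLocallyProjective Aᵐᵒᵖ C → QFCoring.HasTraceUnits A C →
      QFCoring.IsLeftLocallyQuasiFrobenius A C (algebraMap k A) := fun hC' hu =>
    hu.isLeftLocallyQuasiFrobenius hk hC'
  refine ⟨?_, fun hC' hd hs =>
    ⟨QFCoring.moritaMap_injective hC' (.of_surjective hd hs), hs⟩, fun hS => ?_⟩
  · tfae_have 1 → 3 := fun h => by
      obtain ⟨hu, hC'⟩ := h.hasTraceUnits hC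
      exact ⟨hC', hu.dense, hu.tensorRat_fullyFaithful hC'⟩
    -- Well-definedness of the functor supplies C = C · Rat(*C), which the test module argument
    -- needs alongside faithfulness.
    tfae_have 3 → 2 := fun ⟨hC', hd, h, _, hf⟩ => ⟨hC', hd,
      (QFCoring.tensorFaithful_of_tensorRat_faithful h hf).surjective hC hC' hd
        (QFCoring.mulRight_surjective_of_tensorRat_firm hd h)⟩
    tfae_have 2 → 1 := fun ⟨hC', hd, hs⟩ => hQF hC' (.of_surjective hd hs)
    tfae_finish
  · have hsep : QFCoring.IsWeaklyLocallyProjective Aᵐᵒᵖ C → QFCoring.RatRightDualDense A C →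
        CategoryTheory.IsSeparator (QFCoring.LeftComodule.regular A C) →
        QFCoring.IsLeftLocallyQuasiFrobenius A C (algebraMap k A) := fun hC' hd h =>
      hQF hC' (.of_surjective hd (QFCoring.surjective_of_isSeparator hC' h))
    tfae_have 1 → 2 := fun h => by
      obtain ⟨hu, hC'⟩ := h.hasTraceUnits hC
      exact ⟨hC', hu.dense, hu.tensorComodule_fullyFaithful hC'⟩
    -- Here density of Rat(*C) supplies C = C · Rat(*C).
    tfae_have 2 → 1 := fun ⟨hC', hd, _, hf⟩ => hQF hC' <| .of_surjective hd <|
      (QFCoring.tensorFaithful_of_tensorComodule_faithful hf).surjective hC hC' hd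
        hS.mulRight_surjective
    tfae_have 1 → 3 := fun h => by
      obtain ⟨hu, hC'⟩ := h.hasTraceUnits hC
      exact ⟨hC', hu.dense, hu.isSeparator hC'⟩
    tfae_have 3 → 1 := fun ⟨hC', hd, h⟩ => hsep hC' hd h
    tfae_have 1 → 4 := fun h => by
      obtain ⟨hu, hC'⟩ := h.hasTraceUnits hC
      exact ⟨hC', hu.dense, hu.isFlatRight hC'⟩
    tfae_have 4 → 1 := fun ⟨hC', hd, h⟩ => hQF hC' (h.hasTraceUnits hC hC' hd hS)
    tfae_have 1 → 5 := fun h => by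
      obtain ⟨hu, hC'⟩ := h.hasTraceUnits hC
      exact ⟨hC', hu.dense, hu.comoduleHom_fullyFaithful hC'⟩
    tfae_have 5 → 1 := fun ⟨hC', hd, _, hf⟩ =>
      hsep hC' hd (QFCoring.isSeparator_of_comoduleHom_faithful hf)
    tfae_have 1 → 6 := fun h => by
      obtain ⟨hu, hC'⟩ := h.hasTraceUnits hC
      exact ⟨hC', hu.dense, hu.firmComoduleHom_fullyFaithful hC' hS⟩
    tfae_have 6 → 1 := fun ⟨hC', hd, h, _, hf⟩ =>
      hsep hC' hd (QFCoring.isSeparator_of_firmComoduleHom_faithful h hf)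
    tfae_finish
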